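/- **Setting.** Let $s\ge 1$ and $n\ge 2$ be integers, $0<\tau\le\beta$ and $\theta>0$; if $\tau=\beta$, assume in addition $\theta<1/\beta$. Put $$c_\beta=\frac{1}{2\beta^{1/\beta}\Gamma(1+1/\beta)},\qquad \varphi_\beta(y)=c_\beta e^{-|y|^\beta/\beta},\qquad \Phi_\beta(x)=\int_{-\infty}^x\varphi_\beta(t)\,dt,\qquad \psi^2(x)=e^{-\theta|x|^\tau},$$ and let $\Phi_\beta^{-1}$ (applied componentwise to vectors) be the inverse of $\Phi_\beta$. Let $\gamma=(\gamma_{\mathfrak u})_{\mathfrak u\subseteq\{1:s\}}$ be positive weights, where $\{1:s\}=\{1,\dots,s\}$ and $-\mathfrak u=\{1:s\}\setminus\mathfrak u$. The weighted Sobolev space consists of the continuous functions $F:\mathbb R^s\to\mathbb R$ that are integrable with respect to $\prod_{j=1}^s\varphi_\beta(y_j)\,dy$, have weak mixed first derivatives $\partial^{|\mathfrak u|}F/\partial y_{\mathfrak u}\in L^1_{\rm loc}(\mathbb R^s)$ for all $\mathfrak u\subseteq\{1:s\}$, and for which all integrals in $$\|F\|_{s,\gamma}^2=\sum_{\mathfrak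 u\subseteq\{1:s\}}\frac1{\gamma_{\mathfrak u}}\int_{\mathbb R^{|\mathfrak u|}}\Big(\int_{\mathbb R^{s-|\mathfrak u|}}\frac{\partial^{|\mathfrak u|}F}{\partial y_{\mathfrak u}}(y)\prod_{j\in-\mathfrak u}\varphi_\beta(y_j)\,dy_{-\mathfrak u}\Big)^2\prod_{j\in\mathfrak u}\psi^2(y_j)\,dy_{\mathfrak u}$$ exist and are finite (the inner ones for almost every $y_{\mathfrak u}$). Let $I_s(F)=\int_{\mathbb R^s}F(y)\prod_{j=1}^s\varphi_\beta(y_j)\,dy$ and, for $z\in\{1,\dots,n-1\}^s$ and a shift $\Delta$ uniformly distributed on $[0,1]^s$, $$Q^{\Delta}_{s,n}(F)=\frac1n\sum_{i=1}^nF\big(\Phi_\beta^{-1}(\{t_i+\Delta\})\big),\qquad t_i=\Big\{\frac{iz}{n}\Big\},$$ with $\{\cdot\}$ the componentwise fractional part. **CBC algorithm.** For $d=1,\dots,s$ in turn, with $z_1,\dots,z_{d-1}$ kept fixed, choose $z_d\in\{c\in\{1,\dots,n-1\}:\gcd(c,n)=1\}$ minimising the squared shift-averaged worst-case error $$e_d^2(z_1,\dots,z_d)=\sum_{\varnothing\ne\mathfrak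 u\subseteq\{1:d\}}\gamma_{\mathfrak u}\,\frac1n\sum_{i=1}^n\prod_{j\in\mathfrak u}\vartheta\Big(\Big\{\frac{iz_j}{n}\Big\}\Big),$$ $$\vartheta(x)=\int_{\mathbb R}\frac{\max(\Phi_\beta(t)-x,0)+\max(\Phi_\beta(t)-1+x,0)-\Phi_\beta(t)^2}{\psi^2(t)}\,dt ,\qquad x\in[0,1).$$ **Theorem.** The CBC algorithm has an output, and every vector $z$ that it can produce (whatever the choice among minimisers) has the following property. For every $F$ in the weighted Sobolev space, $\Delta\mapsto|I_s(F)-Q^\Delta_{s,n}(F)|^2$ is integrable on $[0,1]^s$; and for every $r$ with $\tfrac12<r<1$ if $\tau<\beta$, respectively $\tfrac12<r<1-\tfrac{\theta\beta}2$ if $\tau=\beta$, and for all $\lambda\in(\tfrac1{2r},1]$, $$\sqrt{\mathbb E_\Delta|I_s(F)-Q^\Delta_{s,n}(F)|^2}\le\Big(\frac1{\phi(n)}\sum_{\varnothing\ne\mathfrak u\subseteq\{1:s\}}\gamma_{\mathfrak u}^\lambda K^{\lambda|\mathfrak u|}(2\zeta(2r\lambda))^{|\mathfrak u|}\Big)^{1/(2\lambda)}\|F\|_{s,\gamma},$$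 where $\phi$ is Euler's totient function, $\zeta$ the Riemann zeta function and, with $$B=\frac{4\pi^{-2r}}{(2r)(2-2r)c_\beta},\qquad \varepsilon=\sqrt{1+2(1-r)}-1,\qquad Y=\exp\Big(\Big(\frac\varepsilon\tau\Big)^{1-\frac\beta{\beta-\tau}}\frac{\beta-\tau}\beta\,\theta^{\frac\beta{\beta-\tau}}\Big),$$ the constant $K$ is * $\displaystyle K=\frac{B\,Y}{(2\Gamma(\frac1\beta))^{1+2(1-r)}}\Big(\frac{1-\beta}{e\beta\varepsilon}\Big)^{\frac{(1-\beta)(1+2(1-r))}\beta}(1+\varepsilon)^{\frac{1+2(1-r)}\beta}$ if $0<\tau<\beta<1$; * $\displaystyle K=\frac{B}{(2\Gamma(\frac1\beta))^{3-2r}}\Big(\frac{1-\beta}{e\beta}\,\frac{1+\beta\theta}{3-2r-1-\beta\theta}\Big)^{\frac{(1-\beta)(3-2r)}\beta}\Big(\frac{3-2r}{1+\beta\theta}\Big)^{\frac{3-2r}\beta}$ if $0<\tau=\beta<1$; * $K=B\,Y$ if $\tau<\beta$ and $\beta\ge1$; * $K=B$ if $1\le\tau=\beta$. -/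

import Mathlib

open MeasureTheory

noncomputable section

namespace LatticeQMC

/-! ### The univariate `β`-Gaussian distribution -/

/-- The normalising constant `c_β = 1 / (2 β^{1/β} Γ(1 + 1/β))`. -/
def normConst (β : ℝ) : ℝ := 1 / (2 * β ^ (1 / β) * Real.Gamma (1 + 1 / β))

/-- The `β`-Gaussian density `φ_β(y) = c_β exp(-|y|^β / β)`. -/
def density (β y : ℝ) : ℝ := normConst β * Real.exp (-(|y| ^ β) / β)

/-- The distribution function `Φ_β`. -/
def distFun (β x : ℝ) : ℝ := ∫ t in Set.Iic x, density β t

/-- The inverse `Φ_β⁻¹` of the distribution function on `(0,1)` (the quantile function). -/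
def quantile (β w : ℝ) : ℝ := sInf {x : ℝ | w ≤ distFun β x}

/-- The squared weight function `ψ²(x) = exp(-θ |x|^τ)`. -/
def psiSq (θ τ x : ℝ) : ℝ := Real.exp (-(θ * |x| ^ τ))

/-! ### Weak mixed derivatives and the weighted Sobolev space on `ℝ^s` -/

/-- The partial derivative `∂v/∂y_j`. -/
def partialDeriv {s : ℕ} (j : Fin s) (v : (Fin s → ℝ) → ℝ) : (Fin s → ℝ) → ℝ :=
  fun y => fderiv ℝ v y (Pi.single j 1)

/-- The mixed first derivative `∂^{|u|} v / ∂y_u` of a smooth function. -/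
def mixedPartial {s : ℕ} (u : Finset (Fin s)) (v : (Fin s → ℝ) → ℝ) : (Fin s → ℝ) → ℝ :=
  (u.sort (· ≤ ·)).foldr partialDeriv v

/-- `g` is a weak (distributional) derivative `∂^{|u|} F / ∂y_u` of `F` on `ℝ^s`. -/
def IsWeakMixedDeriv {s : ℕ} (u : Finset (Fin s)) (F g : (Fin s → ℝ) → ℝ) : Prop :=
  LocallyIntegrable g volume ∧
  ∀ v : (Fin s → ℝ) → ℝ, ContDiff ℝ ((⊤ : ℕ∞) : WithTop ℕ∞) v → HasCompactSupport v →
    ∫ y, F y * mixedPartial u v y = (-1) ^ u.card * ∫ y, g y * v y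

open Classical in
/-- The weak derivative `∂^{|u|} F / ∂y_u` (unique up to null sets; `0` if there is none). -/
def weakMixedDeriv {s : ℕ} (u : Finset (Fin s)) (F : (Fin s → ℝ) → ℝ) : (Fin s → ℝ) → ℝ :=
  if h : ∃ g, IsWeakMixedDeriv u F g then Classical.choose h else 0

/-- The point `y ∈ ℝ^s` with components `y_u` in `u` and `y_{-u}` outside `u`. -/
def glue {s : ℕ} (u : Finset (Fin s)) (a : {j // j ∈ u} → ℝ) (b : {j // j ∉ u} → ℝ) :
    Fin s → ℝ :=
  fun j => if h : j ∈ u then a ⟨j, h⟩ else b ⟨j, h⟩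

/-- The integrand `∂^{|u|}F/∂y_u (y) ∏_{j ∉ u} φ_β(y_j)` of the inner integral of the norm. -/
def innerIntegrand {s : ℕ} (β : ℝ) (u : Finset (Fin s)) (F : (Fin s → ℝ) → ℝ)
    (a : {j // j ∈ u} → ℝ) (b : {j // j ∉ u} → ℝ) : ℝ :=
  weakMixedDeriv u F (glue u a b) * ∏ j, density β (b j)

/-- The integrand of the outer integral (over `y_u`) of the norm. -/
def outerIntegrand {s : ℕ} (β θ τ : ℝ) (u : Finset (Fin s)) (F : (Fin s → ℝ) → ℝ)
    (a : {j // j ∈ u} → ℝ) : ℝ :=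
  (∫ b, innerIntegrand β u F a b) ^ 2 * ∏ j, psiSq θ τ (a j)

/-- The weighted Sobolev space: continuous functions on `ℝ^s`, integrable with respect to the
product `β`-Gaussian measure, whose weak mixed first derivatives exist and for which all the
integrals in the norm exist and are finite. (For positive weights the space does not depend on
the weights.) -/
structure MemSobolev {s : ℕ} (β θ τ : ℝ) (F : (Fin s → ℝ) → ℝ) : Prop where
  continuous : Continuous F
  integrable : Integrable (fun y : Fin s → ℝ => F y * ∏ j, density β (y j))
  exists_deriv : ∀ u : Finset (Fin s), ∃ g, IsWeakMixedDeriv u F g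
  inner_integrable : ∀ u : Finset (Fin s), ∀ᵐ a, Integrable (innerIntegrand β u F a)
  outer_integrable : ∀ u : Finset (Fin s), Integrable (outerIntegrand β θ τ u F)

/-- The norm `‖F‖_{s,γ}`. -/
def sobolevNorm {s : ℕ} (β θ τ : ℝ) (γ : Finset (Fin s) → ℝ) (F : (Fin s → ℝ) → ℝ) : ℝ :=
  Real.sqrt (∑ u : Finset (Fin s), 1 / γ u * ∫ a, outerIntegrand β θ τ u F a)

/-! ### The integral and randomly shifted rank-1 lattice rules -/

/-- `I_s(F)`, the integral of `F` against the product `β`-Gaussian density. -/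
def integralS {s : ℕ} (β : ℝ) (F : (Fin s → ℝ) → ℝ) : ℝ :=
  ∫ y : Fin s → ℝ, F y * ∏ j, density β (y j)

/-- The lattice point `t_i = {i z / n}`. -/
def latticePoint {s : ℕ} (n : ℕ) (z : Fin s → ℕ) (i : ℕ) : Fin s → ℝ :=
  fun j => Int.fract ((i : ℝ) * z j / n)

/-- The lattice rule with generating vector `z` and shift `Δ`, mapped to `ℝ^s` by `Φ_β⁻¹`. -/
def latticeRule {s : ℕ} (β : ℝ) (n : ℕ) (z : Fin s → ℕ) (Δ : Fin s → ℝ)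
    (F : (Fin s → ℝ) → ℝ) : ℝ :=
  1 / n * ∑ i ∈ Finset.Icc 1 n,
    F (fun j => quantile β (Int.fract (latticePoint n z i j + Δ j)))

/-! ### The component-by-component (CBC) algorithm -/

/-- The univariate shift-averaged kernel
`ϑ(x) = ∫ ((Φ_β(t) - x)₊ + (Φ_β(t) - (1 - x))₊ - Φ_β(t)²) / ψ²(t) dt`, `x ∈ [0,1)`; it is
`∫₀¹ η(Φ_β⁻¹(w), Φ_β⁻¹({w + x})) dw` for the kernel
`η(x, y) = ∫ (Φ_β(t) - 1_{t > x}) (Φ_β(t) - 1_{t > y}) / ψ²(t) dt`, where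
`∑ u, γ_u ∏_{j ∈ u} η(x_j, y_j)` is the reproducing kernel of the weighted Sobolev space. -/
def shiftKernel (β θ τ x : ℝ) : ℝ :=
  ∫ t : ℝ, (max (distFun β t - x) 0 + max (distFun β t - (1 - x)) 0 - distFun β t ^ 2)
    / psiSq θ τ t

/-- The squared shift-averaged worst-case error of the lattice rule in the first `d` dimensions
(the components with index at most `d` in the zero-based indexing),
`∑_{∅ ≠ u} γ_u (1/n) ∑_{i=1}^n ∏_{j ∈ u} ϑ({i z_j / n})`. -/
def sqWorstCaseError {s : ℕ} (β θ τ : ℝ) (γ : Finset (Fin s) → ℝ) (n : ℕ) (z : Fin s → ℕ)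
    (d : Fin s) : ℝ :=
  ∑ u ∈ (Finset.Iic d).powerset.erase ∅,
    γ u * (1 / n * ∑ i ∈ Finset.Icc 1 n, ∏ j ∈ u, shiftKernel β θ τ (latticePoint n z i j))

/-- The candidates `{c ∈ {1, …, n-1} : gcd(c, n) = 1}` for a component. -/
def candidates (n : ℕ) : Finset ℕ := (Finset.Icc 1 (n - 1)).filter (fun c => c.Coprime n)

/-- `z` is an output of the CBC algorithm: for `d = 1, …, s` in turn, with `z_1, …, z_{d-1}`
kept fixed, `z_d` is chosen among the candidates so as to minimise the squared shift-averaged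
worst-case error in the first `d` dimensions. -/
def IsCBC {s : ℕ} (β θ τ : ℝ) (γ : Finset (Fin s) → ℝ) (n : ℕ) (z : Fin s → ℕ) : Prop :=
  ∀ d : Fin s, z d ∈ candidates n ∧
    ∀ c ∈ candidates n,
      sqWorstCaseError β θ τ γ n z d ≤ sqWorstCaseError β θ τ γ n (Function.update z d c) d

/-! ### The constant `K` -/

/-- The factor `exp((ε/τ)^{1-β/(β-τ)} ((β-τ)/β) θ^{β/(β-τ)})` with `ε = √(1+2(1-r)) - 1`. -/
def youngFactor (β θ τ r : ℝ) : ℝ :=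
  Real.exp (((Real.sqrt (1 + 2 * (1 - r)) - 1) / τ) ^ (1 - β / (β - τ))
    * ((β - τ) / β) * θ ^ (β / (β - τ)))

/-- The factor `4 π^{-2r} / ((2r)(2-2r) c_β)` common to all cases. -/
def baseConst (β r : ℝ) : ℝ :=
  4 * Real.pi ^ (-(2 * r)) / ((2 * r) * (2 - 2 * r) * normConst β)

/-- `K` for `0 < τ < β < 1`. -/
def constLtSmall (β θ τ r : ℝ) : ℝ :=
  baseConst β r * youngFactor β θ τ r
    * (1 / (2 * Real.Gamma (1 / β)) ^ (1 + 2 * (1 - r)))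
    * ((1 - β) / (Real.exp 1 * β * (Real.sqrt (1 + 2 * (1 - r)) - 1)))
        ^ ((1 - β) * (1 + 2 * (1 - r)) / β)
    * Real.sqrt (1 + 2 * (1 - r)) ^ ((1 + 2 * (1 - r)) / β)

/-- `K` for `0 < τ = β < 1`. -/
def constEqSmall (β θ r : ℝ) : ℝ :=
  baseConst β r
    * (1 / (2 * Real.Gamma (1 / β)) ^ (3 - 2 * r))
    * ((1 - β) / (Real.exp 1 * β) * ((1 + β * θ) / (3 - 2 * r - 1 - β * θ)))
        ^ ((1 - β) * (3 - 2 * r) / β)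
    * ((3 - 2 * r) / (1 + β * θ)) ^ ((3 - 2 * r) / β)

/-- The constant `K` in the four cases. -/
def constK (β θ τ r : ℝ) : ℝ :=
  if τ < β then
    if β < 1 then constLtSmall β θ τ r else baseConst β r * youngFactor β θ τ r
  else
    if β < 1 then constEqSmall β θ r else baseConst β r

end LatticeQMC

end

open LatticeQMC

/-! ### The `β`-Gaussian distribution function and its tails -/

namespace LatticeQMC
open Set Filter Topology

/-! The argument has an analytic half, valid for every generating vector, and an arithmetic half,
which exploits the choices made by the algorithm.

Analytic half. Almost everywhere, F(y) = I(F) + ∑_{V ≠ ∅} ∫ D_V(b) ∏_{j ∈ V} κ(y_j, b_j) ∏_{j ∉ V}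
φ(b_j) db, where D_V is ∂^V F averaged over the coordinates outside V and κ(y, t) = Φ(t) - 1_{y ≤ t}
(`MemSobolev.ae_eq_integralS_add`). The proof works with weak derivatives throughout: by downward
induction on |u|, the difference between ∂^u F and its claimed expansion has vanishing weak
derivatives in the coordinates outside u, so it equals its own average over them, and that average
is zero. A uniform shift turns lattice points into points with density φ (`ae_shiftPoint`), so the
formula may be evaluated at shifted points although it holds only almost everywhere. Cauchy–Schwarz,
in the integrals with the weights of the norm and over V with the weights γ_V, bounds the error at a
fixed shift. Integrating over the shift leaves ‖F‖² times the weighted sum of the lattice means of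
products of ϑ (`MemSobolev.integral_sq_error_le`), which is the quantity the algorithm minimises.

Arithmetic half. The Fourier coefficients of ϑ are nonnegative, vanish at h = 0 and are at most
K|h|^{-2r} (`hasSum_shiftKernel`, `shiftCoeff_le`). Each is an integral of (sin(πhΦ)/(πh))²/ψ²; tail
estimates for Φ trade 1/ψ² for a multiple of φ(t)Φ(-t)^{-(3-2r)}, and the substitution v = Φ(-t)
makes the integral explicit, which produces K. By orthogonality of characters, a lattice mean is a
sum of products of these coefficients over the dual lattice, and the subadditive map x ↦ x^λ can be
applied term by term. Summed over all candidates c for one component, the terms with hc congruent to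
a fixed residue contribute no more than the full sum over h (`sum_candidates_resSum_le`), so
averaging over the candidates gains the factor 1/φ(n). A minimiser is no worse than this average,
and adding one dimension at a time gives the bound (`sum_weightedMean_rpow_le`). -/

lemma normConst_pos {β : ℝ} (hβ : 0 < β) : 0 < normConst β := by
  unfold normConst
  have : 0 < Real.Gamma (1 + 1 / β) := Real.Gamma_pos_of_pos (by positivity)
  positivity

lemma density_pos {β : ℝ} (hβ : 0 < β) (y : ℝ) : 0 < density β y :=
  mul_pos (normConst_pos hβ) (Real.exp_pos _)

lemma density_neg (β y : ℝ) : density β (-y) = density β y := by simp [density]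

lemma continuous_density {β : ℝ} (hβ : 0 < β) : Continuous (density β) := by
  unfold density
  have : Continuous fun y : ℝ => |y| ^ β := continuous_abs.rpow_const fun _ => Or.inr hβ.le
  fun_prop

lemma integrable_exp_neg_mul_abs_rpow {β b : ℝ} (hβ : 0 < β) (hb : 0 < b) :
    Integrable fun y : ℝ => Real.exp (-(b * |y| ^ β)) := by
  have h := integrableOn_rpow_mul_exp_neg_mul_rpow (p := β) (s := 0) (b := b) (by norm_num) hβ hb
  have h2 : IntegrableOn (fun y : ℝ => Real.exp (-(b * |y| ^ β))) (Ioi 0) := by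
    refine h.congr_fun (fun x hx => ?_) measurableSet_Ioi
    simp [abs_of_pos (mem_Ioi.1 hx)]
  have h3 : IntegrableOn (fun y : ℝ => Real.exp (-(b * |y| ^ β))) (Iic 0) := by
    rw [← Measure.map_neg_eq_self (volume : Measure ℝ)]
    let m : MeasurableEmbedding fun x : ℝ => -x := (Homeomorph.neg ℝ).measurableEmbedding
    rw [m.integrableOn_map_iff]
    simp_rw [Function.comp_def, abs_neg, neg_preimage, neg_Iic, neg_zero]
    exact Iff.mpr integrableOn_Ici_iff_integrableOn_Ioi h2
  rw [← integrableOn_univ, ← Iic_union_Ioi (a := (0:ℝ))]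
  exact h3.union h2

lemma integrable_density {β : ℝ} (hβ : 0 < β) : Integrable (density β) := by
  unfold density
  refine ((integrable_exp_neg_mul_abs_rpow hβ (inv_pos.2 hβ)).const_mul (normConst β)).congr ?_
  refine Eventually.of_forall fun x => ?_
  simp only
  congr 2; field_simp

lemma integral_Ioi_exp {β : ℝ} (hβ : 0 < β) :
    ∫ y in Ioi (0 : ℝ), Real.exp (-(y ^ β) / β) = (2 * normConst β)⁻¹ := by
  have h := integral_exp_neg_mul_rpow hβ (inv_pos.2 hβ)
  have : ∀ y : ℝ, -(y ^ β) / β = -β⁻¹ * y ^ β := fun y => by field_simp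
  simp_rw [this, h, normConst]
  have hG : 0 < Real.Gamma (1 + 1 / β) := Real.Gamma_pos_of_pos (by positivity)
  rw [Real.inv_rpow hβ.le, ← Real.rpow_neg hβ.le, neg_div, neg_neg, add_comm]
  have : 0 < β ^ (1 / β) := by positivity
  field_simp

lemma integral_Ioi_density {β : ℝ} (hβ : 0 < β) : ∫ y in Ioi (0 : ℝ), density β y = 1 / 2 := by
  have h : ∫ y in Ioi (0 : ℝ), density β y
      = ∫ y in Ioi (0 : ℝ), normConst β * Real.exp (-(y ^ β) / β) :=
    setIntegral_congr_fun measurableSet_Ioi fun x hx => by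
      simp only [density, abs_of_pos (mem_Ioi.1 hx)]
  rw [h, integral_const_mul, integral_Ioi_exp hβ]
  have := normConst_pos hβ
  field_simp

lemma integral_density {β : ℝ} (hβ : 0 < β) : ∫ y, density β y = 1 := by
  have h := integral_comp_abs (f := density β)
  simp only [density, abs_abs] at h
  have h2 := integral_Ioi_density hβ
  simp only [density] at h2 ⊢
  rw [h, h2]; norm_num

lemma distFun_neg {β : ℝ} (hβ : 0 < β) (x : ℝ) : distFun β (-x) = 1 - distFun β x := by
  have h1 : distFun β (-x) = ∫ t in Ioi x, density β t := by
    have := integral_comp_neg_Iic (-x) (density β)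
    simp only [density_neg, neg_neg] at this
    exact this
  rw [h1, ← integral_density hβ, distFun,
    ← intervalIntegral.integral_Iic_add_Ioi (integrable_density hβ).integrableOn
      (integrable_density hβ).integrableOn]
  ring

lemma distFun_sub {β : ℝ} (hβ : 0 < β) (x y : ℝ) :
    distFun β y - distFun β x = ∫ t in x..y, density β t :=
  intervalIntegral.integral_Iic_sub_Iic (integrable_density hβ).integrableOn
    (integrable_density hβ).integrableOn

lemma distFun_zero {β : ℝ} (hβ : 0 < β) : distFun β 0 = 1 / 2 := by
  have := distFun_neg hβ 0
  rw [neg_zero] at this; linarith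

lemma hasDerivAt_distFun {β : ℝ} (hβ : 0 < β) (x : ℝ) :
    HasDerivAt (distFun β) (density β x) x := by
  have h : distFun β = fun y => (∫ t in (0:ℝ)..y, density β t) + 1 / 2 := by
    funext y; rw [← distFun_sub hβ, distFun_zero hβ]; ring
  rw [h]
  exact (((continuous_density hβ).integral_hasStrictDerivAt 0 x).hasDerivAt).add_const _

lemma continuous_distFun {β : ℝ} (hβ : 0 < β) : Continuous (distFun β) :=
  continuous_iff_continuousAt.2 fun x => (hasDerivAt_distFun hβ x).continuousAt

lemma strictMono_distFun {β : ℝ} (hβ : 0 < β) : StrictMono (distFun β) :=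
  strictMono_of_deriv_pos fun x => by
    rw [(hasDerivAt_distFun hβ x).deriv]; exact density_pos hβ x

lemma tendsto_distFun_atTop {β : ℝ} (hβ : 0 < β) : Tendsto (distFun β) atTop (𝓝 1) := by
  rw [← integral_density hβ]
  exact (aecover_Iic tendsto_id).integral_tendsto_of_countably_generated (integrable_density hβ)

lemma tendsto_distFun_atBot {β : ℝ} (hβ : 0 < β) : Tendsto (distFun β) atBot (𝓝 0) := by
  have h := ((tendsto_distFun_atTop hβ).comp tendsto_neg_atBot_atTop).const_sub 1
  rw [sub_self] at h
  refine h.congr fun x => ?_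
  simp [distFun_neg hβ]

lemma distFun_pos {β : ℝ} (hβ : 0 < β) (x : ℝ) : 0 < distFun β x := by
  have h := (strictMono_distFun hβ).monotone.le_of_tendsto (tendsto_distFun_atBot hβ) (x - 1)
  exact h.trans_lt (strictMono_distFun hβ (by linarith))

lemma distFun_lt_one {β : ℝ} (hβ : 0 < β) (x : ℝ) : distFun β x < 1 := by
  have h := distFun_pos hβ (-x)
  rw [distFun_neg hβ] at h; linarith

/-- By continuity and strict monotonicity the set in the infimum is a closed half-line. Apart from
measurability, this equivalence is all that is used about the quantile, so no inverse function has
to be handled. -/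
lemma quantile_le_iff {β : ℝ} (hβ : 0 < β) {w : ℝ} (h0 : 0 < w) (h1 : w < 1) (a : ℝ) :
    quantile β w ≤ a ↔ w ≤ distFun β a := by
  obtain ⟨x, hx⟩ : ∃ x, distFun β x = w :=
    mem_range_of_exists_le_of_exists_ge (continuous_distFun hβ)
      (((tendsto_distFun_atBot hβ).eventually_lt_const h0).exists.imp fun _ h => h.le)
      (((tendsto_distFun_atTop hβ).eventually_const_lt h1).exists.imp fun _ h => h.le)
  have : {y : ℝ | w ≤ distFun β y} = Ici x := by
    ext y; simp [← hx, (strictMono_distFun hβ).le_iff_le]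
  rw [quantile, this, csInf_Ici, ← hx, (strictMono_distFun hβ).le_iff_le]

lemma measurable_quantile {β : ℝ} (hβ : 0 < β) :
    Measurable fun w : ℝ => quantile β w := by
  classical
  -- Outside (0, 1) the infimum is taken over all of ℝ or over ∅; both have the default value 0.
  have hle : ∀ w ≤ 0, quantile β w = sInf univ := fun w hw => by
    rw [quantile]; congr 1; ext y; simp [hw.trans (distFun_pos hβ y).le]
  have hge : ∀ w, 1 ≤ w → quantile β w = sInf ∅ := fun w hw => by
    rw [quantile]; congr 1; ext y; simp [(distFun_lt_one hβ y).trans_le hw]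
  have h : (fun w : ℝ => quantile β w) = fun w => if w ∈ Ioo (0:ℝ) 1 then
      quantile β w else 0 := by
    funext w
    split_ifs with hw
    · rfl
    · rcases not_and_or.1 hw with h | h
      · rw [hle w (not_lt.1 h)]; simp
      · rw [hge w (not_lt.1 h)]; simp
  rw [h]
  refine measurable_of_Iic fun a => ?_
  have : (fun w => if w ∈ Ioo (0:ℝ) 1 then quantile β w else 0) ⁻¹' Iic a =
      (Ioo (0:ℝ) 1 ∩ Iic (distFun β a)) ∪ ((Ioo (0:ℝ) 1)ᶜ ∩ {_w | (0:ℝ) ≤ a}) := by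
    ext w
    by_cases hw : w ∈ Ioo (0:ℝ) 1
    · simp only [mem_preimage, hw, if_true, mem_Iic, quantile_le_iff hβ hw.1 hw.2]
      simp [hw]
    · simp only [mem_preimage, hw, if_false, mem_Iic]
      simp [hw]
  rw [this]
  exact (measurableSet_Ioo.inter measurableSet_Iic).union
    (measurableSet_Ioo.compl.inter (MeasurableSet.const _))

/-- For β ≥ 1 the power is superadditive, (x + t)^β ≥ x^β + t^β, so the density at x + t is at most
exp(-x^β/β) times the density at t, and the half-line has mass 1/2. -/
lemma distFun_neg_le_half_mul_exp {β : ℝ} (hβ : 1 ≤ β) {x : ℝ} (hx : 0 ≤ x) :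
    distFun β (-x) ≤ 1 / 2 * Real.exp (-(x ^ β) / β) := by
  have hβ0 : 0 < β := by linarith
  have h1 : distFun β (-x) = ∫ t in Ioi (0:ℝ), density β (x + t) := by
    have := integral_comp_neg_Iic (-x) (density β)
    simp only [density_neg, neg_neg] at this
    rw [distFun, this]
    have h2 := (measurePreserving_add_left volume x).setIntegral_preimage_emb
      (measurableEmbedding_addLeft x) (density β) (Ioi x)
    rw [← h2]
    simp
  rw [h1, ← integral_Ioi_density hβ0, mul_comm, ← integral_const_mul]
  refine setIntegral_mono_on ?_ ?_ measurableSet_Ioi fun t ht => ?_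
  · exact ((integrable_density hβ0).comp_add_left x).integrableOn
  · exact ((integrable_density hβ0).const_mul _).integrableOn
  · have ht : 0 < t := ht
    rw [density, density, abs_of_pos ht, abs_of_nonneg (by positivity), mul_left_comm,
      ← Real.exp_add]
    have := Real.add_rpow_le_rpow_add hx ht.le hβ
    have h3 := normConst_pos hβ0
    gcongr
    rw [← add_div]
    gcongr
    linarith

/-- The function v^k exp(-δv) is maximal at v = k/δ. The inequality 1 + u ≤ exp u at u = δv/k - 1 is
tangent exactly there. -/
lemma rpow_le_mul_exp {k δ v : ℝ} (hk : 0 < k) (hδ : 0 < δ) (hv : 0 ≤ v) :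
    v ^ k ≤ (k / (Real.exp 1 * δ)) ^ k * Real.exp (δ * v) := by
  have h := Real.add_one_le_exp (δ * v / k - 1)
  have h2 : v ≤ k / (Real.exp 1 * δ) * Real.exp (δ * v / k) := by
    rw [Real.exp_sub] at h
    have h3 : δ * v / k ≤ Real.exp (δ * v / k) / Real.exp 1 := by linarith
    rw [div_mul_eq_mul_div, le_div_iff₀ (by positivity)]
    rw [div_le_div_iff₀ (by positivity) (by positivity)] at h3
    linarith
  calc v ^ k ≤ (k / (Real.exp 1 * δ) * Real.exp (δ * v / k)) ^ k :=
        Real.rpow_le_rpow hv h2 hk.le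
    _ = _ := by
      rw [Real.mul_rpow (by positivity) (by positivity), ← Real.exp_mul]
      congr 2; field_simp

/-- The constant in the tail estimate for exponents `β < 1`. -/
noncomputable def tailConst (β δ : ℝ) : ℝ :=
  1 / (2 * Real.Gamma (1 / β)) * ((1 - β) / β / (Real.exp 1 * δ)) ^ ((1 - β) / β) / (1 - δ)

lemma normConst_eq {β : ℝ} (hβ : 0 < β) :
    normConst β * β ^ ((1 - β) / β) = 1 / (2 * Real.Gamma (1 / β)) := by
  have hG : 0 < Real.Gamma (1 / β) := Real.Gamma_pos_of_pos (by positivity)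
  rw [normConst, add_comm, Real.Gamma_add_one (by positivity)]
  have : (1 - β) / β = 1 / β - 1 := by field_simp
  rw [this, Real.rpow_sub_one hβ.ne']
  have : 0 < β ^ (1 / β) := by positivity
  field_simp

/-- Superadditivity fails for β < 1. With X = t^β/β, the factor t^{1-β} is a multiple of X^{(1-β)/β}
and is paid for by a share exp(δX) of the exponential; what remains, t^{β-1} exp(-(1-δ)X), has an
elementary primitive. -/
lemma distFun_neg_le_tailConst_mul_exp {β δ : ℝ} (hβ : 0 < β) (hβ1 : β < 1) (hδ : 0 < δ)
    (hδ1 : δ < 1) {x : ℝ} (hx : 0 ≤ x) :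
    distFun β (-x) ≤ tailConst β δ * Real.exp (-((1 - δ) * (x ^ β / β))) := by
  have h1 : distFun β (-x) = ∫ t in Ioi x, density β t := by
    have := integral_comp_neg_Iic (-x) (density β)
    simp only [density_neg, neg_neg] at this
    exact this
  set k := (1 - β) / β with hk
  have hk0 : 0 < k := div_pos (by linarith) hβ
  set A := normConst β * (β ^ k * (k / (Real.exp 1 * δ)) ^ k) with hA
  have hc := normConst_pos hβ
  have hA0 : 0 ≤ A := by positivity
  have hδ' : 0 < 1 - δ := by linarith
  let G : ℝ → ℝ := fun t => -(A / (1 - δ) * Real.exp (-((1 - δ) * (t ^ β / β))))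
  let g : ℝ → ℝ := fun t => A * (t ^ (β - 1) * Real.exp (-((1 - δ) * (t ^ β / β))))
  have hcont : ContinuousWithinAt G (Ici x) x := by
    have : Continuous G := by
      have : Continuous fun t : ℝ => t ^ β := Real.continuous_rpow_const hβ.le
      fun_prop
    exact this.continuousWithinAt
  have hder : ∀ t ∈ Ioi x, HasDerivAt G (g t) t := fun t ht => by
    have ht0 : 0 < t := hx.trans_lt ht
    have h := ((((Real.hasDerivAt_rpow_const (x := t) (p := β) (Or.inl ht0.ne')).div_const
      β).const_mul (1 - δ)).neg.exp.const_mul (A / (1 - δ))).neg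
    refine h.congr_deriv ?_
    simp only [g, Pi.neg_apply]
    field_simp
  have hg0 : ∀ t ∈ Ioi x, 0 ≤ g t := fun t ht => by
    have ht0 : 0 < t := hx.trans_lt ht
    positivity
  have hlim : Tendsto G atTop (𝓝 0) := by
    have : Tendsto (fun t : ℝ => (1 - δ) * (t ^ β / β)) atTop atTop :=
      ((tendsto_rpow_atTop hβ).atTop_div_const hβ).const_mul_atTop hδ'
    have := ((Real.tendsto_exp_neg_atTop_nhds_zero.comp this).const_mul (A / (1 - δ))).neg
    simpa using this
  have hint := integrableOn_Ioi_deriv_of_nonneg hcont hder hg0 hlim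
  have hval := integral_Ioi_of_hasDerivAt_of_nonneg hcont hder hg0 hlim
  rw [h1]
  calc ∫ t in Ioi x, density β t ≤ ∫ t in Ioi x, g t := by
        refine setIntegral_mono_on (integrable_density hβ).integrableOn hint measurableSet_Ioi
          fun t ht => ?_
        have ht0 : 0 < t := hx.trans_lt ht
        have hv := rpow_le_mul_exp hk0 hδ (v := t ^ β / β) (by positivity)
        have hkβ : t ^ (1 - β) = β ^ k * (t ^ β / β) ^ k := by
          rw [← Real.mul_rpow hβ.le (by positivity), mul_div_cancel₀ _ hβ.ne', ← Real.rpow_mul ht0.le]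
          congr 1; rw [hk]; field_simp
        have hone : t ^ (1 - β) * t ^ (β - 1) = 1 := by
          rw [← Real.rpow_add ht0]; simp
        have he : Real.exp (-((1 - δ) * (t ^ β / β))) =
            Real.exp (δ * (t ^ β / β)) * Real.exp (-(t ^ β) / β) := by
          rw [← Real.exp_add]; congr 1; ring
        simp only [density, abs_of_pos ht0, g, hA, he]
        calc normConst β * Real.exp (-(t ^ β) / β)
            = normConst β * (β ^ k * (t ^ β / β) ^ k * t ^ (β - 1) * Real.exp (-(t ^ β) / β)) := by
              rw [← hkβ, hone, one_mul]
          _ ≤ normConst β * (β ^ k * ((k / (Real.exp 1 * δ)) ^ k * Real.exp (δ * (t ^ β / β)))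
              * t ^ (β - 1) * Real.exp (-(t ^ β) / β)) := by gcongr
          _ = _ := by ring
    _ = 0 - G x := hval
    _ = _ := by
      simp only [G, hA, tailConst]
      rw [← mul_assoc (normConst β), hk, normConst_eq hβ]
      ring

end LatticeQMC

/-! ### Young's inequality, tail bounds and the four forms of `K` -/

namespace LatticeQMC
open Set Filter Topology

/-- Young's inequality with exponents β/τ and β/(β-τ). The factor (ε/τ)^{τ/β} is moved from θ to x^τ
so that the first term becomes exactly ε x^β/β; the second is the exponent in `youngFactor`. -/
lemma mul_rpow_le_young {β θ τ ε : ℝ} (hτ : 0 < τ) (hτβ : τ < β) (hθ : 0 < θ) (hε : 0 < ε)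
    {x : ℝ} (hx : 0 ≤ x) :
    θ * x ^ τ ≤ ε * (x ^ β / β) +
      (ε / τ) ^ (1 - β / (β - τ)) * ((β - τ) / β) * θ ^ (β / (β - τ)) := by
  have hβ : 0 < β := hτ.trans hτβ
  have hd : 0 < β - τ := by linarith
  have hpq : (β / τ).HolderConjugate (β / (β - τ)) := by
    rw [Real.holderConjugate_iff]
    refine ⟨by rw [lt_div_iff₀ hτ]; linarith, ?_⟩
    field_simp; ring
  have h := Real.young_inequality_of_nonneg (a := (ε / τ) ^ (τ / β) * x ^ τ)
    (b := θ * (ε / τ) ^ (-(τ / β))) (by positivity) (by positivity) hpq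
  have e0 : (ε / τ) ^ (τ / β) * (ε / τ) ^ (-(τ / β)) = 1 := by
    rw [← Real.rpow_add (by positivity)]; simp
  have e1 : ((ε / τ) ^ (τ / β) * x ^ τ) ^ (β / τ) = ε / τ * x ^ β := by
    rw [Real.mul_rpow (by positivity) (by positivity), ← Real.rpow_mul (by positivity),
      ← Real.rpow_mul hx]
    congr 1
    · rw [show τ / β * (β / τ) = 1 by field_simp, Real.rpow_one]
    · congr 1; field_simp
  have e2 : (θ * (ε / τ) ^ (-(τ / β))) ^ (β / (β - τ)) =
      θ ^ (β / (β - τ)) * (ε / τ) ^ (1 - β / (β - τ)) := by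
    rw [Real.mul_rpow (by positivity) (by positivity), ← Real.rpow_mul (by positivity)]
    congr 2; field_simp; ring
  rw [e1, e2] at h
  calc θ * x ^ τ = (ε / τ) ^ (τ / β) * x ^ τ * (θ * (ε / τ) ^ (-(τ / β))) := by
        linear_combination (-(θ * x ^ τ)) * e0
    _ ≤ _ := h
    _ = _ := by field_simp

/-- The p-th power of a tail bound has exponent -pqX, of which one unit X is kept to recover the
density; the surplus pq - 1 is available to absorb exp(g). -/
lemma rpow_mul_exp_le_of_tail {a p C q L g X : ℝ} (ha : 0 ≤ a) (hp : 0 ≤ p) (hC : 0 ≤ C)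
    (h : a ≤ C * Real.exp (-(q * X))) (hg : g ≤ (p * q - 1) * X + L) :
    a ^ p * Real.exp g ≤ C ^ p * Real.exp L * Real.exp (-X) := by
  have h1 : a ^ p ≤ C ^ p * Real.exp (-(q * X) * p) := by
    rw [Real.exp_mul, ← Real.mul_rpow hC (Real.exp_pos _).le]
    exact Real.rpow_le_rpow ha h hp
  calc a ^ p * Real.exp g ≤ C ^ p * Real.exp (-(q * X) * p) * Real.exp ((p * q - 1) * X + L) := by
        gcongr
    _ = _ := by
      rw [mul_assoc, mul_assoc, ← Real.exp_add, ← Real.exp_add]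
      congr 2; ring

/-- The tail estimate behind the constant `K`. -/
lemma exists_constK_eq_mul {β θ τ r : ℝ} (hτ : 0 < τ) (hτβ : τ ≤ β) (hθ : 0 < θ)
    (hr1 : τ < β → r < 1) (hr2 : τ = β → r < 1 - θ * β / 2) (hr : 1 / 2 < r) :
    ∃ R, 0 ≤ R ∧ constK β θ τ r = baseConst β r * R ∧ ∀ x, 0 ≤ x →
      distFun β (-x) ^ (3 - 2 * r) * Real.exp (θ * x ^ τ) ≤ R * Real.exp (-(x ^ β / β)) := by
  have hβ : 0 < β := hτ.trans_le hτβ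
  have hr3 : r < 1 := by
    rcases hτβ.lt_or_eq with h | h
    · exact hr1 h
    · have := hr2 h
      have : 0 < θ * β := by positivity
      linarith
  have hp1 : 1 < 3 - 2 * r := by linarith
  have hs : 1 < Real.sqrt (3 - 2 * r) := by rw [Real.lt_sqrt] <;> linarith
  have hss : Real.sqrt (3 - 2 * r) ^ 2 = 3 - 2 * r := Real.sq_sqrt (by linarith)
  have hps : (1 + 2 * (1 - r)) = 3 - 2 * r := by ring
  -- Here ε = s - 1 and the power 3 - 2r of the tail is s², a factorisation that fits the first case
  -- below.
  set s := Real.sqrt (3 - 2 * r) with hsdef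
  have hGam : 0 < Real.Gamma (1 / β) := Real.Gamma_pos_of_pos (by positivity)
  have hY := fun x hx => mul_rpow_le_young (ε := s - 1) hτ (β := β) (θ := θ) (x := x)
    (hθ := hθ) (hε := by linarith) (hx := hx)
  unfold constK
  -- The two constants for β < 1 arise from this closed form by specialising δ.
  have hkey : ∀ δ, 0 < δ → δ < 1 → β < 1 → tailConst β δ ^ (3 - 2 * r) =
      (1 / (2 * Real.Gamma (1 / β)) ^ (3 - 2 * r)) *
      ((1 - β) / (Real.exp 1 * β) * ((1 - δ) / δ)) ^ ((1 - β) * (3 - 2 * r) / β) *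
      (1 / (1 - δ)) ^ ((3 - 2 * r) / β) := fun δ h0 h1 hb => by
    have h1' : 0 < 1 - δ := by linarith
    have hb' : 0 < 1 - β := by linarith
    have hk : tailConst β δ = 1 / (2 * Real.Gamma (1 / β)) *
        ((1 - β) / (Real.exp 1 * β) * ((1 - δ) / δ)) ^ ((1 - β) / β) *
        (1 / (1 - δ)) ^ (1 / β) := by
      have e : (1 - β) / β / (Real.exp 1 * δ) =
          (1 - β) / (Real.exp 1 * β) * ((1 - δ) / δ) * (1 / (1 - δ)) := by field_simp
      have e2 : 1 / β = (1 - β) / β + 1 := by field_simp; ring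
      rw [tailConst, e, Real.mul_rpow (by positivity) (by positivity)]
      conv_rhs => rw [e2, Real.rpow_add_one (by positivity)]
      rw [← e2]; ring
    rw [hk, Real.mul_rpow (by positivity) (by positivity),
      Real.mul_rpow (by positivity) (by positivity),
      ← Real.rpow_mul (by positivity), ← Real.rpow_mul (by positivity),
      Real.div_rpow (by positivity) (by positivity), Real.one_rpow]
    rw [div_mul_eq_mul_div (1 - β) β, div_mul_eq_mul_div 1 β, one_mul (3 - 2 * r)]
  split_ifs with h1 h2 h2
  -- With δ = (s-1)/s one has s²(1-δ) - 1 = s - 1 = ε, precisely the surplus that Young's inequality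
  -- consumes.
  · refine ⟨tailConst β ((s - 1) / s) ^ (3 - 2 * r) * youngFactor β θ τ r, ?_, ?_, ?_⟩
    · have : 0 ≤ tailConst β ((s - 1) / s) := by
        unfold tailConst
        have : 0 < (s - 1) / s := div_pos (by linarith) (by linarith)
        have : 0 < 1 - (s - 1) / s := by rw [sub_pos, div_lt_one] <;> linarith
        have : 0 < 1 - β := by linarith
        positivity
      unfold youngFactor
      positivity
    · have hs0 : 0 < s := by linarith
      have hs1 : 0 < s - 1 := by linarith
      rw [hkey _ (div_pos hs1 hs0) (by rw [div_lt_one] <;> linarith) h2, constLtSmall, hps, ← hsdef]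
      have e1 : 1 - (s - 1) / s = 1 / s := by field_simp; ring
      have e2 : (1 / s) / ((s - 1) / s) = 1 / (s - 1) := by field_simp
      have e3 : (1 - β) / (Real.exp 1 * β) * (1 / (s - 1)) =
          (1 - β) / (Real.exp 1 * β * (s - 1)) := by field_simp
      rw [e1, e2, one_div_one_div, e3]
      ring
    · intro x hx
      have hs0 : 0 < s := by linarith
      have hs1 : 0 < s - 1 := by linarith
      have hlt : (s - 1) / s < 1 := by rw [div_lt_one] <;> linarith
      unfold youngFactor
      rw [hps, ← hsdef]
      refine rpow_mul_exp_le_of_tail (distFun_pos hβ _).le (by linarith) ?_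
        (distFun_neg_le_tailConst_mul_exp hβ h2 (div_pos hs1 hs0) hlt hx) ?_
      · unfold tailConst
        have : 0 < (s - 1) / s := div_pos (by linarith) (by linarith)
        have : 0 < 1 - (s - 1) / s := by linarith
        have : 0 < 1 - β := by linarith
        positivity
      · refine (hY x hx h1).trans (le_of_eq ?_)
        congr 2
        rw [← hss]; field_simp; ring
  · refine ⟨youngFactor β θ τ r, (Real.exp_pos _).le, rfl, fun x hx => ?_⟩
    unfold youngFactor
    rw [hps, ← hsdef]
    have ht := distFun_neg_le_half_mul_exp (not_lt.1 h2) hx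
    -- The factor 1/2 of the tail bound and the gap between s - 1 and s² - 1 are given away here.
    have := rpow_mul_exp_le_of_tail (p := 3 - 2 * r) (C := 1) (q := 1) (X := x ^ β / β)
      (distFun_pos hβ (-x)).le (by linarith) zero_le_one
      (by
        rw [one_mul, one_mul, ← neg_div]
        have := Real.exp_pos (-x ^ β / β)
        linarith)
      (le_trans (hY x hx h1) (add_le_add (mul_le_mul_of_nonneg_right
        (by nlinarith : s - 1 ≤ (3 - 2 * r) * 1 - 1) (by positivity)) le_rfl))
    rwa [Real.one_rpow, one_mul] at this
  · have heq : τ = β := le_antisymm hτβ (not_lt.1 h1)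
    have hr4 := hr2 heq
    have hp0 : 0 < 3 - 2 * r := by linarith
    have hθβ : 0 < θ * β := by positivity
    have hd : 0 < 3 - 2 * r - 1 - β * θ := by linarith
    -- Chosen so that (3 - 2r)(1 - δ) = 1 + βθ, since θx^β is βθ times x^β/β. The upper bound on r
    -- makes δ positive.
    set δ := (3 - 2 * r - 1 - β * θ) / (3 - 2 * r) with hδ
    have hδ0 : 0 < δ := div_pos hd hp0
    have hδ1 : 1 - δ = (1 + β * θ) / (3 - 2 * r) := by rw [hδ]; field_simp; ring
    have hδ2 : 0 < 1 - δ := by rw [hδ1]; exact div_pos (by linarith) hp0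
    refine ⟨tailConst β δ ^ (3 - 2 * r), ?_, ?_, ?_⟩
    · have : 0 ≤ tailConst β δ := by
        unfold tailConst
        have : 0 < 1 - β := by linarith
        positivity
      positivity
    · rw [hkey _ hδ0 (by linarith) h2, constEqSmall, hδ1]
      have e2 : ((1 + β * θ) / (3 - 2 * r)) / δ = (1 + β * θ) / (3 - 2 * r - 1 - β * θ) := by
        rw [hδ]; field_simp
      rw [e2, one_div_div]
      ring
    · intro x hx
      have := rpow_mul_exp_le_of_tail (p := 3 - 2 * r) (L := 0) (g := θ * x ^ τ)
        (distFun_pos hβ (-x)).le (by linarith) ?_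
        (distFun_neg_le_tailConst_mul_exp hβ h2 hδ0 (by linarith) hx) ?_
      · simpa using this
      · unfold tailConst
        have : 0 < 1 - β := by linarith
        positivity
      · rw [heq, hδ1]
        refine le_of_eq ?_
        field_simp; ring
  · have heq : τ = β := le_antisymm hτβ (not_lt.1 h1)
    have hr4 := hr2 heq
    refine ⟨1, zero_le_one, (mul_one _).symm, fun x hx => ?_⟩
    have ht := distFun_neg_le_half_mul_exp (not_lt.1 h2) hx
    have := rpow_mul_exp_le_of_tail (p := 3 - 2 * r) (C := 1) (q := 1) (X := x ^ β / β) (L := 0)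
      (g := θ * x ^ τ)
      (distFun_pos hβ (-x)).le (by linarith) zero_le_one
      (by
        rw [one_mul, one_mul, ← neg_div]
        have := Real.exp_pos (-x ^ β / β)
        linarith) ?_
    · simpa using this
    · have h0 : 0 ≤ x ^ β / β := by positivity
      have e : θ * x ^ τ = θ * β * (x ^ β / β) := by rw [heq]; field_simp
      rw [e, add_zero]
      gcongr
      linarith

lemma exists_tail_bound {β q : ℝ} (hβ : 0 < β) (hq0 : 0 < q) (hq1 : q < 1) :
    ∃ C, 0 ≤ C ∧ ∀ x, 0 ≤ x → distFun β (-x) ≤ C * Real.exp (-(q * (x ^ β / β))) := by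
  rcases lt_or_ge β 1 with h | h
  · refine ⟨tailConst β (1 - q), ?_, fun x hx => ?_⟩
    · unfold tailConst
      have : 0 < 1 - β := by linarith
      have : 0 < 1 - q := by linarith
      have : 0 < 1 - (1 - q) := by linarith
      have hGam : 0 < Real.Gamma (1 / β) := Real.Gamma_pos_of_pos (by positivity)
      positivity
    · have := distFun_neg_le_tailConst_mul_exp hβ h (δ := 1 - q) (by linarith) (by linarith) hx
      simpa using this
  · refine ⟨1, zero_le_one, fun x hx => (distFun_neg_le_half_mul_exp h hx).trans ?_⟩
    have h0 : 0 ≤ x ^ β / β := by positivity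
    gcongr
    · norm_num
    · rw [neg_div]
      nlinarith

/-- The weight 1/ψ² may use up only a fraction κ < 1 of the Gaussian exponent. For τ < β Young's
inequality allows any positive fraction; for τ = β the fraction is θβ, which is why θ < 1/β is
needed. -/
lemma exists_growth_bound {β θ τ : ℝ} (hτ : 0 < τ) (hτβ : τ ≤ β) (hθ : 0 < θ)
    (hθβ : τ = β → θ < 1 / β) :
    ∃ κ L, 0 < κ ∧ κ < 1 ∧ ∀ x, 0 ≤ x → θ * x ^ τ ≤ κ * (x ^ β / β) + L := by
  have hβ : 0 < β := hτ.trans_le hτβ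
  rcases hτβ.lt_or_eq with h | h
  · exact ⟨1 / 2, _, by norm_num, by norm_num,
      fun x hx => mul_rpow_le_young hτ h hθ (by norm_num) hx⟩
  · refine ⟨θ * β, 0, by positivity, ?_, fun x hx => ?_⟩
    · have := hθβ h
      rwa [lt_div_iff₀ hβ] at this
    · rw [h]; refine le_of_eq ?_; field_simp; ring

lemma psiSq_pos (θ τ x : ℝ) : 0 < psiSq θ τ x := Real.exp_pos _

lemma continuous_psiSq {τ : ℝ} (θ : ℝ) (hτ : 0 < τ) : Continuous (psiSq θ τ) := by
  unfold psiSq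
  have : Continuous fun y : ℝ => |y| ^ τ := continuous_abs.rpow_const fun _ => Or.inr hτ.le
  fun_prop

/-- With X = |t|^β/β, the tails and the density are O(exp(-qX)) for each q < 1, whereas 1/ψ² is
O(exp(κX)) with κ < 1. Taking q halfway between κ and 1 leaves the integrable factor exp(-(1-κ)X/2).
-/
lemma integrable_tail_div_psiSq {β θ τ : ℝ} (hτ : 0 < τ) (hτβ : τ ≤ β) (hθ : 0 < θ)
    (hθβ : τ = β → θ < 1 / β) {g : ℝ → ℝ} (hg : Continuous g)
    (hle : ∃ D, 0 ≤ D ∧ ∀ t, |g t| ≤ D * max (distFun β (-|t|)) (density β t)) :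
    Integrable fun t => g t / psiSq θ τ t := by
  have hβ : 0 < β := hτ.trans_le hτβ
  obtain ⟨κ, L, hκ0, hκ1, hκ⟩ := exists_growth_bound hτ hτβ hθ hθβ
  obtain ⟨C, hC0, hC⟩ := exists_tail_bound hβ (q := (1 + κ) / 2) (by linarith) (by linarith)
  obtain ⟨D, hD0, hD⟩ := hle
  have hb : 0 < (1 - κ) / 2 / β := div_pos (by linarith) hβ
  refine Integrable.mono' ((integrable_exp_neg_mul_abs_rpow hβ hb).const_mul
    (D * max C (normConst β) * Real.exp L)) ?_ (Eventually.of_forall fun t => ?_)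
  · exact (hg.div (continuous_psiSq θ hτ) fun t => (psiSq_pos θ τ t).ne').aestronglyMeasurable
  · have hX : 0 ≤ |t| ^ β / β := by positivity
    have hmax : max (distFun β (-|t|)) (density β t) ≤
        max C (normConst β) * Real.exp (-((1 + κ) / 2 * (|t| ^ β / β))) := by
      refine max_le ((hC _ (abs_nonneg t)).trans ?_) ?_
      · gcongr; exact le_max_left _ _
      · unfold density
        have := normConst_pos hβ
        gcongr
        · exact le_max_right _ _
        · rw [neg_div]; nlinarith
    rw [Real.norm_eq_abs, abs_div, abs_of_pos (psiSq_pos θ τ t), psiSq, Real.exp_neg, div_inv_eq_mul]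
    have hm : 0 ≤ max C (normConst β) := hC0.trans (le_max_left _ _)
    calc |g t| * Real.exp (θ * |t| ^ τ) ≤
        D * (max C (normConst β) * Real.exp (-((1 + κ) / 2 * (|t| ^ β / β)))) *
          Real.exp (κ * (|t| ^ β / β) + L) := by
          gcongr
          · exact (hD t).trans (by gcongr)
          · exact hκ _ (abs_nonneg t)
      _ = D * max C (normConst β) * (Real.exp (-((1 + κ) / 2 * (|t| ^ β / β))) *
          Real.exp (κ * (|t| ^ β / β) + L)) := by ring
      _ = D * max C (normConst β) * (Real.exp L *
          Real.exp (-((1 - κ) / 2 / β * |t| ^ β))) := by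
          rw [← Real.exp_add, ← Real.exp_add]; congr 2; ring
      _ = _ := by ring

lemma distFun_mul_one_sub_le {β : ℝ} (hβ : 0 < β) (t : ℝ) :
    distFun β t * (1 - distFun β t) ≤ distFun β (-|t|) := by
  have h0 := distFun_pos hβ t
  have h1 := distFun_lt_one hβ t
  rcases abs_cases t with ⟨h, _⟩ | ⟨h, _⟩
  · rw [h, distFun_neg hβ]; nlinarith
  · rw [h, neg_neg]; nlinarith

lemma integrable_distFun_mul_div {β θ τ : ℝ} (hτ : 0 < τ) (hτβ : τ ≤ β) (hθ : 0 < θ)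
    (hθβ : τ = β → θ < 1 / β) :
    Integrable fun t => distFun β t * (1 - distFun β t) / psiSq θ τ t := by
  have hβ : 0 < β := hτ.trans_le hτβ
  have := continuous_distFun hβ
  refine integrable_tail_div_psiSq hτ hτβ hθ hθβ (by fun_prop) ⟨1, zero_le_one, fun t => ?_⟩
  have h0 := distFun_pos hβ t
  have h1 := distFun_lt_one hβ t
  rw [abs_of_nonneg (mul_nonneg h0.le (by linarith)), one_mul]
  exact (distFun_mul_one_sub_le hβ t).trans (le_max_left _ _)

lemma density_le {β : ℝ} (hβ : 0 < β) (t : ℝ) : density β t ≤ normConst β := by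
  unfold density
  refine mul_le_of_le_one_right (normConst_pos hβ).le (Real.exp_le_one_iff.2 ?_)
  rw [neg_div]
  have : 0 ≤ |t| ^ β / β := by positivity
  linarith

lemma integrable_density_sq_div {β θ τ : ℝ} (hτ : 0 < τ) (hτβ : τ ≤ β) (hθ : 0 < θ)
    (hθβ : τ = β → θ < 1 / β) :
    Integrable fun t => density β t ^ 2 / psiSq θ τ t := by
  have hβ : 0 < β := hτ.trans_le hτβ
  have := continuous_density hβ
  refine integrable_tail_div_psiSq hτ hτβ hθ hθβ (by fun_prop)
    ⟨normConst β, (normConst_pos hβ).le, fun t => ?_⟩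
  have h0 := density_pos hβ t
  have h1 := normConst_pos hβ
  rw [abs_of_nonneg (by positivity), pow_two]
  exact mul_le_mul (density_le hβ t) (le_max_right _ _) h0.le h1.le

end LatticeQMC

/-! ### Decay of the Fourier coefficients of the shift-averaged kernel -/

namespace LatticeQMC
open Set Filter Topology

/-- The `h`-th Fourier coefficient of `x ↦ (w - x)₊ + (w - (1 - x))₊ - w ^ 2`. -/
noncomputable def arcCoeff (h : ℤ) (w : ℝ) : ℝ := (Real.sin (Real.pi * h * w) / (Real.pi * h)) ^ 2

/-- The `h`-th Fourier coefficient of `shiftKernel`. -/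
noncomputable def shiftCoeff (β θ τ : ℝ) (h : ℤ) : ℝ :=
  ∫ t : ℝ, arcCoeff h (distFun β t) / psiSq θ τ t

lemma arcCoeff_nonneg (h : ℤ) (w : ℝ) : 0 ≤ arcCoeff h w := sq_nonneg _

lemma arcCoeff_zero (w : ℝ) : arcCoeff 0 w = 0 := by simp [arcCoeff]

lemma arcCoeff_one_sub (h : ℤ) (w : ℝ) : arcCoeff h (1 - w) = arcCoeff h w := by
  unfold arcCoeff
  rw [div_pow, div_pow]
  congr 1
  rw [show Real.pi * h * (1 - w) = h * Real.pi - Real.pi * h * w by ring,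
    Real.sin_sub, Real.sin_int_mul_pi, zero_mul, zero_sub, neg_sq, mul_pow, Real.cos_sq',
    Real.sin_int_mul_pi]
  ring

lemma continuous_arcCoeff (h : ℤ) : Continuous (arcCoeff h) := by
  unfold arcCoeff; fun_prop

lemma arcCoeff_le_sq (h : ℤ) (w : ℝ) : arcCoeff h w ≤ w ^ 2 := by
  rcases eq_or_ne h 0 with rfl | hh
  · rw [arcCoeff_zero]; positivity
  have hh' : (h : ℝ) ≠ 0 := by exact_mod_cast hh
  have h0 : 0 < |Real.pi * h| := by have := Real.pi_ne_zero; positivity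
  rw [arcCoeff, sq_le_sq, abs_div, div_le_iff₀ h0, ← abs_mul, mul_comm w]
  exact Real.abs_sin_le_abs

lemma arcCoeff_le_inv_sq (h : ℤ) (w : ℝ) : arcCoeff h w ≤ ((Real.pi * h) ^ 2)⁻¹ := by
  rw [arcCoeff, div_pow, ← one_div]
  gcongr
  exact Real.sin_sq_le_one _

/-- The symmetry w ↦ 1 - w improves the bound w² to the square of min(w, 1 - w). The result vanishes
at both ends, which makes the coefficients integrable against 1/ψ² in both tails. -/
lemma arcCoeff_le_mul {h : ℤ} {w : ℝ} (h0 : 0 ≤ w) (h1 : w ≤ 1) :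
    arcCoeff h w ≤ 2 * (w * (1 - w)) := by
  rcases le_total w (1 / 2) with hw | hw
  · have := arcCoeff_le_sq h w
    nlinarith
  · have := arcCoeff_le_sq h (1 - w)
    rw [arcCoeff_one_sub] at this
    nlinarith

variable {β θ τ : ℝ}

lemma integrable_arcCoeff (hτ : 0 < τ) (hτβ : τ ≤ β) (hθ : 0 < θ)
    (hθβ : τ = β → θ < 1 / β) (h : ℤ) :
    Integrable fun t => arcCoeff h (distFun β t) / psiSq θ τ t := by
  have hβ : 0 < β := hτ.trans_le hτβ
  have hc := continuous_distFun hβ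
  refine ((integrable_distFun_mul_div hτ hτβ hθ hθβ).const_mul 2).mono' ?_
    (Eventually.of_forall fun t => ?_)
  · exact (((continuous_arcCoeff h).comp hc).div (continuous_psiSq θ hτ)
      fun t => (psiSq_pos θ τ t).ne').aestronglyMeasurable
  · have hp := psiSq_pos θ τ t
    have hn := arcCoeff_nonneg h (distFun β t)
    rw [Real.norm_of_nonneg (by positivity), ← mul_div_assoc]
    gcongr
    exact arcCoeff_le_mul (distFun_pos hβ t).le (distFun_lt_one hβ t).le

lemma shiftCoeff_nonneg (h : ℤ) : 0 ≤ shiftCoeff β θ τ h :=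
  integral_nonneg fun t => div_nonneg (arcCoeff_nonneg _ _) (psiSq_pos θ τ t).le

lemma shiftCoeff_zero : shiftCoeff β θ τ 0 = 0 := by simp [shiftCoeff, arcCoeff_zero]

/-- The majorant of `v ↦ arcCoeff h v * v ^ (-p)` on `(0, ∞)`, where `a = π |h|`. -/
noncomputable def powMajorant (a p v : ℝ) : ℝ :=
  if v ≤ 1 / a then v ^ (2 - p) else (a ^ 2)⁻¹ * v ^ (-p)

lemma powMajorant_nonneg {a p v : ℝ} (hv : 0 < v) : 0 ≤ powMajorant a p v := by
  unfold powMajorant; split_ifs <;> positivity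

/-- The integral is split at v = 1/a; it converges at 0 because p < 3 and at infinity because p > 1.
With p = 3 - 2r the scaling factor a^{p-3} is the decay rate a^{-2r}. -/
lemma integral_powMajorant {a p : ℝ} (ha : 0 < a) (hp1 : 1 < p) (hp2 : p < 3) :
    IntegrableOn (powMajorant a p) (Ioi 0) ∧
    ∫ v in Ioi (0:ℝ), powMajorant a p v = a ^ (p - 3) * (1 / (3 - p) + 1 / (p - 1)) := by
  have ha' : 0 < 1 / a := by positivity
  have hu : Ioi (0:ℝ) = Ioc 0 (1 / a) ∪ Ioi (1 / a) := (Ioc_union_Ioi_eq_Ioi ha'.le).symm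
  have h1 : EqOn (powMajorant a p) (fun v => v ^ (2 - p)) (Ioc 0 (1 / a)) := fun v hv => by
    simp only [powMajorant, if_pos hv.2]
  have h2 : EqOn (powMajorant a p) (fun v => (a ^ 2)⁻¹ * v ^ (-p)) (Ioi (1 / a)) := fun v hv => by
    simp only [powMajorant, if_neg (not_le.2 (mem_Ioi.1 hv))]
  have i1 : IntegrableOn (fun v : ℝ => v ^ (2 - p)) (Ioc 0 (1 / a)) :=
    (intervalIntegrable_iff_integrableOn_Ioc_of_le ha'.le).1
      (intervalIntegral.intervalIntegrable_rpow' (by linarith))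
  have i2 : IntegrableOn (fun v : ℝ => (a ^ 2)⁻¹ * v ^ (-p)) (Ioi (1 / a)) :=
    (integrableOn_Ioi_rpow_of_lt (by linarith) ha').const_mul _
  have j1 := i1.congr_fun h1.symm measurableSet_Ioc
  have j2 := i2.congr_fun h2.symm measurableSet_Ioi
  refine ⟨hu ▸ j1.union j2, ?_⟩
  rw [hu, setIntegral_union (Ioc_disjoint_Ioi le_rfl) measurableSet_Ioi j1 j2,
    setIntegral_congr_fun measurableSet_Ioc h1, setIntegral_congr_fun measurableSet_Ioi h2,
    ← intervalIntegral.integral_of_le ha'.le, integral_rpow (Or.inl (by linarith)),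
    integral_const_mul, integral_Ioi_rpow_of_lt (by linarith) ha', Real.zero_rpow (by linarith)]
  have e1 : (1 / a) ^ (2 - p + 1) = a ^ (p - 3) := by
    rw [one_div, Real.inv_rpow ha.le, ← Real.rpow_neg ha.le]; congr 1; ring
  have e2 : (a ^ 2)⁻¹ * (1 / a) ^ (-p + 1) = a ^ (p - 3) := by
    rw [one_div, Real.inv_rpow ha.le, ← Real.rpow_neg ha.le, ← Real.rpow_natCast, ← Real.rpow_neg ha.le,
      ← Real.rpow_add ha]
    congr 1; push_cast; ring
  rw [e1, mul_div_assoc', mul_neg, e2]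
  have : 3 - p ≠ 0 := by linarith
  have : p - 1 ≠ 0 := by linarith
  have : 2 - p + 1 ≠ 0 := by linarith
  have : -p + 1 ≠ 0 := by linarith
  field_simp
  ring

lemma arcCoeff_mul_rpow_le {h : ℤ} {p v : ℝ} (hv : 0 < v) :
    arcCoeff h v * v ^ (-p) ≤ powMajorant (Real.pi * |(h : ℝ)|) p v := by
  unfold powMajorant
  split_ifs with hle
  · calc arcCoeff h v * v ^ (-p) ≤ v ^ 2 * v ^ (-p) := by gcongr; exact arcCoeff_le_sq h v
      _ = v ^ (2 - p) := by
        rw [← Real.rpow_natCast, ← Real.rpow_add hv]; congr 1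
  · gcongr
    refine (arcCoeff_le_inv_sq h v).trans_eq ?_
    rw [mul_pow, mul_pow, sq_abs]

/-- Symmetry in t leaves twice the integral over the positive half-line. There the tail estimate
bounds 1/ψ² by (R/c_β) φ(t) v^{-p} with v = Φ(-t) and p = 3 - 2r, and φ(t) dt is the Jacobian of
this substitution. -/
lemma shiftCoeff_le (hτ : 0 < τ) (hτβ : τ ≤ β) (hθ : 0 < θ)
    (hθβ : τ = β → θ < 1 / β) {r : ℝ} (hr : 1 / 2 < r)
    (hr1 : τ < β → r < 1) (hr2 : τ = β → r < 1 - θ * β / 2) {h : ℤ} (hh : h ≠ 0) :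
    shiftCoeff β θ τ h ≤ constK β θ τ r * |(h : ℝ)| ^ (-(2 * r)) := by
  have hβ : 0 < β := hτ.trans_le hτβ
  have hr3 : r < 1 := by
    rcases hτβ.lt_or_eq with h | h
    · exact hr1 h
    · have := hr2 h
      have : 0 < θ * β := by positivity
      linarith
  obtain ⟨R, hR0, hK, hR⟩ := exists_constK_eq_mul hτ hτβ hθ hr1 hr2 hr
  have hc := normConst_pos hβ
  have hh' : 0 < |(h : ℝ)| := by simpa using hh
  set a := Real.pi * |(h : ℝ)| with ha
  have ha0 : 0 < a := by have := Real.pi_pos; positivity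
  set p := 3 - 2 * r with hp
  obtain ⟨hGi, hGv⟩ := integral_powMajorant (p := p) ha0 (by linarith) (by linarith)
  have hsymm : shiftCoeff β θ τ h =
      2 * ∫ t in Ioi (0:ℝ), arcCoeff h (distFun β t) / psiSq θ τ t := by
    rw [← integral_comp_abs (f := fun t => arcCoeff h (distFun β t) / psiSq θ τ t)]
    refine integral_congr_ae (Eventually.of_forall fun t => ?_)
    simp only [psiSq, abs_abs]
    congr 1
    rcases abs_cases t with ⟨e, _⟩ | ⟨e, _⟩
    · rw [e]
    · rw [e, distFun_neg hβ, arcCoeff_one_sub]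
  have hder : ∀ t ∈ Ioi (0:ℝ), HasDerivWithinAt (fun t => distFun β (-t)) (-density β t)
      (Ioi 0) t := fun t _ => by
    have := (hasDerivAt_distFun hβ (-t)).comp t (hasDerivAt_neg t)
    rw [density_neg, mul_neg_one] at this
    exact this.hasDerivWithinAt
  have hinj : InjOn (fun t => distFun β (-t)) (Ioi 0) := fun x _ y _ hxy => by
    have := (strictMono_distFun hβ).injective hxy
    linarith
  have himg : (fun t => distFun β (-t)) '' Ioi 0 ⊆ Ioi 0 := by
    rintro _ ⟨t, _, rfl⟩
    exact distFun_pos hβ _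
  have hcv := integral_image_eq_integral_abs_deriv_smul measurableSet_Ioi hder hinj
    (powMajorant a p)
  have hci := (integrableOn_image_iff_integrableOn_abs_deriv_smul measurableSet_Ioi hder hinj
    (powMajorant a p)).1 (hGi.mono_set himg)
  have hle : ∫ t in Ioi (0:ℝ), arcCoeff h (distFun β t) / psiSq θ τ t ≤
      ∫ t in Ioi (0:ℝ), R / normConst β * (|-density β t| • powMajorant a p (distFun β (-t))) := by
    refine setIntegral_mono_on (integrable_arcCoeff hτ hτβ hθ hθβ h).integrableOn
      (hci.const_mul _) measurableSet_Ioi fun t ht => ?_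
    have ht0 : 0 < t := ht
    have hv := distFun_pos hβ (-t)
    have hb := hR t ht0.le
    have e1 : arcCoeff h (distFun β t) = arcCoeff h (distFun β (-t)) := by
      rw [distFun_neg hβ, arcCoeff_one_sub]
    have e2 : 1 / psiSq θ τ t ≤ R / normConst β * density β t * distFun β (-t) ^ (-p) := by
      rw [psiSq, density, abs_of_pos ht0, Real.exp_neg, one_div, inv_inv, Real.rpow_neg hv.le,
        ← div_eq_mul_inv, le_div_iff₀ (by positivity), mul_comm (Real.exp _), neg_div]
      refine hb.trans_eq ?_
      field_simp
    rw [smul_eq_mul, abs_neg, abs_of_pos (density_pos hβ t), e1, div_eq_mul_one_div]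
    have hn := arcCoeff_nonneg h (distFun β (-t))
    have hd := density_pos hβ t
    calc arcCoeff h (distFun β (-t)) * (1 / psiSq θ τ t) ≤
        arcCoeff h (distFun β (-t)) *
          (R / normConst β * density β t * distFun β (-t) ^ (-p)) := by gcongr
      _ = R / normConst β * (density β t *
          (arcCoeff h (distFun β (-t)) * distFun β (-t) ^ (-p))) := by ring
      _ ≤ _ := by gcongr; exact arcCoeff_mul_rpow_le hv
  rw [integral_const_mul, ← hcv] at hle
  -- Enlarging the range of v to the whole half-line leaves the rate in h unchanged and makes the
  -- integral explicit.
  have hmono : ∫ v in (fun t => distFun β (-t)) '' Ioi 0, powMajorant a p v ≤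
      ∫ v in Ioi (0:ℝ), powMajorant a p v :=
    setIntegral_mono_set hGi ((ae_restrict_iff' measurableSet_Ioi).2
      (Eventually.of_forall fun v hv => powMajorant_nonneg hv)) himg.eventuallyLE
  rw [hGv] at hmono
  calc shiftCoeff β θ τ h ≤ 2 * (R / normConst β *
      (a ^ (p - 3) * (1 / (3 - p) + 1 / (p - 1)))) := by
        rw [hsymm]; gcongr; exact hle.trans (by gcongr)
    _ = _ := by
      rw [hK, baseConst, hp, ha, show (3 - 2 * r - 3) = -(2 * r) by ring,
        Real.mul_rpow Real.pi_pos.le hh'.le]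
      have : 1 - r ≠ 0 := by linarith
      have e : 3 - 2 * r - 1 = 2 - 2 * r := by ring
      have e' : 3 - (3 - 2 * r) = 2 * r := by ring
      have : r ≠ 0 := by linarith
      rw [e, e']
      field_simp
      ring

end LatticeQMC

/-! ### The Fourier series of the shift-averaged kernel -/

namespace LatticeQMC
open Set Filter Topology

/-- This is the Fourier series of the second Bernoulli polynomial. Division by zero gives 0, so the
index h = 0 contributes nothing. -/
lemma hasSum_exp_div_sq {x : ℝ} (hx : x ∈ Icc (0:ℝ) 1) :
    HasSum (fun h : ℤ => 1 / (h : ℂ) ^ 2 * Complex.exp (2 * Real.pi * Complex.I * h * x))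
      ((2 * Real.pi ^ 2 * (x ^ 2 - x + 6⁻¹) : ℝ) : ℂ) := by
  have h := hasSum_one_div_pow_mul_fourier_mul_bernoulliFun le_rfl hx
  rw [bernoulliFun_two] at h
  convert! h using 1
  · funext n
    rw [fourier_coe_apply]
    simp
  · push_cast
    rw [mul_pow, mul_pow, Complex.I_sq, Nat.factorial_two]
    push_cast
    ring

lemma exp_int_mul_add_one (h : ℤ) (x : ℝ) :
    Complex.exp (2 * Real.pi * Complex.I * h * ((x + 1 : ℝ) : ℂ)) =
      Complex.exp (2 * Real.pi * Complex.I * h * x) := by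
  have := Complex.exp_int_mul_two_pi_mul_I h
  rw [show 2 * Real.pi * Complex.I * h * ((x + 1 : ℝ) : ℂ) =
    2 * Real.pi * Complex.I * h * x + h * (2 * Real.pi * Complex.I) by push_cast; ring,
    Complex.exp_add, this, mul_one]

lemma arcCoeff_mul_exp (h : ℤ) (w x : ℝ) :
    (arcCoeff h w : ℂ) * Complex.exp (2 * Real.pi * Complex.I * h * x) =
      ((4 * Real.pi ^ 2 : ℝ) : ℂ)⁻¹ *
      (2 * (1 / (h : ℂ) ^ 2 * Complex.exp (2 * Real.pi * Complex.I * h * x)) -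
      1 / (h : ℂ) ^ 2 * Complex.exp (2 * Real.pi * Complex.I * h * ((x + w : ℝ) : ℂ)) -
      1 / (h : ℂ) ^ 2 * Complex.exp (2 * Real.pi * Complex.I * h * ((x - w : ℝ) : ℂ))) := by
  have e1 : Complex.exp (2 * Real.pi * Complex.I * h * ((x + w : ℝ) : ℂ)) =
      Complex.exp (2 * Real.pi * Complex.I * h * x) *
        Complex.exp ((Real.pi * h * w : ℂ) * Complex.I) ^ 2 := by
    rw [← Complex.exp_nat_mul, ← Complex.exp_add]; congr 1; push_cast; ring
  have e2 : Complex.exp (2 * Real.pi * Complex.I * h * ((x - w : ℝ) : ℂ)) =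
      Complex.exp (2 * Real.pi * Complex.I * h * x) *
        Complex.exp (-(Real.pi * h * w : ℂ) * Complex.I) ^ 2 := by
    rw [← Complex.exp_nat_mul, ← Complex.exp_add]; congr 1; push_cast; ring
  have e3 : Complex.exp ((Real.pi * h * w : ℂ) * Complex.I) *
      Complex.exp (-(Real.pi * h * w : ℂ) * Complex.I) = 1 := by
    rw [← Complex.exp_add]; simp
  have e4 : ((Real.sin (Real.pi * h * w) : ℝ) : ℂ) = (Complex.exp (-(Real.pi * h * w : ℂ) * Complex.I)
      - Complex.exp ((Real.pi * h * w : ℂ) * Complex.I)) * Complex.I / 2 := by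
    rw [Complex.ofReal_sin, Complex.sin]; push_cast; rfl
  rw [e1, e2, arcCoeff]
  push_cast [e4] at *
  rw [e4]
  set u := Complex.exp ((Real.pi * h * w : ℂ) * Complex.I)
  set v := Complex.exp (-(Real.pi * h * w : ℂ) * Complex.I)
  rcases eq_or_ne h 0 with rfl | hh
  · simp
  have hh' : (h : ℂ) ≠ 0 := by exact_mod_cast hh
  have hp : (Real.pi : ℂ) ≠ 0 := by exact_mod_cast Real.pi_ne_zero
  have hI := Complex.I_sq
  field_simp
  rw [hI]
  linear_combination 8 * e3

/-- Writing sin² through exponentials, as in `arcCoeff_mul_exp`, presents the series as a second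
difference of the Bernoulli series at x, x + w and x - w. Moving x + w and x - w back into [0, 1] by
periodicity gives four cases, one for each combination of active positive parts. -/
lemma hasSum_arcCoeff {w x : ℝ} (hw : w ∈ Icc (0:ℝ) 1) (hx : x ∈ Icc (0:ℝ) 1) :
    HasSum (fun h : ℤ => (arcCoeff h w : ℂ) * Complex.exp (2 * Real.pi * Complex.I * h * x))
      ((max (w - x) 0 + max (w - (1 - x)) 0 - w ^ 2 : ℝ) : ℂ) := by
  have hx1 := hasSum_exp_div_sq hx
  obtain ⟨y₁, hy₁, hs₁⟩ : ∃ y₁, (y₁ = if x + w ≤ 1 then x + w else x + w - 1) ∧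
      HasSum (fun h : ℤ => 1 / (h : ℂ) ^ 2 *
        Complex.exp (2 * Real.pi * Complex.I * h * ((x + w : ℝ) : ℂ)))
      ((2 * Real.pi ^ 2 * (y₁ ^ 2 - y₁ + 6⁻¹) : ℝ) : ℂ) := by
    refine ⟨_, rfl, ?_⟩
    split_ifs with hc
    · exact hasSum_exp_div_sq ⟨add_nonneg hx.1 hw.1, hc⟩
    · have := hasSum_exp_div_sq (x := x + w - 1) ⟨by linarith, by linarith [hx.2, hw.2]⟩
      simp_rw [← exp_int_mul_add_one _ (x + w - 1), sub_add_cancel] at this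
      exact this
  obtain ⟨y₂, hy₂, hs₂⟩ : ∃ y₂, (y₂ = if w ≤ x then x - w else x - w + 1) ∧
      HasSum (fun h : ℤ => 1 / (h : ℂ) ^ 2 *
        Complex.exp (2 * Real.pi * Complex.I * h * ((x - w : ℝ) : ℂ)))
      ((2 * Real.pi ^ 2 * (y₂ ^ 2 - y₂ + 6⁻¹) : ℝ) : ℂ) := by
    refine ⟨_, rfl, ?_⟩
    split_ifs with hc
    · exact hasSum_exp_div_sq ⟨by linarith, by linarith [hx.2, hw.1]⟩
    · have := hasSum_exp_div_sq (x := x - w + 1) ⟨by linarith [hx.1, hw.2], by linarith⟩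
      simp_rw [exp_int_mul_add_one _ (x - w)] at this
      exact this
  have := (((hx1.mul_left 2).sub hs₁).sub hs₂).mul_left ((4 * Real.pi ^ 2 : ℝ) : ℂ)⁻¹
  simp_rw [← arcCoeff_mul_exp] at this
  have hreal : max (w - x) 0 + max (w - (1 - x)) 0 - w ^ 2 = (4 * Real.pi ^ 2)⁻¹ *
      (2 * (2 * Real.pi ^ 2 * (x ^ 2 - x + 6⁻¹)) - 2 * Real.pi ^ 2 * (y₁ ^ 2 - y₁ + 6⁻¹)
        - 2 * Real.pi ^ 2 * (y₂ ^ 2 - y₂ + 6⁻¹)) := by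
    have hp := Real.pi_ne_zero
    rw [← mul_right_inj' (show (4 * Real.pi ^ 2 : ℝ) ≠ 0 by positivity),
      mul_inv_cancel_left₀ (by positivity), hy₁, hy₂]
    by_cases c1 : x + w ≤ 1 <;> by_cases c2 : w ≤ x <;> simp only [c1, c2, if_true, if_false]
    · rw [max_eq_right (by linarith), max_eq_right (by linarith)]; ring
    · rw [max_eq_left (by linarith), max_eq_right (by linarith)]; ring
    · rw [max_eq_right (by linarith), max_eq_left (by linarith)]; ring
    · rw [max_eq_left (by linarith), max_eq_left (by linarith)]; ring
  convert! this using 1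
  rw [hreal]
  push_cast
  ring

variable {β θ τ : ℝ}

/-- The admissible range of r is nonempty. This provides summability of the coefficients before any
particular r is given. -/
lemma exists_smoothness (hτβ : τ ≤ β) (hβ : 0 < β) (hθβ : τ = β → θ < 1 / β) :
    ∃ r : ℝ, 1 / 2 < r ∧ (τ < β → r < 1) ∧ (τ = β → r < 1 - θ * β / 2) := by
  rcases hτβ.lt_or_eq with h | h
  · exact ⟨3 / 4, by norm_num, fun _ => by norm_num, fun h' => absurd h' h.ne⟩
  · have h1 := hθβ h
    rw [lt_div_iff₀ hβ] at h1
    exact ⟨(1 / 2 + (1 - θ * β / 2)) / 2, by linarith, fun h' => absurd h h'.ne,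
      fun _ => by linarith⟩

lemma summable_shiftCoeff (hτ : 0 < τ) (hτβ : τ ≤ β) (hθ : 0 < θ)
    (hθβ : τ = β → θ < 1 / β) : Summable (shiftCoeff β θ τ) := by
  obtain ⟨r, hr, hr1, hr2⟩ := exists_smoothness hτβ (hτ.trans_le hτβ) hθβ
  refine .of_nonneg_of_le shiftCoeff_nonneg (fun h => ?_)
    ((Real.summable_abs_int_rpow (b := 2 * r) (by linarith)).mul_left |constK β θ τ r|)
  rcases eq_or_ne h 0 with rfl | hh
  · rw [shiftCoeff_zero]; positivity
  · refine (shiftCoeff_le hτ hτβ hθ hθβ hr hr1 hr2 hh).trans ?_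
    gcongr
    exact le_abs_self _

/-- The coefficients of the integrand are nonnegative, so the L¹ norms of its terms are the numbers
`shiftCoeff` themselves. Their summability permits interchanging the sum over h with the integral
over t. -/
lemma hasSum_shiftKernel (hτ : 0 < τ) (hτβ : τ ≤ β) (hθ : 0 < θ)
    (hθβ : τ = β → θ < 1 / β) {x : ℝ} (hx : x ∈ Icc (0:ℝ) 1) :
    HasSum (fun h : ℤ => (shiftCoeff β θ τ h : ℂ) *
      Complex.exp (2 * Real.pi * Complex.I * h * x)) (shiftKernel β θ τ x : ℂ) := by
  have hβ : 0 < β := hτ.trans_le hτβ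
  let F : ℤ → ℝ → ℂ := fun h t => ((arcCoeff h (distFun β t) / psiSq θ τ t : ℝ) : ℂ) *
    Complex.exp (2 * Real.pi * Complex.I * h * x)
  have hnorm : ∀ h t, ‖F h t‖ = arcCoeff h (distFun β t) / psiSq θ τ t := fun h t => by
    have : ‖Complex.exp (2 * Real.pi * Complex.I * h * x)‖ = 1 := by
      rw [show 2 * Real.pi * Complex.I * h * x = ((2 * Real.pi * h * x : ℝ) : ℂ) * Complex.I by
        push_cast; ring, Complex.norm_exp_ofReal_mul_I]
    rw [norm_mul, this, mul_one, Complex.norm_real, Real.norm_of_nonneg]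
    exact div_nonneg (arcCoeff_nonneg _ _) (psiSq_pos θ τ t).le
  have hint : ∀ h, Integrable (F h) := fun h =>
    (integrable_arcCoeff hτ hτβ hθ hθβ h).ofReal.mul_const _
  have hsum : Summable fun h => ∫ t, ‖F h t‖ := by
    simp_rw [hnorm]
    exact summable_shiftCoeff hτ hτβ hθ hθβ
  have key := hasSum_integral_of_summable_integral_norm hint hsum
  convert! key using 1
  · funext h
    simp only [F]
    rw [integral_mul_const, integral_complex_ofReal]; rfl
  · rw [shiftKernel, ← integral_complex_ofReal]
    refine integral_congr_ae (Eventually.of_forall fun t => ?_)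
    have hw : distFun β t ∈ Icc (0:ℝ) 1 := ⟨(distFun_pos hβ t).le, (distFun_lt_one hβ t).le⟩
    have := ((hasSum_arcCoeff hw hx).div_const (psiSq θ τ t : ℂ)).tsum_eq
    simp only [F]
    rw [Complex.ofReal_div, ← this]
    refine tsum_congr fun h => ?_
    push_cast; ring

end LatticeQMC

namespace LatticeQMC
open Set Filter Topology

/-! ### Sums over residue classes -/

/-- The sum of `f h` over the integers `h` with `h * z ≡ b` modulo `n`. -/
noncomputable def resSum {n : ℕ} (f : ℤ → ℝ) (z b : ZMod n) : ℝ :=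
  ∑' h : ℤ, if (h : ZMod n) * z = b then f h else 0

lemma summable_ite_of_nonneg {f : ℤ → ℝ} (hf : Summable f) (h0 : ∀ h, 0 ≤ f h) (p : ℤ → Prop)
    [DecidablePred p] : Summable fun h => if p h then f h else 0 :=
  .of_nonneg_of_le (fun h => by split_ifs <;> simp [h0]) (fun h => by split_ifs <;> simp [h0]) hf

lemma resSum_nonneg {n : ℕ} {f : ℤ → ℝ} (h0 : ∀ h, 0 ≤ f h) (z b : ZMod n) : 0 ≤ resSum f z b :=
  tsum_nonneg fun h => by split_ifs <;> simp [h0]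

lemma sum_resSum {n : ℕ} [NeZero n] {f : ℤ → ℝ} (hf : Summable f) (h0 : ∀ h, 0 ≤ f h)
    (z : ZMod n) : ∑ b, resSum f z b = ∑' h, f h := by
  unfold resSum
  rw [← Summable.tsum_finsetSum fun b _ => summable_ite_of_nonneg hf h0 _]
  simp

lemma sum_rpow_le {ι : Type*} (s : Finset ι) {f : ι → ℝ} (h0 : ∀ i ∈ s, 0 ≤ f i) {p : ℝ}
    (hp0 : 0 < p) (hp1 : p ≤ 1) : (∑ i ∈ s, f i) ^ p ≤ ∑ i ∈ s, f i ^ p := by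
  classical
  induction s using Finset.induction_on with
  | empty => simp [Real.zero_rpow hp0.ne']
  | insert a s ha ih =>
    rw [Finset.sum_insert ha, Finset.sum_insert ha]
    have h1 := ih fun i hi => h0 i (Finset.mem_insert_of_mem hi)
    exact (Real.rpow_add_le_add_rpow (h0 a (Finset.mem_insert_self a s))
      (Finset.sum_nonneg fun i hi => h0 i (Finset.mem_insert_of_mem hi)) hp0.le hp1).trans
      (by gcongr)

/-- Subadditivity of x ↦ x^p, applied to finite partial sums and carried to the limit. -/
lemma resSum_rpow_le {n : ℕ} {f g : ℤ → ℝ} (hf : Summable f) (hf0 : ∀ h, 0 ≤ f h)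
    (hg : Summable g) {p : ℝ} (hp0 : 0 < p) (hp1 : p ≤ 1) (hfg : ∀ h, f h ^ p ≤ g h)
    (z b : ZMod n) : resSum f z b ^ p ≤ resSum g z b := by
  have hg0 : ∀ h, 0 ≤ g h := fun h => (Real.rpow_nonneg (hf0 h) p).trans (hfg h)
  have hs := (summable_ite_of_nonneg hf hf0 fun h => (h : ZMod n) * z = b).hasSum
  have hs' := summable_ite_of_nonneg hg hg0 fun h => (h : ZMod n) * z = b
  refine le_of_tendsto (((Real.continuous_rpow_const hp0.le).tendsto _).comp hs)
    (Eventually.of_forall fun s => ?_)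
  refine (sum_rpow_le s (fun h _ => by split_ifs <;> simp [hf0]) hp0 hp1).trans ?_
  refine le_trans (Finset.sum_le_sum fun h _ => ?_)
    (hs'.sum_le_tsum s fun h _ => by split_ifs <;> simp [hg0])
  split_ifs
  · exact hfg h
  · rw [Real.zero_rpow hp0.ne']

lemma card_candidates {n : ℕ} (hn : 2 ≤ n) : (candidates n).card = n.totient := by
  rw [Nat.totient_eq_card_coprime, candidates]
  congr 1
  ext c
  simp only [Finset.mem_filter, Finset.mem_Icc, Finset.mem_range]
  constructor
  · rintro ⟨⟨h1, h2⟩, h3⟩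
    exact ⟨by omega, h3.symm⟩
  · rintro ⟨h1, h2⟩
    refine ⟨⟨?_, by omega⟩, h2.symm⟩
    rcases Nat.eq_zero_or_pos c with rfl | h
    · simp at h2; omega
    · exact h

/-- For c coprime to n, hc ≡ b forces gcd(h, n) = gcd(b, n) = g. After cancelling g, the residue of
c modulo m = n/g is determined, so the quotient c / m, which takes at most g values, identifies c.
-/
lemma card_filter_candidates_le {n : ℕ} (hn : 2 ≤ n) (h : ℤ) (b : ZMod n) :
    ((candidates n).filter fun c : ℕ => (h : ZMod n) * c = b).card ≤
      if ((Nat.gcd b.val n : ℕ) : ℤ) ∣ h then Nat.gcd b.val n else 0 := by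
  have : NeZero n := ⟨by omega⟩
  set g := Nat.gcd b.val n with hg
  have hgpos : 0 < g := Nat.gcd_pos_of_pos_right _ (by omega)
  have hdvd : ∀ c ∈ (candidates n).filter fun c : ℕ => (h : ZMod n) * c = b,
      (n : ℤ) ∣ h * c - b.val := fun c hc => by
    have := (Finset.mem_filter.1 hc).2
    rw [← ZMod.intCast_zmod_eq_zero_iff_dvd]
    push_cast
    rw [this, ZMod.natCast_val, ZMod.cast_id, sub_self]
  have hgcd : ∀ c ∈ (candidates n).filter fun c : ℕ => (h : ZMod n) * c = b,
      Int.gcd h n = g := fun c hc => by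
    have hcop : c.Coprime n := (Finset.mem_filter.1 (Finset.mem_filter.1 hc).1).2
    obtain ⟨k, hk⟩ := hdvd c hc
    have e1 : Int.gcd (h * c) n = Int.gcd h n := by
      rw [Int.gcd, Int.gcd, Int.natAbs_mul, Int.natAbs_natCast, Int.natAbs_natCast]
      exact Nat.Coprime.gcd_mul_right_cancel h.natAbs hcop
    have e2 : Int.gcd (h * c) n = Int.gcd (b.val : ℤ) n := by
      rw [show h * c = b.val + n * k by linarith]
      simp
    rw [← e1, e2, hg, Int.gcd_natCast_natCast]
  by_cases hne : ((candidates n).filter fun c : ℕ => (h : ZMod n) * c = b).Nonempty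
  · obtain ⟨c₀, hc₀⟩ := hne
    have hgh := hgcd c₀ hc₀
    have hgd : (g : ℤ) ∣ h := by rw [← hgh]; exact Int.gcd_dvd_left ..
    rw [if_pos hgd]
    obtain ⟨m, hm⟩ : g ∣ n := Nat.gcd_dvd_right _ _
    obtain ⟨h', hh'⟩ := hgd
    have hmpos : 0 < m := Nat.pos_of_ne_zero fun h0 => by rw [h0] at hm; omega
    have hcop : IsCoprime (m : ℤ) h' := by
      rw [Int.isCoprime_iff_gcd_eq_one]
      have h1 : Int.gcd (g * h') (g * m) = g := by
        rw [← hh']; rw [hm] at hgh; push_cast at hgh; exact hgh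
      rw [Int.gcd_mul_left, Int.natAbs_natCast] at h1
      rw [Int.gcd_comm]
      exact Nat.eq_of_mul_eq_mul_left hgpos (by rw [h1, mul_one])
    have hmod : ∀ c ∈ (candidates n).filter fun c : ℕ => (h : ZMod n) * c = b,
        c % m = c₀ % m := fun c hc => by
      have h1 : (n : ℤ) ∣ h * (c - c₀) := by
        have := dvd_sub (hdvd c hc) (hdvd c₀ hc₀)
        rwa [show h * c - b.val - (h * c₀ - b.val) = h * ((c : ℤ) - c₀) by ring] at this
      have h2 : (m : ℤ) ∣ h' * (c - c₀) := by
        rw [hm, hh'] at h1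
        push_cast at h1
        rw [mul_assoc] at h1
        exact Int.dvd_of_mul_dvd_mul_left (by positivity) h1
      have h3 := hcop.dvd_of_dvd_mul_left h2
      have h4 : (c : ℤ) % m = c₀ % m := (Int.modEq_iff_dvd.2 h3).symm
      exact_mod_cast h4
    calc _ ≤ (Finset.range g).card := by
          refine Finset.card_le_card_of_injOn (fun c => c / m) (fun c hc => ?_) fun c hc c' hc' e => ?_
          · have h1 := (Finset.mem_Icc.1 (Finset.mem_filter.1 (Finset.mem_filter.1 hc).1).1).2
            simp only [Finset.coe_range, mem_Iio]
            rw [Nat.div_lt_iff_lt_mul hmpos, ← hm]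
            omega
          · have h1 := hmod c hc
            have h2 := hmod c' hc'
            rw [← Nat.div_add_mod c m, ← Nat.div_add_mod c' m, h1, h2]
            simp only at e
            rw [e]
      _ = g := Finset.card_range g
  · rw [Finset.not_nonempty_iff_eq_empty.1 hne, Finset.card_empty]
    exact Nat.zero_le _

/-- Only multiples of g = gcd(b, n) occur as h, each for at most g candidates. By homogeneity the
total is at most g·g^{-α} times the full sum, and α > 1 makes this factor at most 1. Hence no
residue b, not even b = 0, is worse than the full sum, and n need not be prime. -/
lemma sum_candidates_resSum_le {n : ℕ} (hn : 2 ≤ n) {A α : ℝ} (hA : 0 ≤ A) (hα : 1 < α)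
    (b : ZMod n) :
    ∑ c ∈ candidates n, resSum (fun h => A * |(h : ℝ)| ^ (-α)) (c : ZMod n) b ≤
      ∑' h : ℤ, A * |(h : ℝ)| ^ (-α) := by
  have hs : Summable fun h : ℤ => A * |(h : ℝ)| ^ (-α) := (Real.summable_abs_int_rpow hα).mul_left A
  have h0 : ∀ h : ℤ, 0 ≤ A * |(h : ℝ)| ^ (-α) := fun h => by positivity
  set f := fun h : ℤ => A * |(h : ℝ)| ^ (-α) with hf
  set g := Nat.gcd b.val n with hg
  have hgpos : 0 < g := Nat.gcd_pos_of_pos_right _ (by omega)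
  have hinj : Function.Injective fun h : ℤ => (g : ℤ) * h :=
    mul_right_injective₀ (by exact_mod_cast hgpos.ne')
  have hs2 : Summable fun h : ℤ => if (g : ℤ) ∣ h then g * f h else 0 :=
    summable_ite_of_nonneg (hs.mul_left _) (fun h => mul_nonneg (Nat.cast_nonneg g) (h0 h)) _
  unfold resSum
  rw [← Summable.tsum_finsetSum fun c _ => summable_ite_of_nonneg hs h0 _]
  calc _ ≤ ∑' h : ℤ, if (g : ℤ) ∣ h then g * f h else 0 := by
        refine Summable.tsum_le_tsum (fun h => ?_)
          (summable_sum fun c _ => summable_ite_of_nonneg hs h0 _) hs2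
        rw [← Finset.sum_filter, Finset.sum_const, nsmul_eq_mul]
        have := card_filter_candidates_le hn h b
        split_ifs at this ⊢ with hd
        · exact mul_le_mul_of_nonneg_right (by exact_mod_cast this) (h0 h)
        · rw [Nat.le_zero.1 this]; simp
    _ = ∑' h : ℤ, g * f (g * h) := by
        rw [← hinj.tsum_eq]
        · simp
        · intro h hh
          by_contra hc
          refine hh ?_
          refine if_neg ?_
          rintro ⟨k, rfl⟩
          exact hc ⟨k, rfl⟩
    _ ≤ ∑' h, f h := by
        have e : ∀ h : ℤ, g * f (g * h) = g * (g : ℝ) ^ (-α) * f h := fun h => by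
          simp only [hf]
          push_cast
          rw [abs_mul, Nat.abs_cast, Real.mul_rpow (by positivity) (by positivity)]
          ring
        simp_rw [e]
        rw [tsum_mul_left]
        refine mul_le_of_le_one_left (tsum_nonneg h0) ?_
        have hg1 : (1:ℝ) ≤ g := by exact_mod_cast hgpos
        rw [← Real.rpow_one_add' (by positivity) (by linarith)]
        exact Real.rpow_le_one_of_one_le_of_nonpos hg1 (by linarith)

lemma tsum_abs_int_rpow {α : ℝ} (hα : 1 < α) :
    ∑' h : ℤ, |(h : ℝ)| ^ (-α) = 2 * (riemannZeta (α : ℂ)).re := by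
  have hz : (riemannZeta (α : ℂ)).re = ∑' k : ℕ, ((k + 1 : ℕ) : ℝ) ^ (-α) := by
    rw [zeta_eq_tsum_one_div_nat_add_one_cpow (by simpa using hα)]
    have : ∀ k : ℕ, 1 / (k + 1 : ℂ) ^ (α : ℂ) = ((((k + 1 : ℕ) : ℝ) ^ (-α) : ℝ) : ℂ) := fun k => by
      rw [Real.rpow_neg (by positivity), Complex.ofReal_inv, Complex.ofReal_cpow (by positivity),
        one_div]
      push_cast; rfl
    simp_rw [this]
    rw [← Complex.ofReal_tsum, Complex.ofReal_re]
  have hs : Summable fun k : ℕ => ((k + 1 : ℕ) : ℝ) ^ (-α) :=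
    (summable_nat_add_iff 1).2 (Real.summable_nat_rpow.2 (by linarith))
  have hs0 : Summable fun k : ℕ => (k : ℝ) ^ (-α) := Real.summable_nat_rpow.2 (by linarith)
  have h1 : HasSum (fun k : ℕ => |((k : ℤ) : ℝ)| ^ (-α)) (∑' k : ℕ, ((k + 1 : ℕ) : ℝ) ^ (-α)) := by
    have := hs0.hasSum
    rw [hs0.tsum_eq_zero_add, Nat.cast_zero, Real.zero_rpow (by linarith), zero_add] at this
    simpa using this
  have h2 : HasSum (fun k : ℕ => |((-(k + 1 : ℤ) : ℤ) : ℝ)| ^ (-α))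
      (∑' k : ℕ, ((k + 1 : ℕ) : ℝ) ^ (-α)) := by
    convert! hs.hasSum using 1
    funext k
    congr 1
    push_cast
    rw [abs_neg, abs_of_nonneg (by positivity)]
  rw [(HasSum.of_nat_of_neg_add_one (f := fun h : ℤ => |(h : ℝ)| ^ (-α)) h1 h2).tsum_eq, hz]
  ring

end LatticeQMC

/-! ### Finite Fourier analysis of lattice means -/

namespace LatticeQMC
open Set Filter Topology

/-- `shiftKernel` at the fractions `a / n`, as a function on `ZMod n`. -/
noncomputable def kernelMod (β θ τ : ℝ) {n : ℕ} (a : ZMod n) : ℝ :=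
  shiftKernel β θ τ ((a.val : ℝ) / n)

section
variable {β θ τ : ℝ} {n : ℕ} [NeZero n]

lemma shiftKernel_fract_div (m : ℤ) :
    shiftKernel β θ τ (Int.fract ((m : ℝ) / n)) = kernelMod β θ τ (m : ZMod n) := by
  rw [kernelMod, Int.fract_div_intCast_eq_div_intCast_mod, ← ZMod.val_intCast, Int.cast_natCast]

lemma shiftKernel_latticePoint {s : ℕ} (z : Fin s → ℕ) (i : ℕ) (j : Fin s) :
    shiftKernel β θ τ (latticePoint n z i j) = kernelMod β θ τ ((i : ZMod n) * (z j : ZMod n)) := by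
  have := shiftKernel_fract_div (β := β) (θ := θ) (τ := τ) (n := n) (i * z j)
  push_cast at this
  exact this

/-- At a multiple of 1/n the h-th exponential depends only on the residue of hz, so grouping the
frequencies by this residue turns the Fourier series into a finite character sum. -/
lemma kernelMod_mul_eq (hτ : 0 < τ) (hτβ : τ ≤ β) (hθ : 0 < θ) (hθβ : τ = β → θ < 1 / β)
    (i z : ZMod n) : (kernelMod β θ τ (i * z) : ℂ) =
      ∑ b, (resSum (shiftCoeff β θ τ) z b : ℂ) * ZMod.stdAddChar (i * b) := by
  have hn : (0 : ℝ) < n := by exact_mod_cast Nat.pos_of_ne_zero (NeZero.ne n)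
  have hx : (((i * z).val : ℝ) / n) ∈ Icc (0:ℝ) 1 := by
    refine ⟨by positivity, ?_⟩
    rw [div_le_one hn]
    exact_mod_cast (ZMod.val_lt _).le
  have hs := summable_shiftCoeff hτ hτβ hθ hθβ
  have h := hasSum_shiftKernel hτ hτβ hθ hθβ hx
  have e : ∀ h : ℤ, Complex.exp (2 * Real.pi * Complex.I * h * (((i * z).val : ℝ) / n : ℝ)) =
      ZMod.stdAddChar (i * ((h : ZMod n) * z)) := fun h => by
    have := ZMod.stdAddChar_coe (N := n) (h * ((i * z).val : ℤ))
    push_cast at this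
    rw [ZMod.natCast_val, ZMod.cast_id] at this
    rw [mul_left_comm, this]
    congr 1
    push_cast
    ring
  simp_rw [e] at h
  rw [kernelMod, ← h.tsum_eq]
  simp_rw [resSum, Complex.ofReal_tsum, ← tsum_mul_right]
  rw [← Summable.tsum_finsetSum]
  · refine tsum_congr fun h => ?_
    rw [Finset.sum_eq_single ((h : ZMod n) * z)]
    · simp
    · intro b _ hb
      rw [if_neg hb.symm]; simp
    · simp
  · intro b _
    exact (Complex.hasSum_ofReal.2 (summable_ite_of_nonneg hs shiftCoeff_nonneg
      fun h => (h : ZMod n) * z = b).hasSum).summable.mul_right _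

/-- The index i = n represents the residue 0. -/
lemma sum_Icc_natCast {M : Type*} [AddCommMonoid M] (g : ZMod n → M) :
    ∑ i ∈ Finset.Icc 1 n, g (i : ZMod n) = ∑ a, g a := by
  have hn : 0 < n := Nat.pos_of_ne_zero (NeZero.ne n)
  refine Finset.sum_bij (fun i _ => (i : ZMod n)) (fun _ _ => Finset.mem_univ _) ?_ ?_
    fun _ _ => rfl
  · intro i hi j hj hij
    rw [Finset.mem_Icc] at hi hj
    have h := (ZMod.natCast_eq_natCast_iff' _ _ _).1 hij
    rcases hi.2.lt_or_eq with h1 | h1 <;> rcases hj.2.lt_or_eq with h2 | h2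
    · rwa [Nat.mod_eq_of_lt h1, Nat.mod_eq_of_lt h2] at h
    · rw [Nat.mod_eq_of_lt h1, h2, Nat.mod_self] at h; omega
    · rw [Nat.mod_eq_of_lt h2, h1, Nat.mod_self] at h; omega
    · omega
  · intro a _
    rcases Nat.eq_zero_or_pos a.val with h | h
    · exact ⟨n, Finset.mem_Icc.2 ⟨hn, le_rfl⟩, by
        rw [ZMod.natCast_self, eq_comm, ← ZMod.val_eq_zero, h]⟩
    · exact ⟨a.val, Finset.mem_Icc.2 ⟨h, (ZMod.val_lt a).le⟩, by
        rw [ZMod.natCast_val, ZMod.cast_id]⟩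

/-- The mean over the lattice of `∏_{j ∈ u} ϑ`. -/
noncomputable def latticeMean (β θ τ : ℝ) (n : ℕ) [NeZero n] {s : ℕ} (u : Finset (Fin s))
    (z : Fin s → ℕ) : ℝ :=
  1 / n * ∑ i : ZMod n, ∏ j ∈ u, kernelMod β θ τ (i * (z j : ZMod n))

lemma latticeMean_eq {s : ℕ} (u : Finset (Fin s)) (z : Fin s → ℕ) :
    1 / n * ∑ i ∈ Finset.Icc 1 n, ∏ j ∈ u, shiftKernel β θ τ (latticePoint n z i j) =
      latticeMean β θ τ n u z := by
  simp_rw [shiftKernel_latticePoint]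
  rw [sum_Icc_natCast fun i : ZMod n => ∏ j ∈ u, kernelMod β θ τ (i * (z j : ZMod n))]
  rfl

lemma latticeMean_congr {s : ℕ} {u : Finset (Fin s)} {z z' : Fin s → ℕ}
    (h : ∀ j ∈ u, z j = z' j) : latticeMean β θ τ n u z = latticeMean β θ τ n u z' := by
  unfold latticeMean
  congr 1
  refine Finset.sum_congr rfl fun i _ => Finset.prod_congr rfl fun j hj => ?_
  rw [h j hj]

end

section
variable {β θ τ : ℝ} {n : ℕ} [NeZero n]

/-- Finite Fourier coefficients of lattice products, with a majorant of their `p`-th powers. -/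
lemma exists_fourier_prod (hτ : 0 < τ) (hτβ : τ ≤ β) (hθ : 0 < θ) (hθβ : τ = β → θ < 1 / β)
    {N : ℤ → ℝ} (hN : Summable N) {p : ℝ} (hp0 : 0 < p) (hp1 : p ≤ 1)
    (hcN : ∀ h, shiftCoeff β θ τ h ^ p ≤ N h) {s : ℕ} (z : Fin s → ℕ) (u : Finset (Fin s)) :
    ∃ C C' : ZMod n → ℝ, (∀ a, 0 ≤ C a) ∧ (∀ a, C a ^ p ≤ C' a) ∧
      ∑ a, C' a ≤ (∑' h, N h) ^ u.card ∧
      ∀ i : ZMod n, ((∏ j ∈ u, kernelMod β θ τ (i * (z j : ZMod n)) : ℝ) : ℂ) =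
        ∑ a, (C a : ℂ) * ZMod.stdAddChar (i * a) := by
  have hc0 := shiftCoeff_nonneg (β := β) (θ := θ) (τ := τ)
  have hcs := summable_shiftCoeff hτ hτβ hθ hθβ
  have hN0 : ∀ h, 0 ≤ N h := fun h => (Real.rpow_nonneg (hc0 h) p).trans (hcN h)
  induction u using Finset.induction_on with
  | empty =>
    refine ⟨fun a => if a = 0 then 1 else 0, fun a => if a = 0 then 1 else 0, ?_, ?_, ?_, ?_⟩
    · intro a; dsimp only; split_ifs <;> simp
    · intro a
      dsimp only
      split_ifs
      · simp
      · rw [Real.zero_rpow hp0.ne']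
    · simp
    · intro i
      rw [Finset.sum_eq_single 0] <;> simp +contextual
  | insert j u hj ih =>
    obtain ⟨C, C', h0, h1, h2, h3⟩ := ih
    have h0' : ∀ a, 0 ≤ C' a := fun a => (Real.rpow_nonneg (h0 a) p).trans (h1 a)
    -- A product of functions has the convolution of their coefficients; the majorants are convolved
    -- in parallel, and the total mass of a convolution is the product of the masses.
    refine ⟨fun a => ∑ b, C b * resSum (shiftCoeff β θ τ) (z j : ZMod n) (a - b),
      fun a => ∑ b, C' b * resSum N (z j : ZMod n) (a - b), ?_, ?_, ?_, ?_⟩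
    · exact fun a => Finset.sum_nonneg fun b _ => mul_nonneg (h0 b) (resSum_nonneg hc0 _ _)
    · intro a
      refine (sum_rpow_le _ (fun b _ => mul_nonneg (h0 b) (resSum_nonneg hc0 _ _)) hp0 hp1).trans
        (Finset.sum_le_sum fun b _ => ?_)
      rw [Real.mul_rpow (h0 b) (resSum_nonneg hc0 _ _)]
      exact mul_le_mul (h1 b) (resSum_rpow_le hcs hc0 hN hp0 hp1 hcN _ _)
        (Real.rpow_nonneg (resSum_nonneg hc0 _ _) _) (h0' b)
    · rw [Finset.sum_comm, Finset.card_insert_of_notMem hj, pow_succ]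
      simp_rw [← Finset.mul_sum]
      have e : ∀ b, ∑ a, resSum N (z j : ZMod n) (a - b) = ∑' h, N h := fun b => by
        rw [← sum_resSum hN hN0 (z j : ZMod n)]
        exact Fintype.sum_equiv (Equiv.subRight b) _ _ fun a => rfl
      simp_rw [e]
      rw [← Finset.sum_mul]
      exact mul_le_mul_of_nonneg_right h2 (tsum_nonneg hN0)
    · intro i
      rw [Finset.prod_insert hj, Complex.ofReal_mul, h3,
        kernelMod_mul_eq hτ hτβ hθ hθβ, mul_comm, Finset.sum_mul_sum]
      simp_rw [Complex.ofReal_sum, Finset.sum_mul]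
      rw [Finset.sum_comm (s := Finset.univ) (t := Finset.univ)
        (f := fun a b => ((C b * resSum (shiftCoeff β θ τ) (z j : ZMod n) (a - b) : ℝ) : ℂ) * _)]
      refine Finset.sum_congr rfl fun b _ => ?_
      refine Fintype.sum_equiv (Equiv.addRight b) _ _ fun a => ?_
      rw [Equiv.coe_addRight, add_sub_cancel_right, mul_add, AddChar.map_add_eq_mul]
      push_cast
      ring

/-- Averaging the `p`-th powers over the candidates for one component. -/
lemma exists_latticeMean_rpow_le (hτ : 0 < τ) (hτβ : τ ≤ β) (hθ : 0 < θ)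
    (hθβ : τ = β → θ < 1 / β)
    {N : ℤ → ℝ} (hN : Summable N) {p : ℝ} (hp0 : 0 < p) (hp1 : p ≤ 1)
    (hcN : ∀ h, shiftCoeff β θ τ h ^ p ≤ N h)
    (hav : ∀ b : ZMod n, ∑ c ∈ candidates n, resSum N (c : ZMod n) b ≤ ∑' h, N h)
    {s : ℕ} (z : Fin s → ℕ) {u : Finset (Fin s)} {d : Fin s} (hd : d ∉ u) :
    (∀ c, 0 ≤ latticeMean β θ τ n (insert d u) (Function.update z d c)) ∧
    ∑ c ∈ candidates n, latticeMean β θ τ n (insert d u) (Function.update z d c) ^ p ≤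
      (∑' h, N h) ^ (insert d u).card := by
  have hc0 := shiftCoeff_nonneg (β := β) (θ := θ) (τ := τ)
  have hcs := summable_shiftCoeff hτ hτβ hθ hθβ
  have hN0 : ∀ h, 0 ≤ N h := fun h => (Real.rpow_nonneg (hc0 h) p).trans (hcN h)
  obtain ⟨C, C', h0, h1, h2, h3⟩ := exists_fourier_prod (n := n) hτ hτβ hθ hθβ hN hp0 hp1 hcN z u
  have h0' : ∀ a, 0 ≤ C' a := fun a => (Real.rpow_nonneg (h0 a) p).trans (h1 a)
  -- Averaging over i annihilates every character except the trivial one, so only the pairs with b =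
  -- -a survive. The residue sum is the only factor still depending on c.
  have key : ∀ c : ℕ, latticeMean β θ τ n (insert d u) (Function.update z d c) =
      ∑ a, C a * resSum (shiftCoeff β θ τ) (c : ZMod n) (-a) := fun c => by
    have e1 : ∀ i : ZMod n, ((∏ j ∈ insert d u,
        kernelMod β θ τ (i * (Function.update z d c j : ZMod n)) : ℝ) : ℂ) =
        ∑ a, ∑ b, ((C a * resSum (shiftCoeff β θ τ) (c : ZMod n) b : ℝ) : ℂ) *
          ZMod.stdAddChar (i * (a + b)) := fun i => by
      have e2 : ∏ j ∈ u, kernelMod β θ τ (i * (Function.update z d c j : ZMod n)) =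
          ∏ j ∈ u, kernelMod β θ τ (i * (z j : ZMod n)) :=
        Finset.prod_congr rfl fun j hj => by
          rw [Function.update_of_ne (ne_of_mem_of_not_mem hj hd)]
      rw [Finset.prod_insert hd, Complex.ofReal_mul, e2, h3, Function.update_self,
        kernelMod_mul_eq hτ hτβ hθ hθβ, mul_comm, Finset.sum_mul_sum]
      refine Finset.sum_congr rfl fun a _ => Finset.sum_congr rfl fun b _ => ?_
      rw [mul_add, AddChar.map_add_eq_mul]
      push_cast
      ring
    have hn : (n : ℂ) ≠ 0 := by exact_mod_cast NeZero.ne n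
    have e3 : ((latticeMean β θ τ n (insert d u) (Function.update z d c) : ℝ) : ℂ) =
        ((∑ a, C a * resSum (shiftCoeff β θ τ) (c : ZMod n) (-a) : ℝ) : ℂ) := by
      rw [latticeMean, Complex.ofReal_mul, Complex.ofReal_sum]
      simp_rw [e1]
      rw [Finset.sum_comm, Complex.ofReal_sum, Finset.mul_sum]
      refine Finset.sum_congr rfl fun a _ => ?_
      rw [Finset.sum_comm]
      simp_rw [← Finset.mul_sum, AddChar.sum_mulShift _ (ZMod.isPrimitive_stdAddChar n)]
      rw [Finset.sum_eq_single (-a)]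
      · simp
        field_simp
      · intro b _ hb
        rw [if_neg fun h => hb (by rw [eq_neg_iff_add_eq_zero, add_comm]; exact h)]
        simp
      · simp
    exact_mod_cast e3
  refine ⟨fun c => ?_, ?_⟩
  · rw [key]
    exact Finset.sum_nonneg fun a _ => mul_nonneg (h0 a) (resSum_nonneg hc0 _ _)
  · calc _ ≤ ∑ c ∈ candidates n, ∑ a, C' a * resSum N (c : ZMod n) (-a) := by
          refine Finset.sum_le_sum fun c _ => ?_
          rw [key]
          refine (sum_rpow_le _ (fun b _ => mul_nonneg (h0 b) (resSum_nonneg hc0 _ _))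
            hp0 hp1).trans (Finset.sum_le_sum fun b _ => ?_)
          rw [Real.mul_rpow (h0 b) (resSum_nonneg hc0 _ _)]
          exact mul_le_mul (h1 b) (resSum_rpow_le hcs hc0 hN hp0 hp1 hcN _ _)
            (Real.rpow_nonneg (resSum_nonneg hc0 _ _) _) (h0' b)
      _ = ∑ a, C' a * ∑ c ∈ candidates n, resSum N (c : ZMod n) (-a) := by
          rw [Finset.sum_comm]; simp_rw [Finset.mul_sum]
      _ ≤ ∑ a, C' a * ∑' h, N h :=
          Finset.sum_le_sum fun a _ => mul_le_mul_of_nonneg_left (hav _) (h0' a)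
      _ ≤ _ := by
          rw [← Finset.sum_mul, Finset.card_insert_of_notMem hd, pow_succ]
          exact mul_le_mul_of_nonneg_right h2 (tsum_nonneg hN0)

end

end LatticeQMC

/-! ### The component-by-component construction -/

namespace LatticeQMC
open Set Filter Topology

section
variable {β θ τ : ℝ} {n : ℕ} [NeZero n] {s : ℕ}

/-- The weighted lattice mean with the empty set removed. -/
noncomputable def weightedMean (β θ τ : ℝ) (γ : Finset (Fin s) → ℝ) (n : ℕ) [NeZero n]
    (z : Fin s → ℕ) (u : Finset (Fin s)) : ℝ :=
  if u = ∅ then 0 else γ u * latticeMean β θ τ n u z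

lemma sum_erase_empty (S : Finset (Finset (Fin s))) (f : Finset (Fin s) → ℝ) :
    ∑ u ∈ S.erase ∅, f u = ∑ u ∈ S, if u = ∅ then 0 else f u := by
  have h : ∑ u ∈ S.erase ∅, f u = ∑ u ∈ S.erase ∅, if u = ∅ then 0 else f u :=
    Finset.sum_congr rfl fun u hu => by rw [if_neg (Finset.ne_of_mem_erase hu)]
  rw [h]
  exact Finset.sum_subset (Finset.erase_subset _ _) fun u hu hu' => by
    rw [if_pos]
    by_contra hc
    exact hu' (Finset.mem_erase.2 ⟨hc, hu⟩)

lemma sqWorstCaseError_eq (γ : Finset (Fin s) → ℝ) (z : Fin s → ℕ) (d : Fin s) :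
    sqWorstCaseError β θ τ γ n z d =
      ∑ u ∈ (Finset.Iic d).powerset, weightedMean β θ τ γ n z u := by
  rw [sqWorstCaseError]
  simp_rw [latticeMean_eq]
  exact sum_erase_empty _ _

lemma weightedMean_congr {γ : Finset (Fin s) → ℝ} {u : Finset (Fin s)} {z z' : Fin s → ℕ}
    (h : ∀ j ∈ u, z j = z' j) : weightedMean β θ τ γ n z u = weightedMean β θ τ γ n z' u := by
  unfold weightedMean
  rw [latticeMean_congr h]

lemma sqWorstCaseError_congr {γ : Finset (Fin s) → ℝ} {d : Fin s} {z z' : Fin s → ℕ}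
    (h : ∀ j ≤ d, z j = z' j) :
    sqWorstCaseError β θ τ γ n z d = sqWorstCaseError β θ τ γ n z' d := by
  rw [sqWorstCaseError_eq, sqWorstCaseError_eq]
  refine Finset.sum_congr rfl fun u hu => weightedMean_congr fun j hj => h j ?_
  exact Finset.mem_Iic.1 (Finset.mem_powerset.1 hu hj)

/-- Greedy choice from a nonempty finite set. The error for index d involves only components up to
d, so later choices do not disturb earlier minimality. -/
lemma exists_isCBC (hn : 2 ≤ n) (γ : Finset (Fin s) → ℝ) :
    ∃ z : Fin s → ℕ, IsCBC β θ τ γ n z := by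
  have hne : (candidates n).Nonempty :=
    ⟨1, Finset.mem_filter.2 ⟨Finset.mem_Icc.2 ⟨le_rfl, by omega⟩, Nat.coprime_one_left n⟩⟩
  have key : ∀ m : ℕ, m ≤ s → ∃ z : Fin s → ℕ, ∀ d : Fin s, d.val < m → z d ∈ candidates n ∧
      ∀ c ∈ candidates n,
        sqWorstCaseError β θ τ γ n z d ≤ sqWorstCaseError β θ τ γ n (Function.update z d c) d := by
    intro m
    induction m with
    | zero => exact fun _ => ⟨0, fun d hd => absurd hd (Nat.not_lt_zero _)⟩
    | succ m ih =>
      intro hm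
      obtain ⟨z, hz⟩ := ih (by omega)
      let e : Fin s := ⟨m, by omega⟩
      obtain ⟨c₀, hc₀, hmin⟩ := Finset.exists_min_image (candidates n)
        (fun c => sqWorstCaseError β θ τ γ n (Function.update z e c) e) hne
      refine ⟨Function.update z e c₀, fun d hd => ?_⟩
      rcases (Nat.lt_succ_iff_lt_or_eq.1 hd) with h | h
      · have hde : d < e := h
        obtain ⟨h1, h2⟩ := hz d h
        refine ⟨by rwa [Function.update_of_ne hde.ne], fun c hc => ?_⟩
        have a1 : sqWorstCaseError β θ τ γ n (Function.update z e c₀) d =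
            sqWorstCaseError β θ τ γ n z d :=
          sqWorstCaseError_congr fun j hj => Function.update_of_ne (hj.trans_lt hde).ne _ _
        have a2 : sqWorstCaseError β θ τ γ n
            (Function.update (Function.update z e c₀) d c) d =
            sqWorstCaseError β θ τ γ n (Function.update z d c) d :=
          sqWorstCaseError_congr fun j hj => by
            rw [Function.update_comm hde.ne', Function.update_of_ne (hj.trans_lt hde).ne]
        rw [a1, a2]
        exact h2 c hc
      · have hde : d = e := Fin.ext h
        subst hde
        refine ⟨by rwa [Function.update_self], fun c hc => ?_⟩
        rw [Function.update_idem]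
        exact hmin c hc
  obtain ⟨z, hz⟩ := key s le_rfl
  exact ⟨z, fun d => hz d d.2⟩

/-- Induction on the dimension. Passing from m to m + 1 adds exactly the sets containing the new
index. Their contribution at the minimiser is bounded by an average over the candidates, and
subadditivity of x ↦ x^p joins it to the bound already obtained. -/
lemma sum_weightedMean_rpow_le (hn : 2 ≤ n) (hτ : 0 < τ) (hτβ : τ ≤ β) (hθ : 0 < θ)
    (hθβ : τ = β → θ < 1 / β)
    {N : ℤ → ℝ} (hN : Summable N) {p : ℝ} (hp0 : 0 < p) (hp1 : p ≤ 1)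
    (hcN : ∀ h, shiftCoeff β θ τ h ^ p ≤ N h)
    (hav : ∀ b : ZMod n, ∑ c ∈ candidates n, resSum N (c : ZMod n) b ≤ ∑' h, N h)
    {γ : Finset (Fin s) → ℝ} (hγ : ∀ u, 0 < γ u)
    {z : Fin s → ℕ} (hz : IsCBC β θ τ γ n z) (m : ℕ) (hm : m ≤ s) :
    0 ≤ ∑ u ∈ (Finset.univ.filter fun j : Fin s => j.val < m).powerset,
        weightedMean β θ τ γ n z u ∧
    (∑ u ∈ (Finset.univ.filter fun j : Fin s => j.val < m).powerset,
        weightedMean β θ τ γ n z u) ^ p ≤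
      ∑ u ∈ (Finset.univ.filter fun j : Fin s => j.val < m).powerset,
        if u = ∅ then 0 else 1 / (n.totient : ℝ) * (γ u ^ p * (∑' h, N h) ^ u.card) := by
  have hφ : (0:ℝ) < n.totient := by exact_mod_cast Nat.totient_pos.2 (by omega)
  induction m with
  | zero => simp [weightedMean, Real.zero_rpow hp0.ne']
  | succ m ih =>
    obtain ⟨ih0, ih1⟩ := ih (by omega)
    let d : Fin s := ⟨m, by omega⟩
    have hset : (Finset.univ.filter fun j : Fin s => j.val < m + 1) =
        insert d (Finset.univ.filter fun j : Fin s => j.val < m) := by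
      ext j
      simp only [Finset.mem_filter, Finset.mem_univ, true_and, Finset.mem_insert, Fin.ext_iff, d]
      omega
    have hset' : Finset.Iic d = insert d (Finset.univ.filter fun j : Fin s => j.val < m) := by
      rw [← hset]
      ext j
      simp only [Finset.mem_filter, Finset.mem_univ, true_and, Finset.mem_Iic, Fin.le_def, d]
      omega
    set S := Finset.univ.filter fun j : Fin s => j.val < m with hS
    have hdS : d ∉ S := by simp [hS, d]
    have hdu : ∀ u ∈ S.powerset, d ∉ u := fun u hu hd => hdS (Finset.mem_powerset.1 hu hd)
    -- Only the sets containing d see the candidate c; the rest of the error is constant in c, so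
    -- minimising the error is the same as minimising T.
    let T : ℕ → ℝ := fun c => ∑ u ∈ S.powerset,
      weightedMean β θ τ γ n (Function.update z d c) (insert d u)
    have hT : ∀ c, T c = ∑ u ∈ S.powerset,
        γ (insert d u) * latticeMean β θ τ n (insert d u) (Function.update z d c) := fun c =>
      Finset.sum_congr rfl fun u _ => by
        rw [weightedMean, if_neg (Finset.insert_ne_empty _ _)]
    have hT0 : ∀ c, 0 ≤ T c := fun c => by
      rw [hT]
      exact Finset.sum_nonneg fun u hu => mul_nonneg (hγ _).le
        ((exists_latticeMean_rpow_le hτ hτβ hθ hθβ hN hp0 hp1 hcN hav z (hdu u hu)).1 c)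
    have hsplit : ∀ c, sqWorstCaseError β θ τ γ n (Function.update z d c) d =
        ∑ u ∈ S.powerset, weightedMean β θ τ γ n z u + T c := fun c => by
      rw [sqWorstCaseError_eq, hset', Finset.sum_powerset_insert hdS]
      congr 1
      refine Finset.sum_congr rfl fun u hu => weightedMean_congr fun j hj => ?_
      exact Function.update_of_ne (ne_of_mem_of_not_mem hj (hdu u hu)) _ _
    have hmin : ∀ c ∈ candidates n, T (z d) ≤ T c := fun c hc => by
      have h1 := (hz d).2 c hc
      have h2 := hsplit (z d)
      rw [Function.update_eq_self] at h2
      rw [h2, hsplit] at h1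
      linarith
    have hTz : T (z d) = ∑ u ∈ S.powerset, weightedMean β θ τ γ n z (insert d u) := by
      simp only [T, Function.update_eq_self]
    have hTsum : ∑ c ∈ candidates n, T c ^ p ≤
        ∑ u ∈ S.powerset, γ (insert d u) ^ p * (∑' h, N h) ^ (insert d u).card := by
      calc _ ≤ ∑ c ∈ candidates n, ∑ u ∈ S.powerset, γ (insert d u) ^ p *
            latticeMean β θ τ n (insert d u) (Function.update z d c) ^ p := by
            refine Finset.sum_le_sum fun c _ => ?_
            rw [hT]
            have h0 := fun u hu =>
              (exists_latticeMean_rpow_le hτ hτβ hθ hθβ hN hp0 hp1 hcN hav z (hdu u hu)).1 c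
            refine (sum_rpow_le _ (fun u hu => mul_nonneg (hγ _).le (h0 u hu)) hp0 hp1).trans
              (Finset.sum_le_sum fun u hu => ?_)
            rw [Real.mul_rpow (hγ _).le (h0 u hu)]
        _ ≤ _ := by
            rw [Finset.sum_comm]
            refine Finset.sum_le_sum fun u hu => ?_
            rw [← Finset.mul_sum]
            exact mul_le_mul_of_nonneg_left
              (exists_latticeMean_rpow_le hτ hτβ hθ hθβ hN hp0 hp1 hcN hav z (hdu u hu)).2
              (Real.rpow_nonneg (hγ _).le _)
    -- The p-th power is monotone, so T(z_d)^p is at most the mean of T(c)^p over the φ(n)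
    -- candidates.
    have hTmin : T (z d) ^ p ≤ 1 / (n.totient : ℝ) * ∑ u ∈ S.powerset,
        γ (insert d u) ^ p * (∑' h, N h) ^ (insert d u).card := by
      rw [one_div, ← div_eq_inv_mul, le_div_iff₀ hφ, mul_comm]
      refine le_trans ?_ hTsum
      rw [← card_candidates hn, ← nsmul_eq_mul]
      exact Finset.card_nsmul_le_sum _ _ _ fun c hc =>
        Real.rpow_le_rpow (hT0 _) (hmin c hc) hp0.le
    rw [hset, Finset.sum_powerset_insert hdS, Finset.sum_powerset_insert hdS, ← hTz]
    refine ⟨add_nonneg ih0 (hT0 _), (Real.rpow_add_le_add_rpow ih0 (hT0 _) hp0.le hp1).trans ?_⟩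
    refine add_le_add ih1 (hTmin.trans_eq ?_)
    rw [Finset.mul_sum]
    refine Finset.sum_congr rfl fun u _ => ?_
    rw [if_neg (Finset.insert_ne_empty _ _)]

/-- The CBC error bound. -/
lemma sum_latticeMean_rpow_le (hn : 2 ≤ n) (hτ : 0 < τ) (hτβ : τ ≤ β) (hθ : 0 < θ)
    (hθβ : τ = β → θ < 1 / β) {γ : Finset (Fin s) → ℝ} (hγ : ∀ u, 0 < γ u)
    {z : Fin s → ℕ} (hz : IsCBC β θ τ γ n z) {r : ℝ} (hr : 1 / 2 < r)
    (hr1 : τ < β → r < 1) (hr2 : τ = β → r < 1 - θ * β / 2)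
    {lam : ℝ} (hlam : 1 / (2 * r) < lam) (hlam1 : lam ≤ 1) :
    0 ≤ ∑ u ∈ (Finset.univ : Finset (Finset (Fin s))).erase ∅, γ u * latticeMean β θ τ n u z ∧
    (∑ u ∈ (Finset.univ : Finset (Finset (Fin s))).erase ∅,
        γ u * latticeMean β θ τ n u z) ^ lam ≤
      1 / (n.totient : ℝ) * ∑ u ∈ (Finset.univ : Finset (Finset (Fin s))).erase ∅,
        γ u ^ lam * constK β θ τ r ^ (lam * u.card) *
          (2 * (riemannZeta ((2 * r * lam : ℝ) : ℂ)).re) ^ u.card := by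
  have hlam0 : 0 < lam := lt_trans (by positivity) hlam
  have hα : 1 < 2 * r * lam := by
    rwa [div_lt_iff₀ (by linarith), mul_comm] at hlam
  -- The bound for the coefficient at h = 1 reads 0 ≤ shiftCoeff ≤ K.
  have hK : 0 ≤ constK β θ τ r := by
    have h := shiftCoeff_le hτ hτβ hθ hθβ hr hr1 hr2 (one_ne_zero : (1:ℤ) ≠ 0)
    simp only [Int.cast_one, abs_one, Real.one_rpow, mul_one] at h
    exact (shiftCoeff_nonneg _).trans h
  -- N is the λ-th power of the coefficient bound. The condition λ > 1/(2r) says exactly that its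
  -- exponent 2rλ exceeds 1.
  let N : ℤ → ℝ := fun h => constK β θ τ r ^ lam * |(h : ℝ)| ^ (-(2 * r * lam))
  have hN : Summable N := (Real.summable_abs_int_rpow hα).mul_left _
  have hcN : ∀ h, shiftCoeff β θ τ h ^ lam ≤ N h := fun h => by
    rcases eq_or_ne h 0 with rfl | hh
    · rw [shiftCoeff_zero, Real.zero_rpow hlam0.ne']
      positivity
    · refine (Real.rpow_le_rpow (shiftCoeff_nonneg h)
        (shiftCoeff_le hτ hτβ hθ hθβ hr hr1 hr2 hh) hlam0.le).trans_eq ?_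
      rw [Real.mul_rpow hK (by positivity), ← Real.rpow_mul (abs_nonneg _), neg_mul]
  have hav := fun b : ZMod n =>
    sum_candidates_resSum_le hn (Real.rpow_nonneg hK lam) hα b
  have hM : ∑' h, N h =
      constK β θ τ r ^ lam * (2 * (riemannZeta ((2 * r * lam : ℝ) : ℂ)).re) := by
    rw [tsum_mul_left, tsum_abs_int_rpow hα]
  have key := sum_weightedMean_rpow_le hn hτ hτβ hθ hθβ hN hlam0 hlam1 hcN hav hγ hz s le_rfl
  have huniv : (Finset.univ.filter fun j : Fin s => j.val < s) = Finset.univ :=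
    Finset.filter_true_of_mem fun j _ => j.2
  rw [huniv, Finset.powerset_univ] at key
  rw [sum_erase_empty, Finset.mul_sum, sum_erase_empty]
  refine ⟨key.1, key.2.trans_eq (Finset.sum_congr rfl fun u _ => ?_)⟩
  split_ifs
  · rfl
  · rw [hM, mul_pow, ← Real.rpow_mul_natCast hK]
    ring

end

end LatticeQMC

namespace LatticeQMC
open Set Filter Topology

/-! ### Exchanging coordinates between two copies of `ℝ^s` -/

section
variable {s : ℕ}

/-- Exchange the coordinates in `w` between two points. -/
def exchange (w : Finset (Fin s)) (q : (Fin s → ℝ) × (Fin s → ℝ)) :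
    (Fin s → ℝ) × (Fin s → ℝ) :=
  (w.piecewise q.2 q.1, w.piecewise q.1 q.2)

lemma exchange_exchange (w : Finset (Fin s)) (q) : exchange w (exchange w q) = q := by
  ext j <;> by_cases h : j ∈ w <;> simp [exchange, h]

/-- Regarded as a family of pairs, one per coordinate, the two points are changed by a swap in the
coordinates of w and by the identity elsewhere; each preserves Lebesgue measure. -/
lemma measurePreserving_exchange (w : Finset (Fin s)) :
    MeasurePreserving (exchange w) ((volume : Measure (Fin s → ℝ)).prod volume)
      (volume.prod volume) := by
  have h1 := volume_measurePreserving_arrowProdEquivProdArrow ℝ ℝ (Fin s)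
  have h2 : MeasurePreserving (fun (a : Fin s → ℝ × ℝ) j => if j ∈ w then (a j).swap else a j) := by
    refine volume_preserving_pi (f := fun j x => if j ∈ w then Prod.swap x else x) fun j => ?_
    by_cases h : j ∈ w
    · simp only [h, if_true]
      exact Measure.measurePreserving_swap
    · simp only [h, if_false]
      exact MeasurePreserving.id _
  have h3 := h1.comp (h2.comp (h1.symm _))
  convert! h3 using 1
  funext q
  ext j <;> by_cases h : j ∈ w <;>
    simp [exchange, h, MeasurableEquiv.arrowProdEquivProdArrow, Equiv.arrowProdEquivProdArrow]

lemma measurableEmbedding_exchange (w : Finset (Fin s)) : MeasurableEmbedding (exchange w) :=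
  MeasurableEquiv.measurableEmbedding
    { toFun := exchange w
      invFun := exchange w
      left_inv := exchange_exchange w
      right_inv := exchange_exchange w
      measurable_toFun := (measurePreserving_exchange w).measurable
      measurable_invFun := (measurePreserving_exchange w).measurable }

lemma integrable_comp_exchange (w : Finset (Fin s)) {G : (Fin s → ℝ) × (Fin s → ℝ) → ℝ} :
    Integrable (fun q => G (exchange w q)) (volume.prod volume) ↔
      Integrable G (volume.prod volume) :=
  (measurePreserving_exchange w).integrable_comp_emb (measurableEmbedding_exchange w)

lemma integral_comp_exchange (w : Finset (Fin s)) (G : (Fin s → ℝ) × (Fin s → ℝ) → ℝ) :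
    ∫ q, G (exchange w q) ∂(volume.prod volume) = ∫ q, G q ∂(volume.prod volume) :=
  (measurePreserving_exchange w).integral_comp (measurableEmbedding_exchange w) G

lemma integrable_prod_coord {p : Fin s → ℝ → ℝ} (hp : ∀ j, Integrable (p j)) :
    Integrable fun y : Fin s → ℝ => ∏ j, p j (y j) :=
  Integrable.fintype_prod hp

lemma integrable_mul_prod_kernel {f : (Fin s → ℝ) → ℝ} {m : Fin s → ℝ → ℝ → ℝ}
    (hf : AEStronglyMeasurable f) (hm : ∀ j, Measurable (Function.uncurry (m j)))
    (hmi : ∀ j t, Integrable (m j t))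
    (hF : Integrable fun y => f y * ∏ j, ∫ b, |m j (y j) b|) :
    Integrable (fun q : (Fin s → ℝ) × (Fin s → ℝ) => f q.1 * ∏ j, m j (q.1 j) (q.2 j))
        (volume.prod volume) ∧
      ∫ q : (Fin s → ℝ) × (Fin s → ℝ), f q.1 * ∏ j, m j (q.1 j) (q.2 j) ∂(volume.prod volume) =
        ∫ y, f y * ∏ j, ∫ b, m j (y j) b := by
  have hmeas : Measurable fun q : (Fin s → ℝ) × (Fin s → ℝ) => ∏ j, m j (q.1 j) (q.2 j) := by
    refine Finset.measurable_prod _ fun j _ => ?_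
    have h : Measurable fun q : (Fin s → ℝ) × (Fin s → ℝ) => (q.1 j, q.2 j) := by fun_prop
    exact (hm j).comp h
  have hint : Integrable (fun q : (Fin s → ℝ) × (Fin s → ℝ) => f q.1 * ∏ j, m j (q.1 j) (q.2 j))
        (volume.prod volume) := by
    have hae : AEStronglyMeasurable (fun q : (Fin s → ℝ) × (Fin s → ℝ) =>
        f q.1 * ∏ j, m j (q.1 j) (q.2 j)) (volume.prod volume) :=
      hf.comp_fst.mul hmeas.aestronglyMeasurable
    rw [integrable_prod_iff hae]
    refine ⟨Eventually.of_forall fun y => ?_, ?_⟩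
    · exact (integrable_prod_coord fun j => hmi j (y j)).const_mul (f y)
    · refine hF.norm.congr (Eventually.of_forall fun y => ?_)
      simp only [norm_mul, Real.norm_eq_abs, Finset.abs_prod]
      rw [integral_const_mul]
      congr 1
      rw [integral_fintype_prod_volume_eq_prod (fun j b => |m j (y j) b|)]
      exact Finset.prod_congr rfl fun j _ => abs_of_nonneg (integral_nonneg fun b => abs_nonneg _)
  refine ⟨hint, ?_⟩
  rw [integral_prod _ hint]
  refine integral_congr_ae (Eventually.of_forall fun y => ?_)
  simp only
  rw [integral_const_mul, integral_fintype_prod_volume_eq_prod (fun j b => m j (y j) b)]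

/-- The operator replacing the coordinates in `w` by integration against a product kernel. -/
noncomputable def prodOp (w : Finset (Fin s)) (k : Fin s → ℝ → ℝ → ℝ) (f : (Fin s → ℝ) → ℝ)
    (y : Fin s → ℝ) : ℝ :=
  ∫ b, f (w.piecewise b y) * ∏ j, k j (y j) (b j)

/-- The `j`-th factor of the pairing of `prodOp w k f` with a tensor product, seen from `f`. -/
def pairFactor (w : Finset (Fin s)) (k : Fin s → ℝ → ℝ → ℝ) (p : Fin s → ℝ → ℝ) (j : Fin s)
    (t b : ℝ) : ℝ :=
  if j ∈ w then k j b t * p j b else k j t b * p j t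

lemma pairFactor_exchange (w : Finset (Fin s)) (k : Fin s → ℝ → ℝ → ℝ) (p : Fin s → ℝ → ℝ)
    (f : (Fin s → ℝ) → ℝ) (q : (Fin s → ℝ) × (Fin s → ℝ)) :
    f (exchange w q).1 * ∏ j, pairFactor w k p j ((exchange w q).1 j) ((exchange w q).2 j) =
      f (w.piecewise q.2 q.1) * (∏ j, k j (q.1 j) (q.2 j)) * ∏ j, p j (q.1 j) := by
  rw [mul_assoc, ← Finset.prod_mul_distrib]
  congr 1
  refine Finset.prod_congr rfl fun j _ => ?_
  by_cases h : j ∈ w <;> simp [exchange, pairFactor, h]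

lemma measurable_pairFactor {w : Finset (Fin s)} {k : Fin s → ℝ → ℝ → ℝ} {p : Fin s → ℝ → ℝ}
    (hk : ∀ j, Measurable (Function.uncurry (k j))) (hp : ∀ j, Measurable (p j)) (j : Fin s) :
    Measurable (Function.uncurry (pairFactor w k p j)) := by
  by_cases h : j ∈ w
  · have : Function.uncurry (pairFactor w k p j) =
        fun q => Function.uncurry (k j) q.swap * p j q.2 := by
      funext q; simp [pairFactor, h, Function.uncurry]
    rw [this]
    exact ((hk j).comp measurable_swap).mul ((hp j).comp measurable_snd)
  · have : Function.uncurry (pairFactor w k p j) =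
        fun q => Function.uncurry (k j) q * p j q.1 := by
      funext q; simp [pairFactor, h, Function.uncurry]
    rw [this]
    exact (hk j).mul ((hp j).comp measurable_fst)

/-- Pairing `prodOp w k f` with a tensor product. -/
lemma prodOp_pairing {w : Finset (Fin s)} {k : Fin s → ℝ → ℝ → ℝ} {p : Fin s → ℝ → ℝ}
    {f : (Fin s → ℝ) → ℝ} (hf : AEStronglyMeasurable f)
    (hk : ∀ j, Measurable (Function.uncurry (k j))) (hp : ∀ j, Measurable (p j))
    (hi : ∀ j t, Integrable (pairFactor w k p j t))
    (hF : Integrable fun y => f y * ∏ j, ∫ b, |pairFactor w k p j (y j) b|) :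
    Integrable (fun q : (Fin s → ℝ) × (Fin s → ℝ) =>
        f (w.piecewise q.2 q.1) * (∏ j, k j (q.1 j) (q.2 j)) * ∏ j, p j (q.1 j))
        (volume.prod volume) ∧
      Integrable (fun y => prodOp w k f y * ∏ j, p j (y j)) ∧
      ∫ y, prodOp w k f y * ∏ j, p j (y j) =
        ∫ y, f y * ∏ j, ∫ b, pairFactor w k p j (y j) b := by
  -- The exchange puts f back at an unmixed point at the price of transposing the kernels in w.
  -- Keeping two full copies of ℝ^s avoids products over subtypes; outside w the second copy is
  -- merely integrated out.
  obtain ⟨h1, h2⟩ := integrable_mul_prod_kernel hf (measurable_pairFactor hk hp) hi hF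
  rw [← integrable_comp_exchange w] at h1
  rw [← integral_comp_exchange w] at h2
  simp only [pairFactor_exchange] at h1 h2
  have e : ∀ y, ∫ b, f (w.piecewise b y) * (∏ j, k j (y j) (b j)) * ∏ j, p j (y j) =
      prodOp w k f y * ∏ j, p j (y j) := fun y => by rw [integral_mul_const]; rfl
  refine ⟨h1, ?_, ?_⟩
  · have := h1.integral_prod_left
    simp only [e] at this
    exact this
  · rw [← h2, integral_prod _ h1]
    simp only [e]

/-! ### Averaging operators -/

/-- Averaging over the coordinates in `w` with the density `χ`. -/
noncomputable def avgOp (χ : ℝ → ℝ) (w : Finset (Fin s)) : ((Fin s → ℝ) → ℝ) → (Fin s → ℝ) → ℝ :=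
  prodOp w fun _ _ b => χ b

lemma avgOp_congr {χ : ℝ → ℝ} {w : Finset (Fin s)} {f : (Fin s → ℝ) → ℝ} {y y' : Fin s → ℝ}
    (h : ∀ j ∉ w, y j = y' j) : avgOp χ w f y = avgOp χ w f y' := by
  have : ∀ b : Fin s → ℝ, w.piecewise b y = w.piecewise b y' := fun b => by
    funext j
    by_cases hj : j ∈ w <;> simp [hj, h]
  simp only [avgOp, prodOp, this]

/-- Transposing the average: in a coordinate of w the test factor integrates to a scalar and χ takes
its place next to f, while elsewhere χ has mass one. -/
lemma avgOp_pairing {χ : ℝ → ℝ} (hχm : Measurable χ) (hχ : Integrable χ)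
    (hχ1 : ∫ x, χ x = 1) {w : Finset (Fin s)} {p : Fin s → ℝ → ℝ}
    (hpm : ∀ j, Measurable (p j)) (hpi : ∀ j, Integrable (p j)) {f : (Fin s → ℝ) → ℝ}
    (hf : AEStronglyMeasurable f)
    (hF : Integrable fun y => f y * ∏ j, if j ∈ w then χ (y j) else p j (y j)) :
    Integrable (fun q : (Fin s → ℝ) × (Fin s → ℝ) =>
        f (w.piecewise q.2 q.1) * (∏ j, χ (q.2 j)) * ∏ j, p j (q.1 j))
        (volume.prod volume) ∧
      Integrable (fun y => avgOp χ w f y * ∏ j, p j (y j)) ∧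
      ∫ y, avgOp χ w f y * ∏ j, p j (y j) =
        (∫ y, f y * ∏ j, if j ∈ w then χ (y j) else p j (y j)) * ∏ j ∈ w, ∫ x, p j x := by
  have hval : ∀ (j : Fin s) t, ∫ b, pairFactor w (fun _ _ b => χ b) p j t b =
      (if j ∈ w then χ t else p j t) * (if j ∈ w then ∫ x, p j x else 1) := fun j t => by
    by_cases h : j ∈ w <;> simp [pairFactor, h, integral_const_mul, integral_mul_const, hχ1]
  have habs : ∀ (j : Fin s) t, ∫ b, |pairFactor w (fun _ _ b => χ b) p j t b| =
      |if j ∈ w then χ t else p j t| * (if j ∈ w then ∫ x, |p j x| else ∫ x, |χ x|) :=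
    fun j t => by
    by_cases h : j ∈ w <;>
      simp [pairFactor, h, integral_const_mul, integral_mul_const, abs_mul, mul_comm]
  have hi : ∀ j t, Integrable (pairFactor w (fun _ _ b => χ b) p j t) := fun j t => by
    unfold pairFactor
    by_cases h : j ∈ w
    · simp only [h, if_true]; exact (hpi j).const_mul (χ t)
    · simp only [h, if_false]; exact hχ.mul_const (p j t)
  have key := prodOp_pairing (w := w) (k := fun _ _ b => χ b) (p := p) hf
    (fun j => hχm.comp measurable_snd) hpm hi ?_
  · refine ⟨key.1, key.2.1, key.2.2.trans ?_⟩
    simp_rw [hval, Finset.prod_mul_distrib, ← mul_assoc]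
    rw [integral_mul_const, Finset.prod_ite_mem, Finset.univ_inter]
  · simp_rw [habs, Finset.prod_mul_distrib, ← mul_assoc]
    refine Integrable.mul_const ?_ _
    refine hF.mono (hf.mul ?_) (Eventually.of_forall fun y => ?_)
    · refine Measurable.aestronglyMeasurable (Finset.measurable_prod _ fun j _ => ?_)
      refine Measurable.abs ?_
      by_cases h : j ∈ w
      · simp only [h, if_true]; exact hχm.comp (measurable_pi_apply j)
      · simp only [h, if_false]; exact (hpm j).comp (measurable_pi_apply j)
    · simp only [norm_mul, Real.norm_eq_abs, Finset.abs_prod, abs_abs]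
      exact le_rfl

/-- A function of the coordinates outside `w`: the coordinates in `w` integrate out. -/
lemma integral_mul_prod_of_indep {χ : ℝ → ℝ} (hχm : Measurable χ) (hχ : Integrable χ)
    (hχ1 : ∫ x, χ x = 1) {w : Finset (Fin s)} {p : Fin s → ℝ → ℝ}
    (hpm : ∀ j, Measurable (p j)) (hpi : ∀ j, Integrable (p j)) {f : (Fin s → ℝ) → ℝ}
    (hf : AEStronglyMeasurable f) (hfw : ∀ y b, f (w.piecewise b y) = f y)
    (hF : Integrable fun y => f y * ∏ j, if j ∈ w then χ (y j) else p j (y j)) :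
    ∫ y, f y * ∏ j, p j (y j) =
        (∫ y, f y * ∏ j, if j ∈ w then χ (y j) else p j (y j)) * ∏ j ∈ w, ∫ x, p j x := by
  rw [← (avgOp_pairing hχm hχ hχ1 hpm hpi hf hF).2.2]
  have : ∀ y, avgOp χ w f y = f y := fun y => by
    simp only [avgOp, prodOp, hfw]
    rw [integral_const_mul, integral_fintype_prod_volume_eq_prod (fun _ b => χ b)]
    simp [hχ1]
  simp only [this]

end

end LatticeQMC

namespace LatticeQMC
open Set Filter Topology

/-! ### The kernel of the univariate representation formula -/

/-- The kernel in `f y - ∫ f φ = ∫ f' t * kern y t dt`. -/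
noncomputable def kern (β y t : ℝ) : ℝ := distFun β t - if y ≤ t then 1 else 0

section
variable {β : ℝ}

lemma measurable_kern (hβ : 0 < β) : Measurable (Function.uncurry (kern β)) := by
  unfold kern Function.uncurry
  refine ((continuous_distFun hβ).measurable.comp measurable_snd).sub ?_
  exact Measurable.ite (measurableSet_le measurable_fst measurable_snd) measurable_const
    measurable_const

lemma abs_kern_le_one (hβ : 0 < β) (y t : ℝ) : |kern β y t| ≤ 1 := by
  have h0 := distFun_pos hβ t
  have h1 := distFun_lt_one hβ t
  unfold kern
  rw [abs_le]
  split_ifs <;> constructor <;> linarith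

/-- Measurable functions bounded by a multiple of the density. -/
def Dominated (β : ℝ) (p : ℝ → ℝ) : Prop :=
  Measurable p ∧ ∃ C, 0 ≤ C ∧ ∀ y, |p y| ≤ C * density β y

lemma Dominated.integrable (hβ : 0 < β) {p : ℝ → ℝ} (hp : Dominated β p) : Integrable p := by
  obtain ⟨hm, C, _, hC⟩ := hp
  exact ((integrable_density hβ).const_mul C).mono' hm.aestronglyMeasurable
    (Eventually.of_forall hC)

lemma dominated_density (hβ : 0 < β) : Dominated β (density β) :=
  ⟨(continuous_density hβ).measurable, 1, zero_le_one, fun y => by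
    rw [abs_of_pos (density_pos hβ y), one_mul]⟩

lemma dominated_of_hasCompactSupport (hβ : 0 < β) {p : ℝ → ℝ} (hc : Continuous p)
    (hp : HasCompactSupport p) : Dominated β p := by
  have h1 : Continuous fun y => p y / density β y :=
    hc.div (continuous_density hβ) fun y => (density_pos hβ y).ne'
  have h2 : HasCompactSupport fun y => p y / density β y :=
    hp.mono fun y hy hy' => hy (by simp [hy'])
  obtain ⟨C, hC⟩ := h1.bounded_above_of_compact_support h2
  refine ⟨hc.measurable, C, (norm_nonneg _).trans (hC 0), fun y => ?_⟩
  have := hC y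
  rwa [norm_div, Real.norm_eq_abs, Real.norm_eq_abs, abs_of_pos (density_pos hβ y),
    div_le_iff₀ (density_pos hβ y)] at this

/-- The transposed kernel operator. -/
noncomputable def kernInt (β : ℝ) (p : ℝ → ℝ) (t : ℝ) : ℝ := ∫ y, kern β y t * p y

lemma measurable_kern_left (hβ : 0 < β) (t : ℝ) : Measurable fun y => kern β y t :=
  (measurable_kern hβ).comp (measurable_id.prodMk measurable_const)

lemma integrable_kern_mul (hβ : 0 < β) {p : ℝ → ℝ} (hp : Integrable p) (t : ℝ) :
    Integrable fun y => kern β y t * p y :=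
  hp.bdd_mul (measurable_kern_left hβ t).aestronglyMeasurable
    (Eventually.of_forall fun y => abs_kern_le_one hβ y t)

lemma kernInt_eq {p : ℝ → ℝ} (hp : Integrable p) (t : ℝ) :
    kernInt β p t = distFun β t * (∫ y, p y) - ∫ y in Iic t, p y := by
  have h : ∀ y, kern β y t * p y = distFun β t * p y - (Iic t).indicator p y := fun y => by
    unfold kern indicator
    by_cases h : y ≤ t <;> simp [h, sub_mul]
  simp only [kernInt, h]
  rw [integral_sub (hp.const_mul _) (hp.indicator measurableSet_Iic), integral_const_mul,
    integral_indicator measurableSet_Iic]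

/-- The kernel has mean zero in its first variable. Through the pairing formula, averaging over a
coordinate in w therefore kills `liftOp`. -/
lemma kernInt_density (hβ : 0 < β) (t : ℝ) : kernInt β (density β) t = 0 := by
  rw [kernInt_eq (integrable_density hβ), integral_density hβ, mul_one, distFun, sub_self]

lemma integral_deriv_eq_zero {v : ℝ → ℝ} (hv : ContDiff ℝ 1 v) (hs : HasCompactSupport v) :
    ∫ x, deriv v x = 0 :=
  integral_eq_zero_of_hasDerivAt_of_integrable
    (fun x => (hv.differentiable one_ne_zero x).hasDerivAt)
    ((hv.continuous_deriv le_rfl).integrable_of_hasCompactSupport hs.deriv)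
    (hv.continuous.integrable_of_hasCompactSupport hs)

/-- Transposed form of the statement that differentiating `liftOp` in a coordinate of w undoes the
integration there. -/
lemma kernInt_deriv {v : ℝ → ℝ} (hv : ContDiff ℝ 1 v) (hs : HasCompactSupport v) (t : ℝ) :
    kernInt β (deriv v) t = -v t := by
  have hi : Integrable (deriv v) :=
    (hv.continuous_deriv le_rfl).integrable_of_hasCompactSupport hs.deriv
  rw [kernInt_eq hi, hs.integral_Iic_deriv_eq hv, integral_deriv_eq_zero hv hs]
  ring

/-- Against the density itself, |kern| integrates to exactly 2Φ(1 - Φ). This is the origin of the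
weight in `Liftable`. -/
lemma integral_abs_kern_mul_le (hβ : 0 < β) {p : ℝ → ℝ} {C : ℝ} (hp : Integrable p)
    (hC : ∀ y, |p y| ≤ C * density β y) (t : ℝ) :
    ∫ y, |kern β y t * p y| ≤ 2 * C * (distFun β t * (1 - distFun β t)) := by
  have h0 := distFun_pos hβ t
  have h1 := distFun_lt_one hβ t
  have hφ := integrable_density hβ
  have h : ∀ y, |kern β y t| * density β y =
      distFun β t * density β y + (1 - 2 * distFun β t) * (Iic t).indicator (density β) y := by
    intro y
    unfold kern indicator
    by_cases h : y ≤ t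
    · simp only [h, if_true, mem_Iic]
      rw [abs_of_neg (by linarith)]; ring
    · simp only [h, if_false, mem_Iic]
      rw [sub_zero, abs_of_pos h0]; ring
  have hint : Integrable fun y => |kern β y t| * density β y := by
    simp only [h]
    exact (hφ.const_mul _).add ((hφ.indicator measurableSet_Iic).const_mul _)
  calc _ ≤ ∫ y, C * (|kern β y t| * density β y) := by
        refine integral_mono (integrable_kern_mul hβ hp t).abs (hint.const_mul C) fun y => ?_
        simp only [abs_mul]
        rw [mul_left_comm]
        exact mul_le_mul_of_nonneg_left (hC y) (abs_nonneg _)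
    _ = C * (distFun β t + (1 - 2 * distFun β t) * distFun β t) := by
        rw [integral_const_mul]
        simp only [h]
        rw [integral_add (hφ.const_mul _) ((hφ.indicator measurableSet_Iic).const_mul _),
          integral_const_mul, integral_const_mul, integral_density hβ,
          integral_indicator measurableSet_Iic]
        simp only [distFun, mul_one]
    _ = _ := by ring

end

/-! ### The multivariate representation operators -/

section
variable {β : ℝ} {s : ℕ}

/-- The `j`-th factor of the kernel of `liftOp`. -/
noncomputable def liftKernel (β : ℝ) (w : Finset (Fin s)) (j : Fin s) (y b : ℝ) : ℝ :=
  if j ∈ w then kern β y b else density β b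

/-- The operator integrating against the kernel `kern` in the coordinates in `w`. -/
noncomputable def liftOp (β : ℝ) (w : Finset (Fin s)) (f : (Fin s → ℝ) → ℝ) :
    (Fin s → ℝ) → ℝ :=
  prodOp w (liftKernel β w) f

/-- Functions to which `liftOp β w` can be applied. -/
def Liftable (β : ℝ) (w : Finset (Fin s)) (f : (Fin s → ℝ) → ℝ) : Prop :=
  AEStronglyMeasurable f ∧
    Integrable fun y => f y *
      ∏ j, if j ∈ w then distFun β (y j) * (1 - distFun β (y j)) else density β (y j)

lemma measurable_liftKernel (hβ : 0 < β) (w : Finset (Fin s)) (j : Fin s) :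
    Measurable (Function.uncurry (liftKernel β w j)) := by
  unfold liftKernel
  by_cases h : j ∈ w
  · simp only [h, if_true]; exact measurable_kern hβ
  · simp only [h, if_false]; exact (continuous_density hβ).measurable.comp measurable_snd

lemma measurable_integral_abs {m : ℝ → ℝ → ℝ} (hm : Measurable (Function.uncurry m)) :
    Measurable fun t => ∫ b, |m t b| :=
  (hm.abs.stronglyMeasurable.integral_prod_right (ν := volume)
    (f := fun t b => |m t b|)).measurable

/-- The general transposition formula: the kernels in w move to the test factors as `kernInt`, and
the density outside w integrates out to 1. Domination of the factors by the density is what lets the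
`Liftable` weight serve as a majorant. -/
lemma liftOp_pairing (hβ : 0 < β) {w : Finset (Fin s)} {p : Fin s → ℝ → ℝ}
    (hp : ∀ j, Dominated β (p j)) {f : (Fin s → ℝ) → ℝ} (hf : Liftable β w f) :
    Integrable (fun q : (Fin s → ℝ) × (Fin s → ℝ) =>
        f (w.piecewise q.2 q.1) * (∏ j, liftKernel β w j (q.1 j) (q.2 j)) * ∏ j, p j (q.1 j))
        (volume.prod volume) ∧
      Integrable (fun y => liftOp β w f y * ∏ j, p j (y j)) ∧
      ∫ y, liftOp β w f y * ∏ j, p j (y j) =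
        ∫ y, f y * ∏ j, if j ∈ w then kernInt β (p j) (y j) else p j (y j) := by
  have hval : ∀ (j : Fin s) t, ∫ b, pairFactor w (liftKernel β w) p j t b =
      if j ∈ w then kernInt β (p j) t else p j t := fun j t => by
    by_cases h : j ∈ w
    · simp [pairFactor, liftKernel, h, kernInt]
    · simp [pairFactor, liftKernel, h, integral_mul_const, integral_density hβ]
  have hi : ∀ j t, Integrable (pairFactor w (liftKernel β w) p j t) := fun j t => by
    unfold pairFactor liftKernel
    by_cases h : j ∈ w
    · simp only [h, if_true]; exact integrable_kern_mul hβ ((hp j).integrable hβ) t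
    · simp only [h, if_false]; exact (integrable_density hβ).mul_const _
  have hle : ∀ j, ∃ C, 0 ≤ C ∧ ∀ t, ∫ b, |pairFactor w (liftKernel β w) p j t b| ≤
      C * if j ∈ w then distFun β t * (1 - distFun β t) else density β t := fun j => by
    obtain ⟨C, hC0, hC⟩ := (hp j).2
    refine ⟨2 * C, by positivity, fun t => ?_⟩
    by_cases h : j ∈ w
    · simp only [pairFactor, liftKernel, h, if_true]
      exact integral_abs_kern_mul_le hβ ((hp j).integrable hβ) hC t
    · simp only [pairFactor, liftKernel, h, if_false, abs_mul, integral_mul_const,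
        abs_of_pos (density_pos hβ _), integral_density hβ, one_mul]
      have := hC t
      have := density_pos hβ t
      nlinarith
  choose C hC0 hC using hle
  have hpm := measurable_pairFactor (w := w) (measurable_liftKernel hβ w) (fun j => (hp j).1)
  have key := prodOp_pairing (w := w) (k := liftKernel β w) (p := p) hf.1
    (measurable_liftKernel hβ w) (fun j => (hp j).1) hi ?_
  · simp_rw [hval] at key
    exact key
  · refine (hf.2.const_mul (∏ j, C j)).mono (hf.1.mul ?_) (Eventually.of_forall fun y => ?_)
    · exact (Finset.measurable_prod _ fun j _ =>
        (measurable_integral_abs (hpm j)).comp (measurable_pi_apply j)).aestronglyMeasurable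
    · rw [mul_left_comm, norm_mul, norm_mul, ← Finset.prod_mul_distrib]
      refine mul_le_mul_of_nonneg_left ?_ (norm_nonneg _)
      rw [Real.norm_eq_abs, Real.norm_eq_abs, Finset.abs_prod, Finset.abs_prod]
      refine Finset.prod_le_prod (fun j _ => abs_nonneg _) fun j _ => ?_
      rw [abs_of_nonneg (integral_nonneg fun b => abs_nonneg _)]
      exact (hC j _).trans (le_abs_self _)

end

/-! ### Tensor products of test functions -/

/-- Univariate test functions. -/
def IsTest (v : ℝ → ℝ) : Prop := ContDiff ℝ ((⊤ : ℕ∞) : WithTop ℕ∞) v ∧ HasCompactSupport v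

section
variable {β : ℝ} {s : ℕ}

lemma IsTest.deriv {v : ℝ → ℝ} (hv : IsTest v) : IsTest (deriv v) :=
  ⟨(contDiff_infty_iff_deriv.1 hv.1).2, hv.2.deriv⟩

lemma IsTest.dominated (hβ : 0 < β) {v : ℝ → ℝ} (hv : IsTest v) : Dominated β v :=
  dominated_of_hasCompactSupport hβ hv.1.continuous hv.2

lemma contDiff_prod_coord {v : Fin s → ℝ → ℝ} (hv : ∀ j, IsTest (v j)) :
    ContDiff ℝ ((⊤ : ℕ∞) : WithTop ℕ∞) fun y : Fin s → ℝ => ∏ j, v j (y j) :=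
  contDiff_prod fun j _ => (hv j).1.comp (contDiff_apply ℝ ℝ j)

lemma hasCompactSupport_prod_coord {v : Fin s → ℝ → ℝ} (hv : ∀ j, HasCompactSupport (v j)) :
    HasCompactSupport fun y : Fin s → ℝ => ∏ j, v j (y j) := by
  refine HasCompactSupport.intro (isCompact_univ_pi fun j => (hv j)) fun y hy => ?_
  simp only [Set.mem_pi, mem_univ, true_implies, not_forall] at hy
  obtain ⟨j, hj⟩ := hy
  exact Finset.prod_eq_zero (Finset.mem_univ j) (image_eq_zero_of_notMem_tsupport hj)

lemma partialDeriv_prod_coord {v : Fin s → ℝ → ℝ} (hv : ∀ j, Differentiable ℝ (v j)) (i : Fin s) :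
    partialDeriv i (fun y : Fin s → ℝ => ∏ j, v j (y j)) =
      fun y => ∏ j, Function.update v i (deriv (v i)) j (y j) := by
  funext y
  have h : HasFDerivAt (fun y : Fin s → ℝ => ∏ j, v j (y j))
      (∑ j, (∏ k ∈ Finset.univ.erase j, v k (y k)) •
        (deriv (v j) (y j) • ContinuousLinearMap.proj (R := ℝ) (φ := fun _ : Fin s => ℝ) j)) y := by
    refine HasFDerivAt.finsetProd fun j _ => ?_
    exact ((hv j (y j)).hasDerivAt).comp_hasFDerivAt y (hasFDerivAt_apply j y)
  rw [partialDeriv, h.fderiv, _root_.sum_apply, Finset.sum_eq_single i]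
  · rw [← Finset.mul_prod_erase _ _ (Finset.mem_univ i), Function.update_self]
    simp only [_root_.smul_apply, ContinuousLinearMap.proj_apply, Pi.single_eq_same,
      smul_eq_mul, mul_one]
    rw [mul_comm]
    congr 1
    refine Finset.prod_congr rfl fun k hk => ?_
    rw [Function.update_of_ne (Finset.ne_of_mem_erase hk)]
  · intro j _ hj
    simp [Pi.single_eq_of_ne hj]
  · simp

lemma mixedPartial_prod_coord {v : Fin s → ℝ → ℝ} (hv : ∀ j, IsTest (v j)) (u : Finset (Fin s)) :
    mixedPartial u (fun y : Fin s → ℝ => ∏ j, v j (y j)) =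
      fun y => ∏ j, (if j ∈ u then deriv (v j) else v j) (y j) := by
  have key : ∀ l : List (Fin s), l.Nodup →
      l.foldr partialDeriv (fun y : Fin s → ℝ => ∏ j, v j (y j)) =
        fun y => ∏ j, (if j ∈ l then deriv (v j) else v j) (y j) := by
    intro l
    induction l with
    | nil => intro _; simp
    | cons i l ih =>
      intro hl
      rw [List.nodup_cons] at hl
      rw [List.foldr_cons, ih hl.2, partialDeriv_prod_coord]
      · funext y
        refine Finset.prod_congr rfl fun j _ => ?_
        by_cases hj : j = i
        · subst hj; simp [hl.1]
        · simp [hj]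
      · intro j
        split_ifs
        · exact (hv j).deriv.1.differentiable (by simp)
        · exact (hv j).1.differentiable (by simp)
  rw [mixedPartial, key _ (Finset.sort_nodup _ _)]
  simp

lemma IsWeakMixedDeriv.integral_prod_coord {u : Finset (Fin s)} {F g : (Fin s → ℝ) → ℝ}
    (h : IsWeakMixedDeriv u F g) {v : Fin s → ℝ → ℝ} (hv : ∀ j, IsTest (v j)) :
    ∫ y, F y * ∏ j, (if j ∈ u then deriv (v j) else v j) (y j) =
      (-1) ^ u.card * ∫ y, g y * ∏ j, v j (y j) := by
  have := h.2 _ (contDiff_prod_coord hv) (hasCompactSupport_prod_coord fun j => (hv j).2)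
  rwa [mixedPartial_prod_coord hv] at this

lemma weakMixedDeriv_spec {u : Finset (Fin s)} {F : (Fin s → ℝ) → ℝ}
    (h : ∃ g, IsWeakMixedDeriv u F g) : IsWeakMixedDeriv u F (weakMixedDeriv u F) := by
  rw [weakMixedDeriv, dif_pos h]
  exact Classical.choose_spec h

/-- Weak differentiation of a mixed derivative in one more coordinate. -/
lemma IsWeakMixedDeriv.integral_update {u : Finset (Fin s)} {i : Fin s} (hi : i ∉ u)
    {F g g' : (Fin s → ℝ) → ℝ} (h : IsWeakMixedDeriv u F g)
    (h' : IsWeakMixedDeriv (insert i u) F g') {v : Fin s → ℝ → ℝ} (hv : ∀ j, IsTest (v j)) :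
    ∫ y, g y * ∏ j, Function.update v i (deriv (v i)) j (y j) =
      -∫ y, g' y * ∏ j, v j (y j) := by
  have hv' : ∀ j, IsTest (Function.update v i (deriv (v i)) j) := fun j => by
    by_cases hj : j = i
    · subst hj; simpa using (hv j).deriv
    · simpa [hj] using hv j
  have h1 := h.integral_prod_coord hv'
  have h2 := h'.integral_prod_coord hv
  have e : ∀ y : Fin s → ℝ, ∏ j, (if j ∈ u then deriv (Function.update v i (deriv (v i)) j)
      else Function.update v i (deriv (v i)) j) (y j) =
      ∏ j, (if j ∈ insert i u then deriv (v j) else v j) (y j) := fun y => by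
    refine Finset.prod_congr rfl fun j _ => ?_
    by_cases hj : j = i
    · subst hj; simp [hi]
    · simp [hj]
  simp only [e] at h1
  rw [h1, Finset.card_insert_of_notMem hi, pow_succ] at h2
  have h3 : ((-1 : ℝ) ^ u.card) ≠ 0 := by positivity
  apply mul_left_cancel₀ h3
  rw [h2]; ring

end

end LatticeQMC

namespace LatticeQMC
open Set Filter Topology

/-! ### Vanishing of locally integrable functions tested against tensor products -/

section
variable {s : ℕ}

/-- Smooth functions increasing to the indicator function of an open interval. -/
noncomputable def intervalBump (a b : ℝ) (m : ℕ) (x : ℝ) : ℝ :=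
  Real.smoothTransition (m * (x - a)) * Real.smoothTransition (m * (b - x))

lemma intervalBump_eq_zero {a b : ℝ} (m : ℕ) {x : ℝ} (hx : x ∉ Ioo a b) :
    intervalBump a b m x = 0 := by
  have hm : (0 : ℝ) ≤ m := m.cast_nonneg
  rw [mem_Ioo, not_and_or, not_lt, not_lt] at hx
  rcases hx with hx | hx
  · rw [intervalBump, Real.smoothTransition.zero_of_nonpos
      (mul_nonpos_of_nonneg_of_nonpos hm (by linarith)), zero_mul]
  · rw [intervalBump, Real.smoothTransition.zero_of_nonpos (x := m * (b - x))
      (mul_nonpos_of_nonneg_of_nonpos hm (by linarith)), mul_zero]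

lemma intervalBump_nonneg (a b : ℝ) (m : ℕ) (x : ℝ) : 0 ≤ intervalBump a b m x :=
  mul_nonneg (Real.smoothTransition.nonneg _) (Real.smoothTransition.nonneg _)

lemma intervalBump_le_one (a b : ℝ) (m : ℕ) (x : ℝ) : intervalBump a b m x ≤ 1 :=
  mul_le_one₀ (Real.smoothTransition.le_one _) (Real.smoothTransition.nonneg _)
    (Real.smoothTransition.le_one _)

lemma isTest_intervalBump (a b : ℝ) (m : ℕ) : IsTest (intervalBump a b m) := by
  constructor
  · unfold intervalBump
    refine ContDiff.mul ?_ ?_ <;> refine Real.smoothTransition.contDiff.comp ?_ <;> fun_prop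
  · exact HasCompactSupport.intro isCompact_Icc fun x hx =>
      intervalBump_eq_zero m fun h => hx (Ioo_subset_Icc_self h)

lemma tendsto_intervalBump (a b x : ℝ) :
    Tendsto (fun m => intervalBump a b m x) atTop (𝓝 ((Ioo a b).indicator 1 x)) := by
  by_cases hx : x ∈ Ioo a b
  · rw [indicator_of_mem hx, Pi.one_apply]
    refine tendsto_const_nhds.congr' ?_
    have h : ∀ c : ℝ, 0 < c → ∀ᶠ m : ℕ in atTop, 1 ≤ m * c := fun c hc =>
      (tendsto_natCast_atTop_atTop.atTop_mul_const hc).eventually_ge_atTop 1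
    filter_upwards [h (x - a) (by linarith [hx.1]), h (b - x) (by linarith [hx.2])] with m h1 h2
    rw [intervalBump, Real.smoothTransition.one_of_one_le h1,
      Real.smoothTransition.one_of_one_le h2, one_mul]
  · rw [indicator_of_notMem hx]
    exact tendsto_const_nhds.congr fun m => (intervalBump_eq_zero m hx).symm

lemma prod_indicator_one (S : Fin s → Set ℝ) (y : Fin s → ℝ) :
    ∏ j, (S j).indicator (1 : ℝ → ℝ) (y j) = (univ.pi S).indicator 1 y := by
  by_cases h : y ∈ univ.pi S
  · rw [indicator_of_mem h]
    exact Finset.prod_eq_one fun j _ => indicator_of_mem (h j (mem_univ j)) _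
  · rw [indicator_of_notMem h]
    simp only [Set.mem_pi, mem_univ, true_implies, not_forall] at h
    obtain ⟨j, hj⟩ := h
    exact Finset.prod_eq_zero (Finset.mem_univ j) (indicator_of_notMem hj _)

/-- Products of interval bumps converge to the indicator of the box, and dominated convergence
applies since D is integrable on its closure. -/
lemma setIntegral_box_eq_zero {D : (Fin s → ℝ) → ℝ} (hD : LocallyIntegrable D)
    (h : ∀ v : Fin s → ℝ → ℝ, (∀ j, IsTest (v j)) → ∫ y, D y * ∏ j, v j (y j) = 0)
    (a b : Fin s → ℝ) : ∫ y in univ.pi fun j => Ioo (a j) (b j), D y = 0 := by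
  have hK : IntegrableOn D (univ.pi fun j => Ioo (a j) (b j)) :=
    (hD.integrableOn_isCompact (isCompact_univ_pi fun j => isCompact_Icc)).mono_set
      (pi_mono fun j _ => Ioo_subset_Icc_self)
  have hm : MeasurableSet (univ.pi fun j => Ioo (a j) (b j)) :=
    MeasurableSet.univ_pi fun j => measurableSet_Ioo
  have hlim : Tendsto (fun m : ℕ => ∫ y, D y * ∏ j, intervalBump (a j) (b j) m (y j)) atTop
      (𝓝 (∫ y, D y * ∏ j, (Ioo (a j) (b j)).indicator 1 (y j))) := by
    refine tendsto_integral_of_dominated_convergence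
      ((univ.pi fun j => Ioo (a j) (b j)).indicator fun y => ‖D y‖) (fun m => ?_)
      ((integrable_indicator_iff hm).2 hK.norm) (fun m => ?_) ?_
    · exact hD.aestronglyMeasurable.mul (contDiff_prod_coord fun j =>
        isTest_intervalBump (a j) (b j) m).continuous.aestronglyMeasurable
    · refine Eventually.of_forall fun y => ?_
      by_cases hy : y ∈ univ.pi fun j => Ioo (a j) (b j)
      · rw [indicator_of_mem hy, norm_mul]
        refine mul_le_of_le_one_right (norm_nonneg _) ?_
        rw [Real.norm_eq_abs, Finset.abs_prod]
        refine Finset.prod_le_one (fun j _ => abs_nonneg _) fun j _ => ?_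
        rw [abs_of_nonneg (intervalBump_nonneg _ _ _ _)]
        exact intervalBump_le_one _ _ _ _
      · rw [indicator_of_notMem hy]
        simp only [Set.mem_pi, mem_univ, true_implies, not_forall] at hy
        obtain ⟨j, hj⟩ := hy
        rw [Finset.prod_eq_zero (Finset.mem_univ j) (intervalBump_eq_zero m hj)]
        simp
    · exact Eventually.of_forall fun y => (tendsto_finsetProd _ fun j _ =>
        tendsto_intervalBump _ _ _).const_mul _
  have h0 : ∀ m : ℕ, ∫ y, D y * ∏ j, intervalBump (a j) (b j) m (y j) = 0 := fun m =>
    h _ fun j => isTest_intervalBump (a j) (b j) m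
  simp only [h0] at hlim
  have := tendsto_nhds_unique hlim tendsto_const_nhds
  rw [← integral_indicator hm, ← this]
  refine integral_congr_ae (Eventually.of_forall fun y => ?_)
  have e := prod_indicator_one (fun j => Ioo (a j) (b j)) y
  beta_reduce at e ⊢
  rw [e]
  by_cases hy : y ∈ univ.pi fun j => Ioo (a j) (b j)
  · rw [indicator_of_mem hy, indicator_of_mem hy, Pi.one_apply, mul_one]
  · rw [indicator_of_notMem hy, indicator_of_notMem hy, mul_zero]

lemma measurableSpace_pi_eq_generateFrom :
    (MeasurableSpace.pi : MeasurableSpace (Fin s → ℝ)) = MeasurableSpace.generateFrom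
      (Set.pi univ '' Set.pi univ fun _ : Fin s => ⋃ (a : ℚ) (b : ℚ) (_ : a < b),
        {Ioo (a : ℝ) (b : ℝ)}) := by
  refine (generateFrom_eq_pi (fun _ => ?_) fun _ => ?_).symm
  · exact Real.borel_eq_generateFrom_Ioo_rat.symm.trans BorelSpace.measurable_eq.symm
  · exact (Real.finiteSpanningSetsInIooRat volume).isCountablySpanning

/-- Rational boxes form a π-system generating the Borel sets, so vanishing on boxes extends to all
measurable sets. Cutting D off to a cube makes it integrable, as the complement and union steps
require. -/
theorem ae_eq_zero_of_integral_prod_coord {D : (Fin s → ℝ) → ℝ} (hD : LocallyIntegrable D)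
    (h : ∀ v : Fin s → ℝ → ℝ, (∀ j, IsTest (v j)) → ∫ y, D y * ∏ j, v j (y j) = 0) :
    D =ᵐ[volume] 0 := by
  have key : ∀ R : ℕ, (univ.pi fun _ => Ioo (-R : ℝ) R).indicator D =ᵐ[volume] 0 := by
    intro R
    have hBm : MeasurableSet (univ.pi fun _ : Fin s => Ioo (-R : ℝ) R) :=
      MeasurableSet.univ_pi fun j => measurableSet_Ioo
    have hK : IntegrableOn D (univ.pi fun _ : Fin s => Ioo (-R : ℝ) R) :=
      (hD.integrableOn_isCompact (isCompact_univ_pi fun j => isCompact_Icc)).mono_set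
        (pi_mono fun j _ => Ioo_subset_Icc_self)
    have hI := (integrable_indicator_iff hBm).2 hK
    refine hI.ae_eq_zero_of_forall_setIntegral_eq_zero fun S hS _ => ?_
    have h0 : ∫ y, (univ.pi fun _ => Ioo (-R : ℝ) R).indicator D y = 0 := by
      rw [integral_indicator hBm]; exact setIntegral_box_eq_zero hD h _ _
    refine MeasurableSpace.induction_on_inter (C := fun S _ => ∫ y in S,
      (univ.pi fun _ => Ioo (-R : ℝ) R).indicator D y = 0)
      measurableSpace_pi_eq_generateFrom (IsPiSystem.pi fun _ => Real.isPiSystem_Ioo_rat)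
      ?_ ?_ ?_ ?_ S hS
    · simp
    · rintro _ ⟨T, hT, rfl⟩
      have hT' : ∀ j, ∃ a b : ℝ, T j = Ioo a b := fun j => by
        have := hT j (mem_univ j)
        simp only [mem_iUnion, mem_singleton_iff] at this
        obtain ⟨a, b, _, h⟩ := this
        exact ⟨a, b, h⟩
      choose a b hab using hT'
      rw [setIntegral_indicator hBm, ← Set.pi_inter_distrib]
      simp only [hab, Ioo_inter_Ioo]
      exact setIntegral_box_eq_zero hD h _ _
    · intro S hS hS0
      have := integral_add_compl hS hI
      rw [hS0, h0, zero_add] at this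
      exact this
    · intro f hdis hf hf0
      rw [integral_iUnion hf hdis hI.integrableOn]
      simp [hf0]
  have := ae_all_iff.2 key
  filter_upwards [this] with y hy
  obtain ⟨R, hR⟩ := exists_nat_gt ‖y‖
  have hyR : y ∈ univ.pi fun _ : Fin s => Ioo (-R : ℝ) R := fun j _ => by
    have := (norm_le_pi_norm y j).trans_lt hR
    rw [Real.norm_eq_abs, abs_lt] at this
    exact this
  have := hy R
  rwa [indicator_of_mem hyR] at this

lemma integrable_mul_prod_test {D : (Fin s → ℝ) → ℝ} (hD : LocallyIntegrable D)
    {v : Fin s → ℝ → ℝ} (hv : ∀ j, IsTest (v j)) :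
    Integrable fun y => D y * ∏ j, v j (y j) := by
  have := hD.integrable_smul_left_of_hasCompactSupport (contDiff_prod_coord hv).continuous
    (hasCompactSupport_prod_coord fun j => (hv j).2)
  simpa [mul_comm] using this

/-- Near a given point the test product can be taken identically 1. -/
lemma locallyIntegrable_of_integrable_mul_prod_test {f : (Fin s → ℝ) → ℝ}
    (h : ∀ v : Fin s → ℝ → ℝ, (∀ j, IsTest (v j)) → Integrable fun y => f y * ∏ j, v j (y j)) :
    LocallyIntegrable f := by
  intro x
  let B : ∀ j : Fin s, ContDiffBump (x j) := fun j => ⟨1, 2, one_pos, one_lt_two⟩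
  have hB := h (fun j => B j) fun j => ⟨(B j).contDiff, (B j).hasCompactSupport⟩
  refine ⟨Metric.ball x 1, Metric.ball_mem_nhds x one_pos, ?_⟩
  refine (hB.integrableOn (s := Metric.ball x 1)).congr_fun (fun y hy => ?_)
    Metric.isOpen_ball.measurableSet
  have : ∏ j, (B j) (y j) = 1 := Finset.prod_eq_one fun j _ => by
    refine (B j).one_of_mem_closedBall ?_
    rw [Metric.mem_closedBall]
    exact (dist_le_pi_dist y x j).trans hy.le
  simp only [this, mul_one]

lemma exists_isTest_integral_eq_one : ∃ χ : ℝ → ℝ, IsTest χ ∧ ∫ x, χ x = 1 := by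
  let B : ContDiffBump (0 : ℝ) := ⟨1, 2, one_pos, one_lt_two⟩
  exact ⟨B.normed volume, ⟨B.contDiff_normed, B.hasCompactSupport_normed⟩, B.integral_normed⟩

lemma IsTest.integrable {v : ℝ → ℝ} (hv : IsTest v) : Integrable v :=
  hv.1.continuous.integrable_of_hasCompactSupport hv.2

lemma IsTest.sub_const_mul {v χ : ℝ → ℝ} (hv : IsTest v) (hχ : IsTest χ) (c : ℝ) :
    IsTest fun x => v x - c * χ x :=
  ⟨hv.1.sub (contDiff_const.mul hχ.1), by
    have := hv.2.add (hχ.2.mul_left (f := fun _ => -c))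
    refine this.mono' (subset_tsupport _ |>.trans' fun x hx => ?_)
    simpa [sub_eq_add_neg] using hx⟩

/-- The primitive started to the left of the support is constant to the right of it, and that
constant is the total mass 0. -/
lemma IsTest.exists_deriv_eq {v : ℝ → ℝ} (hv : IsTest v) (h0 : ∫ x, v x = 0) :
    ∃ p, IsTest p ∧ _root_.deriv p = v := by
  obtain ⟨R, hR0, hR⟩ := hv.2.isCompact.isBounded.subset_ball_lt 0 0
  have hz : ∀ t, R ≤ |t| → v t = 0 := fun t ht => by
    refine image_eq_zero_of_notMem_tsupport fun h => ?_
    have := hR h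
    rw [Metric.mem_ball, dist_zero_right, Real.norm_eq_abs] at this
    linarith
  have hd : _root_.deriv (fun x => ∫ t in (-R)..x, v t) = v := by
    funext x
    exact hv.1.continuous.deriv_integral v (-R) x
  refine ⟨fun x => ∫ t in (-R)..x, v t, ⟨?_, ?_⟩, hd⟩
  · rw [contDiff_infty_iff_deriv, hd]
    exact ⟨fun x => (hv.1.continuous.integral_hasStrictDerivAt (-R) x).hasDerivAt.differentiableAt,
      hv.1⟩
  · refine HasCompactSupport.intro (isCompact_Icc (a := -R) (b := R)) fun x hx => ?_
    rw [mem_Icc, not_and_or, not_le, not_le] at hx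
    rcases hx with hx | hx
    · rw [intervalIntegral.integral_congr (g := fun _ => 0)]
      · simp
      · intro t ht
        rw [uIcc_of_ge hx.le] at ht
        exact hz t ((le_abs.2 (Or.inr (by linarith [ht.2]))))
    · rw [intervalIntegral.integral_eq_integral_of_support_subset, h0]
      intro t ht
      by_contra h
      rw [mem_Ioc, not_and_or, not_lt, not_le] at h
      refine ht (hz t ?_)
      rcases h with h | h
      · exact le_abs.2 (Or.inr (by linarith))
      · exact le_abs.2 (Or.inl (by linarith))

lemma isTest_update {v : Fin s → ℝ → ℝ} (hv : ∀ j, IsTest (v j)) (i : Fin s) {p : ℝ → ℝ}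
    (hp : IsTest p) (j : Fin s) : IsTest (Function.update v i p j) := by
  by_cases hj : j = i
  · subst hj; simpa using hp
  · simpa [hj] using hv j

lemma prod_update_coord (v : Fin s → ℝ → ℝ) (i : Fin s) (p : ℝ → ℝ) (y : Fin s → ℝ) :
    ∏ j, Function.update v i p j (y j) = p (y i) * ∏ j ∈ Finset.univ.erase i, v j (y j) := by
  rw [← Finset.mul_prod_erase _ _ (Finset.mem_univ i), Function.update_self]
  congr 1
  exact Finset.prod_congr rfl fun j hj => by rw [Function.update_of_ne (Finset.ne_of_mem_erase hj)]

/-- If the weak derivatives of `D` in the coordinates in `w` vanish, then `D` is a function of the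
other coordinates. -/
theorem ae_eq_avgOp {D : (Fin s → ℝ) → ℝ} (hD : LocallyIntegrable D) {χ : ℝ → ℝ} (hχ : IsTest χ)
    (hχ1 : ∫ x, χ x = 1) {w : Finset (Fin s)}
    (h : ∀ i ∈ w, ∀ v : Fin s → ℝ → ℝ, (∀ j, IsTest (v j)) →
      ∫ y, D y * ∏ j, Function.update v i (deriv (v i)) j (y j) = 0) :
    D =ᵐ[volume] avgOp χ w D := by
  -- The factor v_i minus its mass times χ has mean zero, hence is the derivative of a test
  -- function, and D is orthogonal to it by hypothesis. So v_i may be replaced by its mass times χ.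
  have step : ∀ v : Fin s → ℝ → ℝ, (∀ j, IsTest (v j)) → ∀ i ∈ w,
      ∫ y, D y * ∏ j, v j (y j) =
        (∫ x, v i x) * ∫ y, D y * ∏ j, Function.update v i χ j (y j) := by
    intro v hv i hi
    obtain ⟨p, hp, hpd⟩ := ((hv i).sub_const_mul hχ (∫ x, v i x)).exists_deriv_eq (by
      rw [integral_sub (hv i).integrable (hχ.integrable.const_mul _), integral_const_mul, hχ1,
        mul_one, sub_self])
    have h0 := h i hi (Function.update v i p) (isTest_update hv i hp)
    rw [Function.update_self, hpd, Function.update_idem] at h0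
    have e : ∀ y : Fin s → ℝ, D y * ∏ j, Function.update v i
        (fun x => v i x - (∫ x, v i x) * χ x) j (y j) =
        D y * ∏ j, v j (y j) - (∫ x, v i x) * (D y * ∏ j, Function.update v i χ j (y j)) := by
      intro y
      rw [prod_update_coord, prod_update_coord,
        ← Finset.mul_prod_erase _ (fun j => v j (y j)) (Finset.mem_univ i)]
      ring
    simp only [e] at h0
    rw [integral_sub (integrable_mul_prod_test hD hv)
      ((integrable_mul_prod_test hD (isTest_update hv i hχ)).const_mul _), integral_const_mul] at h0
    linarith
  have hall : ∀ S ⊆ w, ∀ v : Fin s → ℝ → ℝ, (∀ j, IsTest (v j)) →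
      ∫ y, D y * ∏ j, v j (y j) =
        (∫ y, D y * ∏ j, if j ∈ S then χ (y j) else v j (y j)) * ∏ j ∈ S, ∫ x, v j x := by
    intro S
    induction S using Finset.induction with
    | empty => intro _ v _; simp
    | insert i S hiS ih =>
      intro hS v hv
      have hv' : ∀ j, IsTest (if j ∈ S then χ else v j) := fun j => by
        split_ifs
        exacts [hχ, hv j]
      have h1 := step _ hv' i (hS (Finset.mem_insert_self i S))
      rw [ih (fun j hj => hS (Finset.mem_insert_of_mem hj)) v hv, Finset.prod_insert hiS]
      have e1 : ∀ y : Fin s → ℝ, (∏ j, if j ∈ S then χ (y j) else v j (y j)) =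
          ∏ j, (if j ∈ S then χ else v j) (y j) := fun y =>
        Finset.prod_congr rfl fun j _ => by split_ifs <;> rfl
      have e2 : ∀ y : Fin s → ℝ, (∏ j, if j ∈ insert i S then χ (y j) else v j (y j)) =
          ∏ j, Function.update (fun j => if j ∈ S then χ else v j) i χ j (y j) := fun y =>
        Finset.prod_congr rfl fun j _ => by
          by_cases hj : j = i
          · subst hj; simp
          · by_cases hjS : j ∈ S <;> simp [hj, hjS]
      simp only [e1, e2, h1]
      simp only [hiS, if_false]
      ring
  have hpair : ∀ v : Fin s → ℝ → ℝ, (∀ j, IsTest (v j)) →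
      Integrable (fun y => avgOp χ w D y * ∏ j, v j (y j)) ∧
      ∫ y, avgOp χ w D y * ∏ j, v j (y j) = ∫ y, D y * ∏ j, v j (y j) := by
    intro v hv
    have := avgOp_pairing hχ.1.continuous.measurable hχ.integrable hχ1 (w := w)
      (fun j => (hv j).1.continuous.measurable) (fun j => (hv j).integrable)
      hD.aestronglyMeasurable (by
        have := integrable_mul_prod_test hD (v := fun j => if j ∈ w then χ else v j) fun j => by
          split_ifs
          exacts [hχ, hv j]
        refine this.congr (Eventually.of_forall fun y => ?_)
        simp only
        congr 1
        exact Finset.prod_congr rfl fun j _ => by split_ifs <;> rfl)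
    exact ⟨this.2.1, this.2.2.trans (hall w subset_rfl v hv).symm⟩
  have hloc := locallyIntegrable_of_integrable_mul_prod_test fun v hv => (hpair v hv).1
  have := ae_eq_zero_of_integral_prod_coord (hD.sub hloc) fun v hv => by
    simp only [Pi.sub_apply, sub_mul]
    rw [integral_sub (integrable_mul_prod_test hD hv) (hpair v hv).1, (hpair v hv).2, sub_self]
  filter_upwards [this] with y hy
  simpa [sub_eq_zero] using hy

end
end LatticeQMC

namespace LatticeQMC
open Set Filter Topology

/-! ### Splitting the coordinates -/

section
variable {s : ℕ} (V : Finset (Fin s))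

/-- The coordinates in `V` and those outside `V`. -/
def splitCoord (y : Fin s → ℝ) : ({j // j ∈ V} → ℝ) × ({j // j ∉ V} → ℝ) :=
  (fun j => y j, fun j => y j)

lemma measurePreserving_splitCoord : MeasurePreserving (splitCoord V) volume
    ((volume : Measure ({j // j ∈ V} → ℝ)).prod (volume : Measure ({j // j ∉ V} → ℝ))) := by
  convert! volume_preserving_piEquivPiSubtypeProd (fun _ : Fin s => ℝ) (· ∈ V)
  rw [Measure.volume_eq_prod]
  congr!

lemma measurableEmbedding_splitCoord : MeasurableEmbedding (splitCoord V) :=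
  (MeasurableEquiv.piEquivPiSubtypeProd (fun _ : Fin s => ℝ) (· ∈ V)).measurableEmbedding

lemma integral_splitCoord_mul (G : ({j // j ∈ V} → ℝ) → ℝ) (H : ({j // j ∉ V} → ℝ) → ℝ) :
    ∫ y, G (splitCoord V y).1 * H (splitCoord V y).2 = (∫ a, G a) * ∫ b, H b := by
  rw [← integral_prod_mul]
  exact (measurePreserving_splitCoord V).integral_comp (measurableEmbedding_splitCoord V)
    (fun z => G z.1 * H z.2)

lemma integrable_splitCoord_mul {G : ({j // j ∈ V} → ℝ) → ℝ} {H : ({j // j ∉ V} → ℝ) → ℝ}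
    (hG : Integrable G) (hH : Integrable H) :
    Integrable fun y => G (splitCoord V y).1 * H (splitCoord V y).2 :=
  ((measurePreserving_splitCoord V).integrable_comp_emb (measurableEmbedding_splitCoord V)).2
    (hG.mul_prod hH)

lemma prod_splitCoord (p : Fin s → ℝ → ℝ) (y : Fin s → ℝ) :
    ∏ j, p j (y j) =
      (∏ j : {j // j ∈ V}, p j ((splitCoord V y).1 j)) *
        ∏ j : {j // j ∉ V}, p j ((splitCoord V y).2 j) := by
  convert! (Fintype.prod_subtype_mul_prod_subtype (· ∈ V) fun j => p j (y j)).symm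

end

/-! ### The averaged mixed derivatives -/

section
variable {β θ τ : ℝ} {s : ℕ} {F : (Fin s → ℝ) → ℝ}

/-- The mixed derivative `∂^{|V|}F/∂y_V`, averaged over the coordinates outside `V`. -/
noncomputable def meanDeriv (β : ℝ) (F : (Fin s → ℝ) → ℝ) (V : Finset (Fin s)) :
    (Fin s → ℝ) → ℝ :=
  avgOp (density β) Vᶜ (weakMixedDeriv V F)

lemma integral_prod_density (hβ : 0 < β) {ι : Type*} [Fintype ι] :
    ∫ y : ι → ℝ, ∏ j, density β (y j) = 1 := by
  rw [integral_fintype_prod_volume_eq_prod (fun _ b => density β b)]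
  simp [integral_density hβ]

lemma integrable_prod_density (hβ : 0 < β) {ι : Type*} [Fintype ι] :
    Integrable fun y : ι → ℝ => ∏ j, density β (y j) :=
  Integrable.fintype_prod fun _ => integrable_density hβ

lemma weakMixedDeriv_mul_prod_density (V : Finset (Fin s)) (y b : Fin s → ℝ) :
    weakMixedDeriv V F (Vᶜ.piecewise b y) * ∏ j, density β (b j) =
      (∏ j, density β ((splitCoord V b).1 j)) *
        innerIntegrand β V F (splitCoord V y).1 (splitCoord V b).2 := by
  have : Vᶜ.piecewise b y = glue V (splitCoord V y).1 (splitCoord V b).2 := by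
    funext j
    by_cases h : j ∈ V <;> simp [glue, splitCoord, h]
  rw [this, prod_splitCoord V (fun _ => density β) b, innerIntegrand]
  ring

lemma meanDeriv_eq (hβ : 0 < β) (V : Finset (Fin s)) (y : Fin s → ℝ) :
    meanDeriv β F V y = ∫ b, innerIntegrand β V F (splitCoord V y).1 b := by
  simp only [meanDeriv, avgOp, prodOp, weakMixedDeriv_mul_prod_density]
  rw [integral_splitCoord_mul V (fun a => ∏ j, density β (a j)) fun b =>
    innerIntegrand β V F (splitCoord V y).1 b, integral_prod_density hβ, one_mul]

lemma meanDeriv_piecewise (V : Finset (Fin s)) {w : Finset (Fin s)} (hw : Disjoint w V)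
    (b y : Fin s → ℝ) : meanDeriv β F V (w.piecewise b y) = meanDeriv β F V y := by
  refine avgOp_congr fun j hj => ?_
  rw [Finset.mem_compl, not_not] at hj
  exact Finset.piecewise_eq_of_notMem _ _ _ (Finset.disjoint_right.1 hw hj)

lemma MemSobolev.ae_integrable (hβ : 0 < β) (hF : MemSobolev β θ τ F) (V : Finset (Fin s)) :
    ∀ᵐ y : Fin s → ℝ, Integrable fun b : Fin s → ℝ =>
      weakMixedDeriv V F (Vᶜ.piecewise b y) * ∏ j, density β (b j) := by
  have h : ∀ᵐ y : Fin s → ℝ, Integrable (innerIntegrand β V F (splitCoord V y).1) :=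
    (Measure.quasiMeasurePreserving_fst.comp
      (measurePreserving_splitCoord V).quasiMeasurePreserving).ae (hF.inner_integrable V)
  filter_upwards [h] with y hy
  simp only [weakMixedDeriv_mul_prod_density]
  exact integrable_splitCoord_mul V (integrable_prod_density hβ) hy

lemma MemSobolev.aestronglyMeasurable_meanDeriv (hβ : 0 < β) (hF : MemSobolev β θ τ F)
    (V : Finset (Fin s)) : AEStronglyMeasurable (meanDeriv β F V) := by
  have h1 : AEStronglyMeasurable (weakMixedDeriv V F) :=
    (weakMixedDeriv_spec (hF.exists_deriv V)).1.aestronglyMeasurable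
  have h2 : AEStronglyMeasurable (fun q : (Fin s → ℝ) × (Fin s → ℝ) =>
      weakMixedDeriv V F (Vᶜ.piecewise q.2 q.1) * ∏ j, density β (q.2 j))
      (volume.prod volume) := by
    refine AEStronglyMeasurable.mul ?_ ?_
    · exact h1.comp_fst.comp_quasiMeasurePreserving
        (measurePreserving_exchange Vᶜ).quasiMeasurePreserving
    · have := continuous_density hβ
      exact Continuous.aestronglyMeasurable (by fun_prop)
  exact h2.integral_prod_right'

lemma prod_ite_splitCoord (V : Finset (Fin s)) (p q : ℝ → ℝ) (y : Fin s → ℝ) :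
    (∏ j, if j ∈ V then p (y j) else q (y j)) =
      (∏ j, p ((splitCoord V y).1 j)) * ∏ j, q ((splitCoord V y).2 j) := by
  have := prod_splitCoord V (fun j t => if j ∈ V then p t else q t) y
  rw [this]
  congr 1
  · exact Finset.prod_congr rfl fun j _ => if_pos j.2
  · exact Finset.prod_congr rfl fun j _ => if_neg j.2

lemma meanDeriv_sq_mul (hβ : 0 < β) (V : Finset (Fin s)) (y : Fin s → ℝ) :
    meanDeriv β F V y ^ 2 * (∏ j, if j ∈ V then psiSq θ τ (y j) else density β (y j)) =
      outerIntegrand β θ τ V F (splitCoord V y).1 *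
        ∏ j, density β ((splitCoord V y).2 j) := by
  rw [prod_ite_splitCoord, meanDeriv_eq hβ, outerIntegrand]
  ring

lemma MemSobolev.integrable_meanDeriv_sq (hβ : 0 < β) (hF : MemSobolev β θ τ F)
    (V : Finset (Fin s)) : Integrable fun y =>
      meanDeriv β F V y ^ 2 * (∏ j, if j ∈ V then psiSq θ τ (y j) else density β (y j)) := by
  simp only [meanDeriv_sq_mul hβ]
  exact integrable_splitCoord_mul V (hF.outer_integrable V) (integrable_prod_density hβ)

lemma integral_meanDeriv_sq (hβ : 0 < β) (V : Finset (Fin s)) :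
    ∫ y, meanDeriv β F V y ^ 2 * (∏ j, if j ∈ V then psiSq θ τ (y j) else density β (y j)) =
      ∫ a, outerIntegrand β θ τ V F a := by
  simp only [meanDeriv_sq_mul hβ]
  rw [integral_splitCoord_mul V (fun a => outerIntegrand β θ τ V F a)
    (fun b => ∏ j, density β (b j)), integral_prod_density hβ, mul_one]

/-- With q the `Liftable` weight and ρ the weight of the norm, |D|q ≤ D²ρ + q²/ρ. The first term is
integrable by membership in the space; the second factorises over coordinates, where the integrals
against 1/ψ² converge. -/
lemma MemSobolev.liftable_meanDeriv (hτ : 0 < τ) (hτβ : τ ≤ β) (hθ : 0 < θ)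
    (hθβ : τ = β → θ < 1 / β) (hF : MemSobolev β θ τ F) {V w : Finset (Fin s)} (hw : w ⊆ V) :
    Liftable β w (meanDeriv β F V) := by
  have hβ : 0 < β := hτ.trans_le hτβ
  have hm := hF.aestronglyMeasurable_meanDeriv hβ V
  refine ⟨hm, ?_⟩
  let q : Fin s → ℝ → ℝ := fun j t =>
    if j ∈ w then distFun β t * (1 - distFun β t) else density β t
  have hqc : ∀ j, Continuous (q j) := fun j => by
    have h1 := continuous_distFun hβ
    have h2 := continuous_density hβ
    by_cases h : j ∈ w
    · simp only [q, h, if_true]; fun_prop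
    · simp only [q, h, if_false]; fun_prop
  have hq0 : ∀ j t, 0 < q j t := fun j t => by
    have h0 := distFun_pos hβ t
    have h1 := distFun_lt_one hβ t
    by_cases h : j ∈ w
    · simp only [q, h, if_true]; exact mul_pos h0 (by linarith)
    · simp only [q, h, if_false]; exact density_pos hβ t
  let ρ : Fin s → ℝ → ℝ := fun j t => if j ∈ V then psiSq θ τ t else density β t
  have hρ0 : ∀ j t, 0 < ρ j t := fun j t => by
    by_cases h : j ∈ V
    · simp only [ρ, h, if_true]; exact psiSq_pos θ τ t
    · simp only [ρ, h, if_false]; exact density_pos hβ t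
  have hρc : ∀ j, Continuous (ρ j) := fun j => by
    have h1 := continuous_psiSq θ hτ
    have h2 := continuous_density hβ
    by_cases h : j ∈ V
    · simp only [ρ, h, if_true]; fun_prop
    · simp only [ρ, h, if_false]; fun_prop
  have hqi : ∀ j, Integrable fun t => q j t ^ 2 / ρ j t := fun j => by
    by_cases h : j ∈ V
    · by_cases h' : j ∈ w
      · refine (integrable_distFun_mul_div hτ hτβ hθ hθβ).mono'
          (((hqc j).pow 2).div (hρc j) fun t => (hρ0 j t).ne').aestronglyMeasurable
          (Eventually.of_forall fun t => ?_)
        rw [Real.norm_eq_abs, abs_of_nonneg (div_nonneg (sq_nonneg _) (hρ0 j t).le)]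
        simp only [q, ρ, h, h', if_true]
        have h0 := distFun_pos hβ t
        have h1 := distFun_lt_one hβ t
        have := psiSq_pos θ τ t
        gcongr
        have : 0 ≤ distFun β t * (1 - distFun β t) := mul_nonneg h0.le (by linarith)
        have h2 : distFun β t * (1 - distFun β t) ≤ 1 := by nlinarith
        nlinarith
      · simpa only [q, ρ, h, h', if_true, if_false] using
          integrable_density_sq_div hτ hτβ hθ hθβ
    · have h' : j ∉ w := fun h' => h (hw h')
      simp only [q, ρ, h, h', if_false]
      refine (integrable_density hβ).congr (Eventually.of_forall fun t => ?_)
      have := (density_pos hβ t).ne'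
      field_simp
  have hI := (hF.integrable_meanDeriv_sq hβ V).add (integrable_prod_coord hqi)
  refine hI.mono' (hm.mul ?_) (Eventually.of_forall fun y => ?_)
  · exact (continuous_finsetProd _ fun j _ =>
      (hqc j).comp (continuous_apply j)).aestronglyMeasurable
  · have hP : 0 < ∏ j, ρ j (y j) := Finset.prod_pos fun j _ => hρ0 j _
    have hQ : 0 < ∏ j, q j (y j) := Finset.prod_pos fun j _ => hq0 j _
    simp only [Pi.add_apply]
    rw [Finset.prod_div_distrib, Finset.prod_pow]
    change ‖meanDeriv β F V y * ∏ j, q j (y j)‖ ≤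
      meanDeriv β F V y ^ 2 * (∏ j, ρ j (y j)) + (∏ j, q j (y j)) ^ 2 / ∏ j, ρ j (y j)
    rw [Real.norm_eq_abs, abs_mul, abs_of_pos hQ]
    generalize (∏ j, ρ j (y j)) = P at hP ⊢
    generalize (∏ j, q j (y j)) = Q at hQ ⊢
    have e : meanDeriv β F V y ^ 2 * P + Q ^ 2 / P - 2 * (|meanDeriv β F V y| * Q) =
        (|meanDeriv β F V y| * P - Q) ^ 2 / P := by
      rw [← sq_abs (meanDeriv β F V y)]
      field_simp
      ring
    have h1 : 0 ≤ (|meanDeriv β F V y| * P - Q) ^ 2 / P := by positivity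
    have h2 : 0 ≤ |meanDeriv β F V y| * Q := by positivity
    linarith

end

/-! ### The representation formula -/

section
variable {β θ τ : ℝ} {s : ℕ} {F : (Fin s → ℝ) → ℝ}

lemma liftOp_empty (hβ : 0 < β) (f : (Fin s → ℝ) → ℝ) : liftOp β ∅ f = f := by
  funext y
  simp only [liftOp, prodOp, liftKernel, Finset.piecewise_empty, Finset.notMem_empty, if_false]
  rw [integral_const_mul, integral_prod_density hβ, mul_one]

lemma aestronglyMeasurable_of_integrable_mul_prod_density (hβ : 0 < β) {f : (Fin s → ℝ) → ℝ}
    (h : Integrable fun y => f y * ∏ j, density β (y j)) : AEStronglyMeasurable f := by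
  have hpos : ∀ y : Fin s → ℝ, ∏ j, density β (y j) ≠ 0 := fun y =>
    (Finset.prod_pos fun j _ => density_pos hβ _).ne'
  have hc : Continuous fun y : Fin s → ℝ => (∏ j, density β (y j))⁻¹ := by
    refine Continuous.inv₀ ?_ hpos
    have := continuous_density hβ
    fun_prop
  refine (h.aestronglyMeasurable.mul hc.aestronglyMeasurable).congr
    (Eventually.of_forall fun y => ?_)
  simp only [Pi.mul_apply]
  rw [mul_assoc, mul_inv_cancel₀ (hpos y), mul_one]

lemma Liftable.aestronglyMeasurable_liftOp (hβ : 0 < β) {w : Finset (Fin s)}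
    {f : (Fin s → ℝ) → ℝ} (hf : Liftable β w f) : AEStronglyMeasurable (liftOp β w f) :=
  aestronglyMeasurable_of_integrable_mul_prod_density hβ
    (liftOp_pairing hβ (fun _ => dominated_density hβ) hf).2.1

lemma Dominated.ite (hβ : 0 < β) {w : Finset (Fin s)} {v : Fin s → ℝ → ℝ}
    (hv : ∀ j, Dominated β (v j)) (j : Fin s) :
    Dominated β (if j ∈ w then density β else v j) := by
  split_ifs
  exacts [dominated_density hβ, hv j]

lemma prod_ite_apply (w : Finset (Fin s)) (p : ℝ → ℝ) (v : Fin s → ℝ → ℝ) (y : Fin s → ℝ) :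
    ∏ j, (if j ∈ w then p else v j) (y j) = ∏ j, if j ∈ w then p (y j) else v j (y j) :=
  Finset.prod_congr rfl fun j _ => by split_ifs <;> rfl

lemma avgOp_liftOp_pairing (hβ : 0 < β) {c w : Finset (Fin s)} {f : (Fin s → ℝ) → ℝ}
    (hf : Liftable β w f) {v : Fin s → ℝ → ℝ} (hv : ∀ j, Dominated β (v j)) :
    Integrable (fun q : (Fin s → ℝ) × (Fin s → ℝ) =>
        liftOp β w f (c.piecewise q.2 q.1) * (∏ j, density β (q.2 j)) * ∏ j, v j (q.1 j))
        (volume.prod volume) ∧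
      Integrable (fun y => avgOp (density β) c (liftOp β w f) y * ∏ j, v j (y j)) ∧
      ∫ y, avgOp (density β) c (liftOp β w f) y * ∏ j, v j (y j) =
        (∫ y, liftOp β w f y * ∏ j, if j ∈ c then density β (y j) else v j (y j)) *
          ∏ j ∈ c, ∫ x, v j x := by
  refine avgOp_pairing (continuous_density hβ).measurable (integrable_density hβ)
    (integral_density hβ) (fun j => (hv j).1) (fun j => (hv j).integrable hβ)
    (hf.aestronglyMeasurable_liftOp hβ) ?_
  have := (liftOp_pairing hβ (Dominated.ite hβ (w := c) hv) hf).2.1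
  simpa only [prod_ite_apply] using this

/-- In a coordinate of w the averaging inserts the density as test factor, and the transposed kernel
annihilates the density. -/
lemma avgOp_liftOp_ae_eq_zero (hβ : 0 < β) {c w : Finset (Fin s)} (hwc : w ⊆ c)
    (hw : w.Nonempty) {f : (Fin s → ℝ) → ℝ} (hf : Liftable β w f) :
    avgOp (density β) c (liftOp β w f) =ᵐ[volume] 0 := by
  refine ae_eq_zero_of_integral_prod_coord
    (locallyIntegrable_of_integrable_mul_prod_test fun v hv =>
      (avgOp_liftOp_pairing hβ hf fun j => (hv j).dominated hβ).2.1) fun v hv => ?_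
  rw [(avgOp_liftOp_pairing hβ hf fun j => (hv j).dominated hβ).2.2]
  have := (liftOp_pairing hβ (Dominated.ite hβ (w := c) fun j => (hv j).dominated hβ) hf).2.2
  simp only [prod_ite_apply] at this
  rw [this]
  obtain ⟨i, hi⟩ := hw
  have h0 : ∀ y : Fin s → ℝ, (∏ j, if j ∈ w then
      kernInt β (if j ∈ c then density β else v j) (y j) else
        (if j ∈ c then density β else v j) (y j)) = 0 := fun y => by
    refine Finset.prod_eq_zero (Finset.mem_univ i) ?_
    rw [if_pos hi, if_pos (hwc hi), kernInt_density hβ]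
  simp only [h0, mul_zero, integral_zero, zero_mul]

lemma avgOp_eq_self (hβ : 0 < β) {c : Finset (Fin s)} {f : (Fin s → ℝ) → ℝ} {y : Fin s → ℝ}
    (h : ∀ b, f (c.piecewise b y) = f y) : avgOp (density β) c f y = f y := by
  simp only [avgOp, prodOp, h]
  rw [integral_const_mul, integral_prod_density hβ, mul_one]

lemma ae_piecewise {P : (Fin s → ℝ) → Prop} (h : ∀ᵐ y, P y) (c : Finset (Fin s)) :
    ∀ᵐ y : Fin s → ℝ, ∀ᵐ b : Fin s → ℝ, P (c.piecewise b y) := by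
  have h1 : ∀ᵐ q : (Fin s → ℝ) × (Fin s → ℝ) ∂(volume.prod volume), P (c.piecewise q.2 q.1) :=
    (Measure.quasiMeasurePreserving_fst.comp
      (measurePreserving_exchange c).quasiMeasurePreserving).ae h
  exact Measure.ae_ae_of_ae_prod h1

/-- Testing required a compactly supported χ. Once D is known not to depend on the coordinates in c,
any unit-mass density gives the same average. -/
lemma ae_eq_avgOp_density (hβ : 0 < β) {D : (Fin s → ℝ) → ℝ} {χ : ℝ → ℝ} {c : Finset (Fin s)}
    (h : D =ᵐ[volume] avgOp χ c D) : D =ᵐ[volume] avgOp (density β) c D := by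
  filter_upwards [h, ae_piecewise h c] with y hy hb
  have h1 : avgOp (density β) c D y = ∫ b : Fin s → ℝ, D y * ∏ j, density β (b j) := by
    refine integral_congr_ae ?_
    filter_upwards [hb] with b hb
    rw [hb, hy]
    congr 1
    exact avgOp_congr fun j hj => Finset.piecewise_eq_of_notMem _ _ _ hj
  rw [h1, integral_const_mul, integral_prod_density hβ, mul_one]

end
end LatticeQMC

/-! ### Proof of the representation formula -/

namespace LatticeQMC
open Set Filter Topology

section
variable {β θ τ : ℝ} {s : ℕ} {F : (Fin s → ℝ) → ℝ}

/-- The mixed derivative `∂^{|u|}F/∂y_u` in terms of the averaged mixed derivatives. -/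
noncomputable def liftSum (β : ℝ) (F : (Fin s → ℝ) → ℝ) (u : Finset (Fin s)) (y : Fin s → ℝ) : ℝ :=
  ∑ V ∈ Finset.univ.filter (u ⊆ ·), liftOp β (V \ u) (meanDeriv β F V) y

lemma liftOp_meanDeriv_piecewise {V w : Finset (Fin s)} {i : Fin s} (hi : i ∉ V) (hw : w ⊆ V)
    (y b : Fin s → ℝ) : liftOp β w (meanDeriv β F V) (({i} : Finset (Fin s)).piecewise b y) =
      liftOp β w (meanDeriv β F V) y := by
  have hiw : i ∉ w := fun h => hi (hw h)
  unfold liftOp prodOp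
  congr 1
  funext c
  have e : w.piecewise c (({i} : Finset (Fin s)).piecewise b y) =
      ({i} : Finset (Fin s)).piecewise b (w.piecewise c y) := by
    funext j
    by_cases hj : j = i
    · subst hj; simp [hiw]
    · by_cases hjw : j ∈ w <;> simp [hj, hjw]
  rw [e, meanDeriv_piecewise V (Finset.disjoint_singleton_left.2 hi)]
  congr 1
  refine Finset.prod_congr rfl fun j _ => ?_
  by_cases hj : j = i
  · subst hj; simp [liftKernel, hiw]
  · simp [hj]

lemma dominated_update (hβ : 0 < β) {v : Fin s → ℝ → ℝ} (hv : ∀ j, IsTest (v j)) (i j : Fin s) :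
    Dominated β (Function.update v i (deriv (v i)) j) :=
  (isTest_update hv i (hv i).deriv j).dominated hβ

/-- The function does not depend on the i-th coordinate, and the test factor there is a derivative,
whose integral is zero. -/
lemma integral_liftOp_update_of_notMem (hβ : 0 < β) {V w : Finset (Fin s)} {i : Fin s}
    (hi : i ∉ V) (hw : w ⊆ V) (hf : Liftable β w (meanDeriv β F V)) {v : Fin s → ℝ → ℝ}
    (hv : ∀ j, IsTest (v j)) :
    ∫ y, liftOp β w (meanDeriv β F V) y * ∏ j, Function.update v i (deriv (v i)) j (y j) = 0 := by
  rw [integral_mul_prod_of_indep (w := {i}) (continuous_density hβ).measurable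
    (integrable_density hβ) (integral_density hβ) (fun j => (dominated_update hβ hv i j).1)
    (fun j => (dominated_update hβ hv i j).integrable hβ) (hf.aestronglyMeasurable_liftOp hβ)
    (fun y b => liftOp_meanDeriv_piecewise hi hw y b)]
  · rw [Finset.prod_singleton, Function.update_self,
      integral_deriv_eq_zero ((hv i).1.of_le (by exact_mod_cast le_top)) (hv i).2, mul_zero]
  · have := (liftOp_pairing hβ (Dominated.ite hβ (w := {i}) (dominated_update hβ hv i)) hf).2.1
    simpa only [prod_ite_apply] using this

lemma integral_liftOp_update_of_mem (hβ : 0 < β) {w : Finset (Fin s)} {i : Fin s} (hi : i ∈ w)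
    {f : (Fin s → ℝ) → ℝ} (hf : Liftable β w f) (hf' : Liftable β (w.erase i) f)
    {v : Fin s → ℝ → ℝ} (hv : ∀ j, IsTest (v j)) :
    ∫ y, liftOp β w f y * ∏ j, Function.update v i (deriv (v i)) j (y j) =
      -∫ y, liftOp β (w.erase i) f y * ∏ j, v j (y j) := by
  rw [(liftOp_pairing hβ (dominated_update hβ hv i) hf).2.2,
    (liftOp_pairing hβ (fun j => (hv j).dominated hβ) hf').2.2, ← integral_neg]
  congr 1
  funext y
  rw [← mul_neg]
  congr 1
  rw [← Finset.mul_prod_erase _ _ (Finset.mem_univ i),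
    ← Finset.mul_prod_erase (a := i) (h := Finset.mem_univ i)
      (f := fun j => if j ∈ w.erase i then kernInt β (v j) (y j) else v j (y j))]
  rw [if_pos hi, Function.update_self,
    kernInt_deriv ((hv i).1.of_le (by exact_mod_cast le_top)) (hv i).2]
  simp only [Finset.notMem_erase, if_false, neg_mul]
  congr 2
  refine Finset.prod_congr rfl fun j hj => ?_
  have hji := Finset.ne_of_mem_erase hj
  simp [hji]

lemma liftSum_pairing (hβ : 0 < β) {u : Finset (Fin s)}
    (hf : ∀ V w : Finset (Fin s), w ⊆ V → Liftable β w (meanDeriv β F V)) {p : Fin s → ℝ → ℝ}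
    (hp : ∀ j, Dominated β (p j)) :
    Integrable (fun y => liftSum β F u y * ∏ j, p j (y j)) ∧
      ∫ y, liftSum β F u y * ∏ j, p j (y j) = ∑ V ∈ Finset.univ.filter (u ⊆ ·),
        ∫ y, liftOp β (V \ u) (meanDeriv β F V) y * ∏ j, p j (y j) := by
  have h : ∀ V : Finset (Fin s), Integrable fun y =>
      liftOp β (V \ u) (meanDeriv β F V) y * ∏ j, p j (y j) := fun V =>
    (liftOp_pairing hβ hp (hf V _ Finset.sdiff_subset)).2.1
  simp only [liftSum, Finset.sum_mul]
  exact ⟨integrable_finsetSum _ fun V _ => h V, integral_finsetSum _ fun V _ => h V⟩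

/-- Differentiating the expansion in i removes the sets V that miss i and deletes i from V \ u for
the others. What remains, up to sign, is the expansion for `insert i u`, so the expansions satisfy
the same derivative relations as the mixed derivatives of F. -/
lemma integral_liftSum_update (hβ : 0 < β) {u : Finset (Fin s)} {i : Fin s} (hi : i ∉ u)
    (hf : ∀ V w : Finset (Fin s), w ⊆ V → Liftable β w (meanDeriv β F V)) {v : Fin s → ℝ → ℝ}
    (hv : ∀ j, IsTest (v j)) :
    ∫ y, liftSum β F u y * ∏ j, Function.update v i (deriv (v i)) j (y j) =
      -∫ y, liftSum β F (insert i u) y * ∏ j, v j (y j) := by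
  rw [(liftSum_pairing hβ hf (dominated_update hβ hv i)).2,
    (liftSum_pairing hβ hf fun j => (hv j).dominated hβ).2, ← Finset.sum_neg_distrib]
  symm
  refine Finset.sum_subset_zero_on_sdiff (fun V hV => ?_) (fun V hV => ?_) fun V hV => ?_
  · simp only [Finset.mem_filter, Finset.mem_univ, true_and] at hV ⊢
    exact (Finset.subset_insert i u).trans hV
  · simp only [Finset.mem_sdiff, Finset.mem_filter, Finset.mem_univ, true_and,
      Finset.insert_subset_iff, not_and'] at hV
    exact integral_liftOp_update_of_notMem hβ (hV.2 hV.1) Finset.sdiff_subset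
      (hf V _ Finset.sdiff_subset) hv
  · simp only [Finset.mem_filter, Finset.mem_univ, true_and, Finset.insert_subset_iff] at hV
    have e : V \ insert i u = (V \ u).erase i := by
      ext j; simp only [Finset.mem_sdiff, Finset.mem_insert, Finset.mem_erase]; tauto
    rw [integral_liftOp_update_of_mem hβ (Finset.mem_sdiff.2 ⟨hV.1, hi⟩)
      (hf V _ Finset.sdiff_subset)
      (hf V _ ((Finset.erase_subset _ _).trans Finset.sdiff_subset)) hv, e]

lemma ae_integrable_liftOp (hβ : 0 < β) {c w : Finset (Fin s)} {f : (Fin s → ℝ) → ℝ}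
    (hf : Liftable β w f) : ∀ᵐ y : Fin s → ℝ, Integrable fun b : Fin s → ℝ =>
      liftOp β w f (c.piecewise b y) * ∏ j, density β (b j) := by
  have h := (avgOp_liftOp_pairing hβ (c := c) hf fun _ => dominated_density hβ).1
  filter_upwards [h.prod_right_ae] with y hy
  have hpos : ∏ j, density β (y j) ≠ 0 := (Finset.prod_pos fun j _ => density_pos hβ _).ne'
  refine (hy.mul_const (∏ j, density β (y j))⁻¹).congr (Eventually.of_forall fun b => ?_)
  simp only
  rw [mul_assoc, mul_inv_cancel₀ hpos, mul_one]

/-- The averages of `∂^{|u|}F/∂y_u` and of `liftSum β F u` agree. -/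
lemma avgOp_sub_liftSum_ae_eq_zero (hβ : 0 < β) (hF : MemSobolev β θ τ F)
    (hf : ∀ V w : Finset (Fin s), w ⊆ V → Liftable β w (meanDeriv β F V)) (u : Finset (Fin s)) :
    avgOp (density β) uᶜ (fun y => weakMixedDeriv u F y - liftSum β F u y) =ᵐ[volume] 0 := by
  have h1 : ∀ᵐ y : Fin s → ℝ, ∀ V : Finset (Fin s), Integrable fun b : Fin s → ℝ =>
      liftOp β (V \ u) (meanDeriv β F V) (uᶜ.piecewise b y) * ∏ j, density β (b j) :=
    ae_all_iff.2 fun V => ae_integrable_liftOp hβ (hf V _ Finset.sdiff_subset)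
  have h2 : ∀ᵐ y : Fin s → ℝ, ∀ V : Finset (Fin s), u ⊂ V →
      avgOp (density β) uᶜ (liftOp β (V \ u) (meanDeriv β F V)) y = 0 := by
    refine ae_all_iff.2 fun V => ?_
    by_cases hV : u ⊂ V
    · filter_upwards [avgOp_liftOp_ae_eq_zero hβ (c := uᶜ) (w := V \ u) (fun j hj => by
        simpa using (Finset.mem_sdiff.1 hj).2) (Finset.sdiff_nonempty.2 hV.2)
        (hf V _ Finset.sdiff_subset)] with y hy _
      exact hy
    · exact Eventually.of_forall fun y h => absurd h hV
  filter_upwards [hF.ae_integrable hβ u, h1, h2] with y hy h1 h2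
  have e : avgOp (density β) uᶜ (fun y => weakMixedDeriv u F y - liftSum β F u y) y =
      meanDeriv β F u y - ∑ V ∈ Finset.univ.filter (u ⊆ ·),
        avgOp (density β) uᶜ (liftOp β (V \ u) (meanDeriv β F V)) y := by
    simp only [avgOp, prodOp, liftSum, sub_mul, Finset.sum_mul]
    rw [integral_sub hy (integrable_finsetSum _ fun V _ => h1 V),
      integral_finsetSum _ fun V _ => h1 V]
    rfl
  -- Only V = u survives the averaging, and its term is unchanged because it depends on the
  -- coordinates in u alone.
  rw [e, Finset.sum_eq_single u]
  · rw [Finset.sdiff_self, liftOp_empty hβ, avgOp_eq_self hβ fun b =>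
      meanDeriv_piecewise u (Finset.disjoint_left.2 fun j hj => Finset.mem_compl.1 hj) b y,
      sub_self, Pi.zero_apply]
  · intro V hV hVu
    exact h2 V ((Finset.mem_filter.1 hV).2.ssubset_of_ne hVu.symm)
  · intro h
    simp at h

/-- The difference D of the two sides has zero weak derivatives in the coordinates outside u, so it
equals its average over them, and the two averages agree by `avgOp_sub_liftSum_ae_eq_zero`. -/
lemma weakMixedDeriv_ae_eq_liftSum_step (hβ : 0 < β) (hF : MemSobolev β θ τ F)
    (hf : ∀ V w : Finset (Fin s), w ⊆ V → Liftable β w (meanDeriv β F V)) {u : Finset (Fin s)}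
    (h : ∀ i ∉ u, weakMixedDeriv (insert i u) F =ᵐ[volume] liftSum β F (insert i u)) :
    weakMixedDeriv u F =ᵐ[volume] liftSum β F u := by
  have hg : ∀ u, IsWeakMixedDeriv u F (weakMixedDeriv u F) := fun u =>
    weakMixedDeriv_spec (hF.exists_deriv u)
  have hR := fun (v : Fin s → ℝ → ℝ) (hv : ∀ j, IsTest (v j)) =>
    (liftSum_pairing hβ hf (u := u) fun j => (hv j).dominated hβ).1
  have hD : LocallyIntegrable fun y => weakMixedDeriv u F y - liftSum β F u y :=
    (hg u).1.sub (locallyIntegrable_of_integrable_mul_prod_test hR)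
  obtain ⟨χ, hχ, hχ1⟩ := exists_isTest_integral_eq_one
  have hE := ae_eq_avgOp_density hβ (ae_eq_avgOp hD hχ hχ1 (w := uᶜ) fun i hi v hv => by
    have hi : i ∉ u := Finset.mem_compl.1 hi
    have hv' := isTest_update hv i (hv i).deriv
    simp only [sub_mul]
    rw [integral_sub (integrable_mul_prod_test (hg u).1 hv') (hR _ hv'),
      (hg u).integral_update hi (hg _) hv, integral_liftSum_update hβ hi hf hv, sub_neg_eq_add,
      neg_add_eq_zero]
    refine integral_congr_ae ?_
    filter_upwards [h i hi] with y hy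
    rw [hy])
  filter_upwards [hE, avgOp_sub_liftSum_ae_eq_zero hβ hF hf u] with y h1 h2
  rw [h2, Pi.zero_apply, sub_eq_zero] at h1
  exact h1

/-- Induction on the number of missing coordinates. For the full set the hypothesis of the step is
vacuous. -/
theorem weakMixedDeriv_ae_eq_liftSum (hβ : 0 < β) (hF : MemSobolev β θ τ F)
    (hf : ∀ V w : Finset (Fin s), w ⊆ V → Liftable β w (meanDeriv β F V))
    (u : Finset (Fin s)) : weakMixedDeriv u F =ᵐ[volume] liftSum β F u := by
  generalize hk : uᶜ.card = k
  induction k generalizing u with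
  | zero =>
    refine weakMixedDeriv_ae_eq_liftSum_step hβ hF hf fun i hi => ?_
    rw [Finset.card_eq_zero] at hk
    exact absurd (Finset.mem_compl.2 hi) (by simp [hk])
  | succ k ih =>
    refine weakMixedDeriv_ae_eq_liftSum_step hβ hF hf fun i hi => ih _ ?_
    rw [Finset.compl_insert, Finset.card_erase_of_mem (Finset.mem_compl.2 hi), hk]
    rfl

lemma weakMixedDeriv_empty_ae_eq (hF : MemSobolev β θ τ F) :
    weakMixedDeriv ∅ F =ᵐ[volume] F := by
  have hg := weakMixedDeriv_spec (hF.exists_deriv ∅)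
  have hFl := hF.continuous.locallyIntegrable (μ := (volume : Measure (Fin s → ℝ)))
  have := ae_eq_zero_of_integral_prod_coord (hg.1.sub hFl) fun v hv => by
    have h := hg.integral_prod_coord hv
    simp only [Finset.notMem_empty, if_false, Finset.card_empty, pow_zero, one_mul] at h
    simp only [Pi.sub_apply, sub_mul]
    rw [integral_sub (integrable_mul_prod_test hg.1 hv) (integrable_mul_prod_test hFl hv), h,
      sub_self]
  filter_upwards [this] with y hy
  simpa [sub_eq_zero] using hy

lemma meanDeriv_empty (hF : MemSobolev β θ τ F) (y : Fin s → ℝ) :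
    meanDeriv β F ∅ y = integralS β F := by
  refine integral_congr_ae ?_
  filter_upwards [weakMixedDeriv_empty_ae_eq hF] with b hb
  have : (∅ᶜ : Finset (Fin s)).piecewise b y = b := by
    funext j
    simp
  rw [this, hb]

/-- The representation formula for functions in the Sobolev space. -/
theorem MemSobolev.ae_eq_integralS_add (hτ : 0 < τ) (hτβ : τ ≤ β) (hθ : 0 < θ)
    (hθβ : τ = β → θ < 1 / β) (hF : MemSobolev β θ τ F) :
    ∀ᵐ y, F y = integralS β F + ∑ V ∈ Finset.univ.erase ∅,
      ∫ b, meanDeriv β F V b * ∏ j, liftKernel β V j (y j) (b j) := by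
  have hβ : 0 < β := hτ.trans_le hτβ
  filter_upwards [weakMixedDeriv_empty_ae_eq hF, weakMixedDeriv_ae_eq_liftSum hβ hF
    (fun V w hw => hF.liftable_meanDeriv hτ hτβ hθ hθβ hw) ∅] with y h1 h2
  rw [← h1, h2, liftSum]
  simp only [Finset.empty_subset, Finset.filter_true, Finset.sdiff_empty]
  rw [← Finset.add_sum_erase _ _ (Finset.mem_univ ∅), liftOp_empty hβ, meanDeriv_empty hF]
  congr 1
  refine Finset.sum_congr rfl fun V _ => ?_
  simp only [liftOp, prodOp]
  congr 1
  funext b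
  congr 1
  have : V.piecewise b y = Vᶜ.piecewise y b := (Finset.piecewise_compl V y b).symm
  rw [this]
  exact meanDeriv_piecewise V (Finset.disjoint_left.2 fun j hj => Finset.mem_compl.1 hj) y b

end
end LatticeQMC

namespace LatticeQMC
open Set Filter Topology

/-! ### Randomly shifted points -/

section
variable {β : ℝ}

/-- The shifted point `Φ_β⁻¹({t + x})`. -/
noncomputable def shiftPoint (β t x : ℝ) : ℝ := quantile β (Int.fract (t + x))

lemma measurable_shiftPoint (hβ : 0 < β) (t : ℝ) : Measurable (shiftPoint β t) :=
  (measurable_quantile hβ).comp (measurable_fract.comp (measurable_const.add measurable_id))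

lemma setIntegral_Icc_eq_intervalIntegral (g : ℝ → ℝ) :
    ∫ x in Icc (0 : ℝ) 1, g x = ∫ x in (0 : ℝ)..1, g x := by
  rw [intervalIntegral.integral_of_le zero_le_one, integral_Icc_eq_integral_Ioc]

lemma setIntegral_periodic_add {g : ℝ → ℝ} (hg : Function.Periodic g 1) (t : ℝ) :
    ∫ x in Icc (0 : ℝ) 1, g (t + x) = ∫ x in Icc (0 : ℝ) 1, g x := by
  rw [setIntegral_Icc_eq_intervalIntegral, setIntegral_Icc_eq_intervalIntegral,
    intervalIntegral.integral_comp_add_left, add_zero, hg.intervalIntegral_add_eq t 0, zero_add]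

lemma setIntegral_Icc_congr {f g : ℝ → ℝ} (h : ∀ x ∈ Ioo (0 : ℝ) 1, f x = g x) :
    ∫ x in Icc (0 : ℝ) 1, f x = ∫ x in Icc (0 : ℝ) 1, g x := by
  rw [integral_Icc_eq_integral_Ioo, integral_Icc_eq_integral_Ioo]
  exact setIntegral_congr_fun measurableSet_Ioo h

/-- The indicator function of `{x} ≤ w`. -/
noncomputable def arc (w x : ℝ) : ℝ := if Int.fract x ≤ w then 1 else 0

lemma arc_periodic (w : ℝ) : Function.Periodic (arc w) 1 := fun x => by
  simp [arc]

lemma measurable_arc (w : ℝ) : Measurable (arc w) :=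
  Measurable.ite (measurableSet_le measurable_fract measurable_const) measurable_const
    measurable_const

lemma arc_mem (w x : ℝ) : 0 ≤ arc w x ∧ arc w x ≤ 1 := by
  unfold arc; split_ifs <;> simp

lemma integrableOn_Icc_of_bounded {f : ℝ → ℝ} (hf : Measurable f) {C : ℝ} (hC : ∀ x, |f x| ≤ C) :
    IntegrableOn f (Icc 0 1) := by
  refine Integrable.mono' (g := fun _ => C) (integrable_const _) hf.aestronglyMeasurable
    (Eventually.of_forall hC)

lemma setIntegral_indicator_Icc {a b : ℝ} (ha : 0 ≤ a) (hb : b ≤ 1) :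
    ∫ x in Icc (0 : ℝ) 1, (Icc a b).indicator 1 x = max (b - a) 0 := by
  rw [setIntegral_indicator measurableSet_Icc,
    inter_eq_right.2 (Icc_subset_Icc ha hb)]
  simp

lemma integral_arc {w : ℝ} (h0 : 0 ≤ w) (h1 : w ≤ 1) : ∫ x in Icc (0 : ℝ) 1, arc w x = w := by
  rw [setIntegral_Icc_congr (g := (Icc 0 w).indicator 1), setIntegral_indicator_Icc le_rfl h1,
    sub_zero, max_eq_left h0]
  intro x hx
  rw [arc, Int.fract_eq_self.2 ⟨hx.1.le, hx.2⟩]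
  by_cases h : x ≤ w <;> simp [indicator, h, hx.1.le]

/-- Two arcs of length w on the circle, displaced by d, overlap in up to two intervals: [0, w - d]
before the wrap-around and [1 - d, w] after it. -/
lemma integral_arc_mul_arc {w d : ℝ} (h1 : w < 1) (hd0 : 0 ≤ d) (hd1 : d < 1) :
    ∫ x in Icc (0 : ℝ) 1, arc w (d + x) * arc w x = max (w - d) 0 + max (w - (1 - d)) 0 := by
  have h : ∀ x ∈ Ioo (0 : ℝ) 1, arc w (d + x) * arc w x =
      (Icc 0 (w - d)).indicator 1 x + (Icc (1 - d) w).indicator 1 x := by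
    intro x hx
    have e2 : Int.fract x = x := Int.fract_eq_self.2 ⟨hx.1.le, hx.2⟩
    by_cases hdx : d + x < 1
    · have e1 : Int.fract (d + x) = d + x :=
        Int.fract_eq_self.2 ⟨by linarith [hx.1], hdx⟩
      have hn : x ∉ Icc (1 - d) w := fun h => by linarith [h.1]
      rw [indicator_of_notMem hn, add_zero, arc, arc, e1, e2]
      by_cases h : x ∈ Icc 0 (w - d)
      · rw [indicator_of_mem h, if_pos (by linarith [h.2]), if_pos (by linarith [h.2])]
        simp
      · have : ¬ d + x ≤ w := fun h' => h ⟨hx.1.le, by linarith⟩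
        rw [indicator_of_notMem h, if_neg this, zero_mul]
    · have e1 : Int.fract (d + x) = d + x - 1 := by
        rw [← Int.fract_sub_one]
        exact Int.fract_eq_self.2 ⟨by linarith, by linarith [hx.2]⟩
      have hn : x ∉ Icc 0 (w - d) := fun h => by linarith [h.2]
      rw [indicator_of_notMem hn, zero_add, arc, arc, e1, e2]
      by_cases h : x ∈ Icc (1 - d) w
      · rw [indicator_of_mem h, if_pos (by linarith [h.2]), if_pos h.2]
        simp
      · have : ¬ x ≤ w := fun h' => h ⟨by linarith, h'⟩
        rw [indicator_of_notMem h, if_neg this, mul_zero]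
  have hi : ∀ a b : ℝ, IntegrableOn ((Icc a b).indicator (1 : ℝ → ℝ)) (Icc 0 1) := fun a b =>
    integrableOn_Icc_of_bounded (measurable_one.indicator measurableSet_Icc) (C := 1) fun x => by
      unfold indicator; split_ifs <;> simp
  rw [setIntegral_Icc_congr h, integral_add (hi _ _) (hi _ _),
    setIntegral_indicator_Icc le_rfl (by linarith), setIntegral_indicator_Icc (by linarith) h1.le]
  congr 2; ring

/-- The fractional part 0 is excluded because the quantile takes a default value there; this costs
only a null set of shifts. -/
lemma kern_quantile (hβ : 0 < β) {u : ℝ} (h : Int.fract u ≠ 0) (b : ℝ) :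
    kern β (quantile β (Int.fract u)) b = distFun β b - arc (distFun β b) u := by
  have h0 : 0 < Int.fract u := (Int.fract_nonneg u).lt_of_ne' h
  simp only [kern, arc, quantile_le_iff hβ h0 (Int.fract_lt_one u)]

lemma periodic_kern_quantile (β b c : ℝ) :
    Function.Periodic (fun x => kern β (quantile β (Int.fract (c + x))) b) 1 := fun x => by
  simp only [← add_assoc, Int.fract_add_one]

/-- The expectation over the shift of the product of two kernels. -/
lemma integral_kern_mul_kern (hβ : 0 < β) (t t' b : ℝ) :
    ∫ x in Icc (0 : ℝ) 1, kern β (shiftPoint β t x) b * kern β (shiftPoint β t' x) b =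
      max (distFun β b - Int.fract (t - t')) 0 +
        max (distFun β b - (1 - Int.fract (t - t'))) 0 - distFun β b ^ 2 := by
  set w := distFun β b with hw
  set d := Int.fract (t - t') with hd
  have hd0 : 0 ≤ d := Int.fract_nonneg _
  have hd1 : d < 1 := Int.fract_lt_one _
  have hw0 : 0 < w := distFun_pos hβ b
  have hw1 : w < 1 := distFun_lt_one hβ b
  -- Translation by t' makes the integrand depend on the two points only through d, the fractional
  -- part of their difference.
  have e1 : ∀ x, kern β (shiftPoint β t x) b * kern β (shiftPoint β t' x) b =
      (fun y => kern β (quantile β (Int.fract (d + y))) b *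
        kern β (quantile β (Int.fract (0 + y))) b) (t' + x) := fun x => by
    have : Int.fract (d + (t' + x)) = Int.fract (t + x) := by
      rw [Int.fract_eq_fract]
      exact ⟨-⌊t - t'⌋, by rw [hd, Int.fract]; push_cast; ring⟩
    simp only [shiftPoint, this, zero_add]
  refine (integral_congr_ae (Eventually.of_forall e1)).trans ((setIntegral_periodic_add
    ((periodic_kern_quantile β b d).mul (periodic_kern_quantile β b 0)) t').trans ?_)
  have e2 : ∀ᵐ x ∂volume.restrict (Icc (0 : ℝ) 1),
      kern β (quantile β (Int.fract (d + x))) b * kern β (quantile β (Int.fract (0 + x))) b =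
      w ^ 2 - w * arc w (d + x) - w * arc w x + arc w (d + x) * arc w x := by
    have hne : ∀ c : ℝ, ∀ᵐ x ∂volume.restrict (Icc (0 : ℝ) 1), x ≠ c := fun c =>
      ae_restrict_of_ae (Measure.ae_ne volume c)
    filter_upwards [hne 0, hne 1, hne (1 - d), ae_restrict_mem measurableSet_Icc]
      with x h0 h1 h2 hx
    have hx0 : 0 < x := hx.1.lt_of_ne' h0
    have hx1 : x < 1 := hx.2.lt_of_ne h1
    have f1 : Int.fract (d + x) ≠ 0 := fun h => by
      rw [Int.fract_eq_zero_iff] at h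
      obtain ⟨k, hk⟩ := h
      have hk0 : (0 : ℝ) < k := by linarith
      have hk2 : (k : ℝ) < 2 := by linarith
      have hk1 : k = 1 := by
        have : 0 < k := by exact_mod_cast hk0
        have : k < 2 := by exact_mod_cast hk2
        omega
      rw [hk1] at hk
      push_cast at hk
      exact h2 (by linarith)
    have f2 : Int.fract (0 + x) ≠ 0 := by
      rw [zero_add, Int.fract_eq_self.2 ⟨hx0.le, hx1⟩]
      exact hx0.ne'
    rw [kern_quantile hβ f1, kern_quantile hβ f2, zero_add]
    ring
  refine (integral_congr_ae e2).trans ?_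
  have i1 : IntegrableOn (fun x => arc w (d + x)) (Icc 0 1) :=
    integrableOn_Icc_of_bounded ((measurable_arc w).comp (measurable_const.add measurable_id))
      (C := 1) fun x => by rw [abs_of_nonneg (arc_mem w _).1]; exact (arc_mem w _).2
  have i2 : IntegrableOn (arc w) (Icc 0 1) :=
    integrableOn_Icc_of_bounded (measurable_arc w)
      (C := 1) fun x => by rw [abs_of_nonneg (arc_mem w _).1]; exact (arc_mem w _).2
  have i3 : IntegrableOn (fun x => arc w (d + x) * arc w x) (Icc 0 1) :=
    integrableOn_Icc_of_bounded (((measurable_arc w).comp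
      (measurable_const.add measurable_id)).mul (measurable_arc w)) (C := 1) fun x => by
        have h1 := arc_mem w (d + x)
        have h2 := arc_mem w x
        rw [abs_of_nonneg (mul_nonneg h1.1 h2.1)]
        exact mul_le_one₀ h1.2 h2.1 h2.2
  have i0 : IntegrableOn (fun _ : ℝ => w ^ 2) (Icc 0 1) := integrableOn_const (by simp)
  have j1 : IntegrableOn (fun x => w ^ 2 - w * arc w (d + x)) (Icc 0 1) :=
    i0.sub (i1.const_mul w)
  have j2 : IntegrableOn (fun x => w ^ 2 - w * arc w (d + x) - w * arc w x) (Icc 0 1) :=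
    j1.sub (i2.const_mul w)
  rw [integral_add j2 i3, integral_sub j1 (i2.const_mul w),
    integral_sub i0 (i1.const_mul w), integral_const_mul, integral_const_mul,
    setIntegral_periodic_add (arc_periodic w), integral_arc hw0.le hw1.le,
    integral_arc_mul_arc hw1 hd0 hd1]
  simp
  ring

lemma measurable_kern_shiftPoint (hβ : 0 < β) (t : ℝ) :
    Measurable fun q : ℝ × ℝ => kern β (shiftPoint β t q.2) q.1 :=
  (measurable_kern hβ).comp
    (((measurable_shiftPoint hβ t).comp measurable_snd).prodMk measurable_fst)

lemma integrableOn_kern_mul_kern (hβ : 0 < β) (t t' b : ℝ) :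
    IntegrableOn (fun x => kern β (shiftPoint β t x) b * kern β (shiftPoint β t' x) b)
      (Icc 0 1) := by
  have hm : ∀ t, Measurable fun x => kern β (shiftPoint β t x) b := fun t =>
    (measurable_kern_shiftPoint hβ t).comp (measurable_const.prodMk measurable_id)
  refine integrableOn_Icc_of_bounded ((hm t).mul (hm t')) (C := 1) fun x => ?_
  rw [abs_mul]
  exact mul_le_one₀ (abs_kern_le_one hβ _ _) (abs_nonneg _) (abs_kern_le_one hβ _ _)

/-- The inequality |ab| ≤ (a² + b²)/2 reduces to the diagonal t = t', where the previous formula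
gives Φ(1 - Φ), a majorant independent of the points. -/
lemma integral_abs_kern_mul_kern_le (hβ : 0 < β) (t t' b : ℝ) :
    ∫ x in Icc (0 : ℝ) 1, |kern β (shiftPoint β t x) b * kern β (shiftPoint β t' x) b| ≤
      distFun β b * (1 - distFun β b) := by
  have h0 := distFun_pos hβ b
  have h1 := distFun_lt_one hβ b
  have hs : ∀ t, ∫ x in Icc (0 : ℝ) 1, kern β (shiftPoint β t x) b * kern β (shiftPoint β t x) b =
      distFun β b * (1 - distFun β b) := fun t => by
    rw [integral_kern_mul_kern hβ, sub_self, Int.fract_zero, sub_zero, sub_zero,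
      max_eq_left h0.le, max_eq_right (by linarith)]
    ring
  have hi := integrableOn_kern_mul_kern hβ
  calc _ ≤ ∫ x in Icc (0 : ℝ) 1, (1 / 2 *
        (kern β (shiftPoint β t x) b * kern β (shiftPoint β t x) b) +
        1 / 2 * (kern β (shiftPoint β t' x) b * kern β (shiftPoint β t' x) b)) := by
        refine integral_mono (hi t t' b).abs (((hi t t b).const_mul _).add
          ((hi t' t' b).const_mul _)) fun x => ?_
        simp only
        rw [abs_le]
        constructor
        · nlinarith [sq_nonneg (kern β (shiftPoint β t x) b + kern β (shiftPoint β t' x) b)]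
        · nlinarith [sq_nonneg (kern β (shiftPoint β t x) b - kern β (shiftPoint β t' x) b)]
    _ = _ := by
        rw [integral_add ((hi t t b).const_mul _) ((hi t' t' b).const_mul _),
          integral_const_mul, integral_const_mul, hs, hs]
        ring

/-- The measure with density `φ_β`. -/
noncomputable def densityMeasure (β : ℝ) : Measure ℝ :=
  volume.withDensity fun x => ENNReal.ofReal (density β x)

instance : SigmaFinite (densityMeasure β) := by
  unfold densityMeasure
  infer_instance

/-- Inverse transform sampling: a translate of a uniform variable modulo 1 is uniform, and its
quantile lies in (-∞, a] with probability Φ(a). Half-lines determine a finite measure. -/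
lemma measurePreserving_shiftPoint (hβ : 0 < β) (t : ℝ) :
    MeasurePreserving (shiftPoint β t) (volume.restrict (Icc 0 1)) (densityMeasure β) := by
  have hm := measurable_shiftPoint hβ t
  refine ⟨hm, ?_⟩
  have : IsFiniteMeasure (volume.restrict (Icc (0 : ℝ) 1)) := by infer_instance
  have := Measure.isFiniteMeasure_map (volume.restrict (Icc (0 : ℝ) 1)) (shiftPoint β t)
  refine Measure.ext_of_Iic _ _ fun a => ?_
  have hw0 := distFun_pos hβ a
  have hw1 := distFun_lt_one hβ a
  rw [Measure.map_apply hm measurableSet_Iic, densityMeasure,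
    withDensity_apply _ measurableSet_Iic,
    ← ofReal_integral_eq_lintegral_ofReal (integrable_density hβ).integrableOn
      (Eventually.of_forall fun x => (density_pos hβ x).le)]
  change _ = ENNReal.ofReal (distFun β a)
  rw [← ENNReal.ofReal_toReal (measure_ne_top (volume.restrict (Icc (0 : ℝ) 1))
    (shiftPoint β t ⁻¹' Iic a))]
  congr 1
  change (volume.restrict (Icc (0 : ℝ) 1)).real _ = _
  rw [← integral_indicator_one (hm measurableSet_Iic)]
  have e : ∀ x, (shiftPoint β t ⁻¹' Iic a).indicator (1 : ℝ → ℝ) x =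
      (fun y => (Iic a).indicator (1 : ℝ → ℝ) (quantile β (Int.fract y))) (t + x) := fun x => rfl
  refine (integral_congr_ae (Eventually.of_forall e)).trans ((setIntegral_periodic_add
    (g := fun y => (Iic a).indicator (1 : ℝ → ℝ) (quantile β (Int.fract y)))
    (fun x => by simp only [Int.fract_add_one]) t).trans ?_)
  rw [setIntegral_Icc_congr (g := arc (distFun β a)), integral_arc hw0.le hw1.le]
  intro x hx
  have hf : Int.fract x = x := Int.fract_eq_self.2 ⟨hx.1.le, hx.2⟩
  simp only [arc, indicator, mem_Iic, hf, quantile_le_iff hβ hx.1 hx.2, Pi.one_apply]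

lemma pi_densityMeasure (hβ : 0 < β) {s : ℕ} :
    Measure.pi (fun _ : Fin s => densityMeasure β) =
      volume.withDensity fun y : Fin s → ℝ => ENNReal.ofReal (∏ j, density β (y j)) := by
  refine Measure.pi_eq fun S hS => ?_
  have hi : ∀ S : Set ℝ, MeasurableSet S → ∫⁻ x in S, ENNReal.ofReal (density β x) =
      ENNReal.ofReal (∫ x, S.indicator (density β) x) := fun S hS => by
    rw [← ofReal_integral_eq_lintegral_ofReal (integrable_density hβ).integrableOn
      (Eventually.of_forall fun x => (density_pos hβ x).le), integral_indicator hS]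
  have hn : ∀ S : Set ℝ, ∀ x, 0 ≤ S.indicator (density β) x := fun S x =>
    indicator_nonneg (fun y _ => (density_pos hβ y).le) x
  have hSm : MeasurableSet (univ.pi S) := MeasurableSet.univ_pi hS
  rw [withDensity_apply _ hSm,
    ← ofReal_integral_eq_lintegral_ofReal (integrable_prod_density hβ).integrableOn
      (Eventually.of_forall fun x => Finset.prod_nonneg fun j _ => (density_pos hβ _).le),
    ← integral_indicator hSm]
  simp only [densityMeasure, withDensity_apply _ (hS _), hi _ (hS _)]
  rw [← ENNReal.ofReal_prod_of_nonneg fun j _ => integral_nonneg (hn _),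
    ← integral_fintype_prod_volume_eq_prod (fun j x => (S j).indicator (density β) x)]
  congr 2
  funext y
  have h1 : ∀ j, (S j).indicator (density β) (y j) =
      (S j).indicator (1 : ℝ → ℝ) (y j) * density β (y j) := fun j => by
    unfold indicator; split_ifs <;> simp
  simp only [h1]
  rw [Finset.prod_mul_distrib, prod_indicator_one]
  unfold indicator
  split_ifs <;> simp

lemma restrict_Icc_eq_pi {s : ℕ} : (volume : Measure (Fin s → ℝ)).restrict (Icc 0 1) =
    Measure.pi fun _ => volume.restrict (Icc (0 : ℝ) 1) := by
  rw [← Measure.restrict_pi_pi, ← volume_pi]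
  congr 1
  exact (Set.pi_univ_Icc (0 : Fin s → ℝ) 1).symm

/-- Null sets pull back to null sets under shifted points. -/
lemma ae_shiftPoint (hβ : 0 < β) {s : ℕ} {P : (Fin s → ℝ) → Prop} (h : ∀ᵐ y, P y)
    (t : Fin s → ℝ) : ∀ᵐ x ∂(volume : Measure (Fin s → ℝ)).restrict (Icc 0 1),
      P fun j => shiftPoint β (t j) (x j) := by
  have h1 : MeasurePreserving (fun (x : Fin s → ℝ) j => shiftPoint β (t j) (x j))
      (volume.restrict (Icc 0 1)) (Measure.pi fun _ : Fin s => densityMeasure β) := by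
    rw [restrict_Icc_eq_pi]
    exact measurePreserving_pi _ _ fun j => measurePreserving_shiftPoint hβ (t j)
  refine h1.quasiMeasurePreserving.ae ?_
  rw [pi_densityMeasure hβ]
  exact (withDensity_absolutelyContinuous _ _).ae_le h

end
end LatticeQMC

namespace LatticeQMC
open Set Filter Topology

/-! ### The shift-averaged error -/

section
variable {β θ τ : ℝ} {s : ℕ}

/-- The weight functions in the norm of the mixed derivative `∂^{|V|}F/∂y_V`. -/
noncomputable def normWeight (β θ τ : ℝ) (V : Finset (Fin s)) (j : Fin s) (t : ℝ) : ℝ :=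
  if j ∈ V then psiSq θ τ t else density β t

lemma normWeight_pos (hβ : 0 < β) (V : Finset (Fin s)) (j : Fin s) (t : ℝ) :
    0 < normWeight β θ τ V j t := by
  unfold normWeight
  split_ifs
  exacts [psiSq_pos θ τ t, density_pos hβ t]

lemma measurable_normWeight (hβ : 0 < β) (hτ : 0 < τ) (V : Finset (Fin s)) (j : Fin s) :
    Measurable (normWeight β θ τ V j) := by
  unfold normWeight
  by_cases h : j ∈ V
  · simp only [h, if_true]; exact (continuous_psiSq θ hτ).measurable
  · simp only [h, if_false]; exact (continuous_density hβ).measurable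

/-- The univariate factor of the product of two kernels at shifted points. -/
noncomputable def shiftFactor (β θ τ : ℝ) (V : Finset (Fin s)) (t t' : Fin s → ℝ) (j : Fin s)
    (b x : ℝ) : ℝ :=
  (Icc (0 : ℝ) 1).indicator 1 x * (liftKernel β V j (shiftPoint β (t j) x) b *
    liftKernel β V j (shiftPoint β (t' j) x) b / normWeight β θ τ V j b)

lemma measurable_shiftFactor (hβ : 0 < β) (hτ : 0 < τ) (V : Finset (Fin s)) (t t' : Fin s → ℝ)
    (j : Fin s) : Measurable (Function.uncurry (shiftFactor β θ τ V t t' j)) := by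
  have h : ∀ t : ℝ, Measurable fun q : ℝ × ℝ => liftKernel β V j (shiftPoint β t q.2) q.1 :=
    fun t => (measurable_liftKernel hβ V j).comp
      (((measurable_shiftPoint hβ t).comp measurable_snd).prodMk measurable_fst)
  exact ((measurable_one.indicator measurableSet_Icc).comp measurable_snd).mul
    (((h _).mul (h _)).div ((measurable_normWeight hβ hτ V j).comp measurable_fst))

lemma shiftFactor_of_mem {V : Finset (Fin s)} (t t' : Fin s → ℝ) {j : Fin s} (hj : j ∈ V)
    (b x : ℝ) : shiftFactor β θ τ V t t' j b x = (Icc (0 : ℝ) 1).indicator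
      (fun x => kern β (shiftPoint β (t j) x) b * kern β (shiftPoint β (t' j) x) b) x /
        psiSq θ τ b := by
  simp only [shiftFactor, liftKernel, normWeight, hj, if_true]
  unfold indicator
  split_ifs <;> simp

lemma shiftFactor_of_notMem (hβ : 0 < β) {V : Finset (Fin s)} (t t' : Fin s → ℝ) {j : Fin s}
    (hj : j ∉ V) (b x : ℝ) : shiftFactor β θ τ V t t' j b x =
      (Icc (0 : ℝ) 1).indicator (fun _ => density β b) x := by
  have := (density_pos hβ b).ne'
  simp only [shiftFactor, liftKernel, normWeight, hj, if_false]
  unfold indicator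
  split_ifs
  · simp only [Pi.one_apply]; field_simp
  · simp

lemma integrable_shiftFactor (hβ : 0 < β) (V : Finset (Fin s)) (t t' : Fin s → ℝ)
    (j : Fin s) (b : ℝ) : Integrable (shiftFactor β θ τ V t t' j b) := by
  by_cases hj : j ∈ V
  · have := ((integrable_indicator_iff measurableSet_Icc).2
      (integrableOn_kern_mul_kern hβ (t j) (t' j) b)).div_const (psiSq θ τ b)
    simpa only [← shiftFactor_of_mem t t' hj] using! this
  · have : Integrable ((Icc (0 : ℝ) 1).indicator fun _ => density β b) :=
      (integrable_indicator_iff measurableSet_Icc).2 (integrableOn_const (by simp))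
    exact this.congr (Eventually.of_forall fun x => (shiftFactor_of_notMem hβ t t' hj b x).symm)

lemma integral_shiftFactor (hβ : 0 < β) (V : Finset (Fin s)) (t t' : Fin s → ℝ)
    (j : Fin s) (b : ℝ) : ∫ x, shiftFactor β θ τ V t t' j b x =
      if j ∈ V then (max (distFun β b - Int.fract (t j - t' j)) 0 +
        max (distFun β b - (1 - Int.fract (t j - t' j))) 0 - distFun β b ^ 2) / psiSq θ τ b
      else density β b := by
  split_ifs with hj
  · simp only [shiftFactor_of_mem t t' hj]
    rw [integral_div, integral_indicator measurableSet_Icc, integral_kern_mul_kern hβ]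
  · simp only [shiftFactor_of_notMem hβ t t' hj]
    rw [integral_indicator measurableSet_Icc]
    simp

lemma integral_abs_shiftFactor_le (hβ : 0 < β) (V : Finset (Fin s)) (t t' : Fin s → ℝ)
    (j : Fin s) (b : ℝ) : ∫ x, |shiftFactor β θ τ V t t' j b x| ≤
      if j ∈ V then distFun β b * (1 - distFun β b) / psiSq θ τ b else density β b := by
  split_ifs with hj
  · have : ∀ x, |shiftFactor β θ τ V t t' j b x| = (Icc (0 : ℝ) 1).indicator
        (fun x => |kern β (shiftPoint β (t j) x) b * kern β (shiftPoint β (t' j) x) b|) x /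
        psiSq θ τ b := fun x => by
      rw [shiftFactor_of_mem t t' hj, abs_div, abs_of_pos (psiSq_pos θ τ b)]
      unfold indicator
      split_ifs <;> simp
    simp only [this]
    rw [integral_div, integral_indicator measurableSet_Icc]
    have := psiSq_pos θ τ b
    gcongr
    exact integral_abs_kern_mul_kern_le hβ _ _ _
  · have : ∀ x, |shiftFactor β θ τ V t t' j b x| =
        (Icc (0 : ℝ) 1).indicator (fun _ => density β b) x := fun x => by
      rw [shiftFactor_of_notMem hβ t t' hj]
      exact abs_of_nonneg (indicator_nonneg (fun _ _ => (density_pos hβ b).le) x)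
    simp only [this]
    rw [integral_indicator measurableSet_Icc]
    simp

lemma prod_shiftFactor (V : Finset (Fin s)) (t t' : Fin s → ℝ) (b x : Fin s → ℝ) :
    ∏ j, shiftFactor β θ τ V t t' j (b j) (x j) =
      (Icc (0 : Fin s → ℝ) 1).indicator 1 x *
        ((∏ j, liftKernel β V j (shiftPoint β (t j) (x j)) (b j)) *
          (∏ j, liftKernel β V j (shiftPoint β (t' j) (x j)) (b j)) /
            ∏ j, normWeight β θ τ V j (b j)) := by
  simp only [shiftFactor, Finset.prod_mul_distrib, Finset.prod_div_distrib]
  rw [prod_indicator_one (fun _ => Icc (0 : ℝ) 1) x]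
  congr 3
  exact Set.pi_univ_Icc (0 : Fin s → ℝ) 1

/-- Integrating first over the shift gives, in each coordinate of V, the integrand of ϑ. Outside V
the square of the density divided by the weight is the density again and contributes the factor 1.
-/
lemma integral_prod_shiftFactor (hτ : 0 < τ) (hτβ : τ ≤ β) (hθ : 0 < θ)
    (hθβ : τ = β → θ < 1 / β) (V : Finset (Fin s)) (t t' : Fin s → ℝ) :
    Integrable (fun q : (Fin s → ℝ) × (Fin s → ℝ) =>
        ∏ j, shiftFactor β θ τ V t t' j (q.1 j) (q.2 j)) (volume.prod volume) ∧
      ∫ q : (Fin s → ℝ) × (Fin s → ℝ), ∏ j, shiftFactor β θ τ V t t' j (q.1 j) (q.2 j)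
          ∂(volume.prod volume) =
        ∏ j ∈ V, shiftKernel β θ τ (Int.fract (t j - t' j)) := by
  have hβ : 0 < β := hτ.trans_le hτβ
  have key := integrable_mul_prod_kernel (f := fun _ : Fin s → ℝ => (1 : ℝ))
    (m := shiftFactor β θ τ V t t') aestronglyMeasurable_const
    (measurable_shiftFactor hβ hτ V t t') (integrable_shiftFactor hβ V t t') ?_
  · simp only [one_mul] at key
    refine ⟨key.1, key.2.trans ?_⟩
    rw [integral_fintype_prod_volume_eq_prod
      (fun j b => ∫ x, shiftFactor β θ τ V t t' j b x),
      ← Finset.prod_subset (Finset.subset_univ V)]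
    · refine Finset.prod_congr rfl fun j hj => ?_
      simp only [integral_shiftFactor hβ, hj, if_true]
      rfl
    · intro j _ hj
      simp only [integral_shiftFactor hβ, hj, if_false, integral_density hβ]
  · simp only [one_mul]
    refine integrable_prod_coord (p := fun j b => ∫ x, |shiftFactor β θ τ V t t' j b x|)
      fun j => ?_
    have hi : Integrable fun b => if j ∈ V then distFun β b * (1 - distFun β b) / psiSq θ τ b
        else density β b := by
      by_cases hj : j ∈ V
      · simp only [hj, if_true]; exact integrable_distFun_mul_div hτ hτβ hθ hθβ
      · simp only [hj, if_false]; exact integrable_density hβ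
    refine hi.mono' (measurable_integral_abs
      (measurable_shiftFactor hβ hτ V t t' j)).aestronglyMeasurable
      (Eventually.of_forall fun b => ?_)
    rw [Real.norm_eq_abs, abs_of_nonneg (integral_nonneg fun x => abs_nonneg _)]
    exact integral_abs_shiftFactor_le hβ V t t' j b

variable {n : ℕ}

/-- The kernel of the quadrature error, at the shift `x`. -/
noncomputable def errorKernel (β : ℝ) (n : ℕ) (z : Fin s → ℕ) (V : Finset (Fin s))
    (x b : Fin s → ℝ) : ℝ :=
  1 / n * ∑ i ∈ Finset.Icc 1 n,
    ∏ j, liftKernel β V j (shiftPoint β (latticePoint n z i j) (x j)) (b j)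

/-- The squared norm of the kernel of the quadrature error, at the shift `x`. -/
noncomputable def errorNormSq (β θ τ : ℝ) (n : ℕ) (z : Fin s → ℕ) (V : Finset (Fin s))
    (x : Fin s → ℝ) : ℝ :=
  ∫ b, errorKernel β n z V x b ^ 2 / ∏ j, normWeight β θ τ V j (b j)

lemma indicator_mul_errorKernel_sq (z : Fin s → ℕ) (V : Finset (Fin s)) (b x : Fin s → ℝ) :
    (Icc (0 : Fin s → ℝ) 1).indicator 1 x *
        (errorKernel β n z V x b ^ 2 / ∏ j, normWeight β θ τ V j (b j)) =
      1 / (n : ℝ) ^ 2 * ∑ i ∈ Finset.Icc 1 n, ∑ i' ∈ Finset.Icc 1 n,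
        ∏ j, shiftFactor β θ τ V (latticePoint n z i) (latticePoint n z i') j (b j) (x j) := by
  simp only [prod_shiftFactor]
  rw [errorKernel, mul_pow, sq (∑ i ∈ Finset.Icc 1 n, _), Finset.sum_mul_sum]
  simp only [← Finset.mul_sum, ← Finset.sum_div]
  ring

/-- The lattice points form a group modulo 1, so the double sum depends only on i - i' and every i'
contributes the same single sum. -/
lemma sum_sum_shiftKernel [NeZero n] (z : Fin s → ℕ) (V : Finset (Fin s)) :
    1 / (n : ℝ) ^ 2 * ∑ i ∈ Finset.Icc 1 n, ∑ i' ∈ Finset.Icc 1 n, ∏ j ∈ V,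
      shiftKernel β θ τ (Int.fract (latticePoint n z i j - latticePoint n z i' j)) =
      latticeMean β θ τ n V z := by
  have h : ∀ i i' j, shiftKernel β θ τ
      (Int.fract (latticePoint n z i j - latticePoint n z i' j)) =
      kernelMod β θ τ (((i : ZMod n) - (i' : ZMod n)) * (z j : ZMod n)) := fun i i' j => by
    have h1 := shiftKernel_fract_div (β := β) (θ := θ) (τ := τ) (n := n)
      (((i : ℤ) - i') * z j)
    push_cast at h1
    rw [← h1]
    congr 1
    rw [Int.fract_eq_fract]
    refine ⟨⌊(i' : ℝ) * z j / n⌋ - ⌊(i : ℝ) * z j / n⌋, ?_⟩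
    simp only [latticePoint, Int.fract]
    push_cast
    ring
  simp only [h]
  have h2 := sum_Icc_natCast (n := n) fun a => ∑ i' ∈ Finset.Icc 1 n, ∏ j ∈ V,
    kernelMod β θ τ ((a - (i' : ZMod n)) * (z j : ZMod n))
  rw [h2, Finset.sum_comm]
  have h3 : ∀ c : ZMod n, ∑ a : ZMod n, ∏ j ∈ V, kernelMod β θ τ ((a - c) * (z j : ZMod n)) =
      ∑ a : ZMod n, ∏ j ∈ V, kernelMod β θ τ (a * (z j : ZMod n)) := fun c =>
    Fintype.sum_equiv (Equiv.subRight c) _ _ fun a => rfl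
  simp only [h3, Finset.sum_const, Nat.card_Icc, Nat.add_sub_cancel, nsmul_eq_mul, latticeMean]
  have : (n : ℝ) ≠ 0 := Nat.cast_ne_zero.2 (NeZero.ne n)
  field_simp

lemma integral_indicator_mul_errorKernel_sq [NeZero n] (hτ : 0 < τ) (hτβ : τ ≤ β) (hθ : 0 < θ)
    (hθβ : τ = β → θ < 1 / β) (z : Fin s → ℕ) (V : Finset (Fin s)) :
    Integrable (fun q : (Fin s → ℝ) × (Fin s → ℝ) => (Icc (0 : Fin s → ℝ) 1).indicator 1 q.2 *
        (errorKernel β n z V q.2 q.1 ^ 2 / ∏ j, normWeight β θ τ V j (q.1 j)))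
        (volume.prod volume) ∧
      ∫ q : (Fin s → ℝ) × (Fin s → ℝ), (Icc (0 : Fin s → ℝ) 1).indicator 1 q.2 *
        (errorKernel β n z V q.2 q.1 ^ 2 / ∏ j, normWeight β θ τ V j (q.1 j))
        ∂(volume.prod volume) = latticeMean β θ τ n V z := by
  have h := fun i i' => integral_prod_shiftFactor hτ hτβ hθ hθβ V (latticePoint n z i)
    (latticePoint n z i')
  simp only [indicator_mul_errorKernel_sq]
  refine ⟨(integrable_finsetSum _ fun i _ => integrable_finsetSum _ fun i' _ =>
    (h i i').1).const_mul _, ?_⟩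
  rw [integral_const_mul, integral_finsetSum _ fun i _ => integrable_finsetSum _ fun i' _ =>
    (h i i').1, ← sum_sum_shiftKernel]
  congr 1
  refine Finset.sum_congr rfl fun i _ => ?_
  rw [integral_finsetSum _ fun i' _ => (h i i').1]
  exact Finset.sum_congr rfl fun i' _ => (h i i').2

lemma ae_integrable_errorKernel_sq [NeZero n] (hτ : 0 < τ) (hτβ : τ ≤ β) (hθ : 0 < θ)
    (hθβ : τ = β → θ < 1 / β) (z : Fin s → ℕ) (V : Finset (Fin s)) :
    ∀ᵐ x ∂(volume : Measure (Fin s → ℝ)).restrict (Icc 0 1), Integrable fun b =>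
      errorKernel β n z V x b ^ 2 / ∏ j, normWeight β θ τ V j (b j) := by
  have h := (integral_indicator_mul_errorKernel_sq (n := n) hτ hτβ hθ hθβ z V).1.prod_left_ae
  rw [ae_restrict_iff' measurableSet_Icc]
  filter_upwards [h] with x hx hxI
  simpa [indicator_of_mem hxI] using hx

lemma integral_errorNormSq [NeZero n] (hτ : 0 < τ) (hτβ : τ ≤ β) (hθ : 0 < θ)
    (hθβ : τ = β → θ < 1 / β) (z : Fin s → ℕ) (V : Finset (Fin s)) :
    IntegrableOn (errorNormSq β θ τ n z V) (Icc 0 1) ∧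
      ∫ x in Icc 0 1, errorNormSq β θ τ n z V x = latticeMean β θ τ n V z := by
  obtain ⟨h1, h2⟩ := integral_indicator_mul_errorKernel_sq (n := n) hτ hτβ hθ hθβ z V
  have e : ∀ x : Fin s → ℝ, ∫ b, (Icc (0 : Fin s → ℝ) 1).indicator 1 x *
        (errorKernel β n z V x b ^ 2 / ∏ j, normWeight β θ τ V j (b j)) =
      (Icc (0 : Fin s → ℝ) 1).indicator (errorNormSq β θ τ n z V) x := fun x => by
    rw [integral_const_mul]
    unfold indicator
    split_ifs <;> simp [errorNormSq]
  have h3 := h1.integral_prod_right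
  rw [integral_prod_symm _ h1] at h2
  simp only [e] at h2 h3
  rw [integral_indicator measurableSet_Icc] at h2
  exact ⟨(integrable_indicator_iff measurableSet_Icc).1 h3, h2⟩

/-- The quadratic polynomial c ↦ ∫ (cfρ + g)²/ρ is nonnegative, so its discriminant is nonpositive.
-/
lemma sq_integral_mul_le {X : Type*} [MeasurableSpace X] {μ : Measure X} {f g ρ : X → ℝ}
    (hρ : ∀ x, 0 < ρ x) (hf : Integrable (fun x => f x ^ 2 * ρ x) μ)
    (hg : Integrable (fun x => g x ^ 2 / ρ x) μ) (hfg : Integrable (fun x => f x * g x) μ) :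
    (∫ x, f x * g x ∂μ) ^ 2 ≤ (∫ x, f x ^ 2 * ρ x ∂μ) * ∫ x, g x ^ 2 / ρ x ∂μ := by
  have h : ∀ c : ℝ, 0 ≤ (∫ x, f x ^ 2 * ρ x ∂μ) * (c * c) + (2 * ∫ x, f x * g x ∂μ) * c +
      ∫ x, g x ^ 2 / ρ x ∂μ := fun c => by
    have i1 : Integrable (fun x => c * c * (f x ^ 2 * ρ x) + 2 * c * (f x * g x)) μ :=
      (hf.const_mul _).add (hfg.const_mul _)
    have : ∫ x, (c * c * (f x ^ 2 * ρ x) + 2 * c * (f x * g x) + g x ^ 2 / ρ x) ∂μ =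
        (∫ x, f x ^ 2 * ρ x ∂μ) * (c * c) + (2 * ∫ x, f x * g x ∂μ) * c +
          ∫ x, g x ^ 2 / ρ x ∂μ := by
      rw [integral_add i1 hg, integral_add (hf.const_mul _) (hfg.const_mul _),
        integral_const_mul, integral_const_mul]
      ring
    rw [← this]
    refine integral_nonneg fun x => ?_
    have hx := hρ x
    have e : c * c * (f x ^ 2 * ρ x) + 2 * c * (f x * g x) + g x ^ 2 / ρ x =
        (c * f x * ρ x + g x) ^ 2 / ρ x := by
      field_simp
      ring
    simp only [Pi.zero_apply]
    rw [e]
    positivity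
  have := discrim_le_zero h
  rw [discrim] at this
  nlinarith

end
end LatticeQMC

/-! ### The mean square error of the randomly shifted rule -/

namespace LatticeQMC
open Set Filter Topology

section
variable {β θ τ : ℝ} {s n : ℕ} {F : (Fin s → ℝ) → ℝ}

lemma MemSobolev.ae_integrable_meanDeriv_mul (hτ : 0 < τ) (hτβ : τ ≤ β) (hθ : 0 < θ)
    (hθβ : τ = β → θ < 1 / β) (hF : MemSobolev β θ τ F) (V : Finset (Fin s)) :
    ∀ᵐ y : Fin s → ℝ, Integrable fun b =>
      meanDeriv β F V b * ∏ j, liftKernel β V j (y j) (b j) := by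
  have hβ : 0 < β := hτ.trans_le hτβ
  have h := (liftOp_pairing hβ (fun _ => dominated_density hβ)
    (hF.liftable_meanDeriv hτ hτβ hθ hθβ (subset_refl V))).1
  filter_upwards [h.prod_right_ae] with y hy
  have hpos : ∏ j, density β (y j) ≠ 0 := (Finset.prod_pos fun j _ => density_pos hβ _).ne'
  refine (hy.mul_const (∏ j, density β (y j))⁻¹).congr (Eventually.of_forall fun b => ?_)
  have e : V.piecewise b y = Vᶜ.piecewise y b := (Finset.piecewise_compl V y b).symm
  simp only
  rw [e, meanDeriv_piecewise V (Finset.disjoint_left.2 fun j hj => Finset.mem_compl.1 hj) y b,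
    mul_assoc, mul_inv_cancel₀ hpos, mul_one]

/-- The error of the shifted lattice rule in terms of the averaged mixed derivatives. -/
lemma MemSobolev.ae_error_eq [NeZero n] (hτ : 0 < τ) (hτβ : τ ≤ β) (hθ : 0 < θ)
    (hθβ : τ = β → θ < 1 / β) (hF : MemSobolev β θ τ F) (z : Fin s → ℕ) :
    ∀ᵐ x ∂(volume : Measure (Fin s → ℝ)).restrict (Icc 0 1),
      (∀ V : Finset (Fin s), Integrable fun b => meanDeriv β F V b * errorKernel β n z V x b) ∧
      integralS β F - latticeRule β n z x F =
        -∑ V ∈ Finset.univ.erase ∅, ∫ b, meanDeriv β F V b * errorKernel β n z V x b := by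
  have hβ : 0 < β := hτ.trans_le hτβ
  -- The representation holds off a null set, whose preimage under each shifted lattice point is a
  -- null set of shifts; countably many indices are handled at once.
  have h1 := ae_all_iff.2 fun i : ℕ => ae_shiftPoint hβ
    (hF.ae_eq_integralS_add hτ hτβ hθ hθβ) (latticePoint n z i)
  have h2 := ae_all_iff.2 fun i : ℕ => ae_shiftPoint hβ
    (ae_all_iff.2 (hF.ae_integrable_meanDeriv_mul hτ hτβ hθ hθβ)) (latticePoint n z i)
  filter_upwards [h1, h2] with x h1 h2
  have e : ∀ V b, meanDeriv β F V b * errorKernel β n z V x b = 1 / n * ∑ i ∈ Finset.Icc 1 n,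
      meanDeriv β F V b *
        ∏ j, liftKernel β V j (shiftPoint β (latticePoint n z i j) (x j)) (b j) := fun V b => by
    rw [errorKernel, ← Finset.mul_sum]
    ring
  simp only [e]
  refine ⟨fun V => (integrable_finsetSum _ fun i _ => h2 i V).const_mul _, ?_⟩
  have e2 : ∀ V : Finset (Fin s), ∫ b, 1 / (n : ℝ) * ∑ i ∈ Finset.Icc 1 n, meanDeriv β F V b *
        ∏ j, liftKernel β V j (shiftPoint β (latticePoint n z i j) (x j)) (b j) =
      1 / (n : ℝ) * ∑ i ∈ Finset.Icc 1 n, ∫ b, meanDeriv β F V b *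
        ∏ j, liftKernel β V j (shiftPoint β (latticePoint n z i j) (x j)) (b j) := fun V => by
    rw [integral_const_mul, integral_finsetSum _ fun i _ => h2 i V]
  have e3 : latticeRule β n z x F = 1 / n * ∑ i ∈ Finset.Icc 1 n,
      F fun j => shiftPoint β (latticePoint n z i j) (x j) := rfl
  simp only [e2, e3, h1]
  -- The constant term of the expansion is reproduced exactly by the rule and cancels against the
  -- integral.
  rw [← Finset.mul_sum, Finset.sum_comm (s := Finset.univ.erase ∅), Finset.sum_add_distrib,
    Finset.sum_const, Nat.card_Icc, Nat.add_sub_cancel, nsmul_eq_mul]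
  have : (n : ℝ) ≠ 0 := Nat.cast_ne_zero.2 (NeZero.ne n)
  field_simp
  ring

lemma outerIntegral_nonneg (V : Finset (Fin s)) : 0 ≤ ∫ a, outerIntegrand β θ τ V F a :=
  integral_nonneg fun _ => mul_nonneg (sq_nonneg _)
    (Finset.prod_nonneg fun _ _ => (psiSq_pos _ _ _).le)

/-- The pointwise bound of the error by the Cauchy–Schwarz inequality. -/
lemma MemSobolev.ae_sq_error_le [NeZero n] (hτ : 0 < τ) (hτβ : τ ≤ β) (hθ : 0 < θ)
    (hθβ : τ = β → θ < 1 / β) (hF : MemSobolev β θ τ F) {γ : Finset (Fin s) → ℝ}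
    (hγ : ∀ u, 0 < γ u) (z : Fin s → ℕ) :
    ∀ᵐ x ∂(volume : Measure (Fin s → ℝ)).restrict (Icc 0 1),
      |integralS β F - latticeRule β n z x F| ^ 2 ≤ sobolevNorm β θ τ γ F ^ 2 *
        ∑ V ∈ Finset.univ.erase ∅, γ V * errorNormSq β θ τ n z V x := by
  have hβ : 0 < β := hτ.trans_le hτβ
  filter_upwards [hF.ae_error_eq (n := n) hτ hτβ hθ hθβ z,
    ae_all_iff.2 (ae_integrable_errorKernel_sq (n := n) hτ hτβ hθ hθβ z)] with x h1 h2
  rw [h1.2, sq_abs, neg_sq]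
  have hP : ∀ (V : Finset (Fin s)) (b : Fin s → ℝ), 0 < ∏ j, normWeight β θ τ V j (b j) :=
    fun V b => Finset.prod_pos fun j _ => normWeight_pos hβ V j _
  have hW : ∀ V, 0 ≤ errorNormSq β θ τ n z V x := fun V =>
    integral_nonneg fun b => div_nonneg (sq_nonneg _) (hP V b).le
  have hcs : ∀ V : Finset (Fin s), (∫ b, meanDeriv β F V b * errorKernel β n z V x b) ^ 2 ≤
      (∫ a, outerIntegrand β θ τ V F a) * errorNormSq β θ τ n z V x := fun V => by
    have := sq_integral_mul_le (hP V) (hF.integrable_meanDeriv_sq hβ V) (h2 V) (h1.1 V)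
    exact this.trans_eq (congrArg (· * _) (integral_meanDeriv_sq hβ V))
  have hsum : ∑ V ∈ (Finset.univ : Finset (Finset (Fin s))).erase ∅,
      1 / γ V * ∫ a, outerIntegrand β θ τ V F a ≤ sobolevNorm β θ τ γ F ^ 2 := by
    have hn : ∀ V, 0 ≤ 1 / γ V * ∫ a, outerIntegrand β θ τ V F a := fun V =>
      mul_nonneg (one_div_nonneg.2 (hγ V).le) (outerIntegral_nonneg V)
    rw [sobolevNorm, Real.sq_sqrt (Finset.sum_nonneg fun V _ => hn V)]
    exact Finset.sum_le_sum_of_subset_of_nonneg (Finset.erase_subset _ _) fun V _ _ => hn V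
  -- A second Cauchy–Schwarz inequality, over the sets V, with 1/γ_V placed on the norms and γ_V on
  -- the error kernels.
  refine (Finset.sum_sq_le_sum_mul_sum_of_sq_le_mul _
    (f := fun V => 1 / γ V * ∫ a, outerIntegrand β θ τ V F a)
    (g := fun V => γ V * errorNormSq β θ τ n z V x) (fun V _ => ?_) (fun V _ => ?_)
    fun V _ => ?_).trans (mul_le_mul_of_nonneg_right hsum ?_)
  · exact mul_nonneg (one_div_nonneg.2 (hγ V).le) (outerIntegral_nonneg V)
  · exact mul_nonneg (hγ V).le (hW V)
  · refine (hcs V).trans_eq ?_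
    have := (hγ V).ne'
    field_simp
  · exact Finset.sum_nonneg fun V _ => mul_nonneg (hγ V).le (hW V)

lemma measurable_latticeRule (hβ : 0 < β) (hF : Continuous F) (z : Fin s → ℕ) :
    Measurable fun x => latticeRule β n z x F := by
  refine (Finset.measurable_sum _ fun i _ => ?_).const_mul _
  exact hF.measurable.comp (measurable_pi_lambda _ fun j =>
    (measurable_shiftPoint hβ (latticePoint n z i j)).comp (measurable_pi_apply j))

/-- The mean square error of the randomly shifted lattice rule. -/
theorem MemSobolev.integral_sq_error_le [NeZero n] (hτ : 0 < τ) (hτβ : τ ≤ β) (hθ : 0 < θ)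
    (hθβ : τ = β → θ < 1 / β) (hF : MemSobolev β θ τ F) {γ : Finset (Fin s) → ℝ}
    (hγ : ∀ u, 0 < γ u) (z : Fin s → ℕ) :
    IntegrableOn (fun x => |integralS β F - latticeRule β n z x F| ^ 2) (Icc 0 1) ∧
      ∫ x in Icc 0 1, |integralS β F - latticeRule β n z x F| ^ 2 ≤
        sobolevNorm β θ τ γ F ^ 2 *
          ∑ V ∈ Finset.univ.erase ∅, γ V * latticeMean β θ τ n V z := by
  have hβ : 0 < β := hτ.trans_le hτβ
  have hE := fun V => integral_errorNormSq (n := n) hτ hτβ hθ hθβ z V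
  have hle := hF.ae_sq_error_le (n := n) hτ hτβ hθ hθβ hγ z
  have hi : IntegrableOn (fun x => sobolevNorm β θ τ γ F ^ 2 *
      ∑ V ∈ Finset.univ.erase ∅, γ V * errorNormSq β θ τ n z V x) (Icc 0 1) :=
    (integrable_finsetSum _ fun V _ => (hE V).1.const_mul (γ V)).const_mul _
  have hint : IntegrableOn (fun x => |integralS β F - latticeRule β n z x F| ^ 2) (Icc 0 1) := by
    refine Integrable.mono' hi ?_ ?_
    · have := measurable_latticeRule (n := n) hβ hF.continuous z
      exact ((measurable_const.sub this).abs.pow_const 2).aestronglyMeasurable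
    · filter_upwards [hle] with x hx
      rwa [Real.norm_eq_abs, abs_of_nonneg (sq_nonneg _)]
  refine ⟨hint, (integral_mono_ae hint hi hle).trans_eq ?_⟩
  rw [integral_const_mul, integral_finsetSum _ fun V _ => (hE V).1.const_mul (γ V)]
  simp only [integral_const_mul, (hE _).2]

end
end LatticeQMC

theorem mainTheorem3 {s n : ℕ} (hn : 2 ≤ n) {β θ τ : ℝ}
    (hτ : 0 < τ) (hτβ : τ ≤ β) (hθ : 0 < θ) (hθβ : τ = β → θ < 1 / β)
    (γ : Finset (Fin s) → ℝ) (hγ : ∀ u, 0 < γ u) :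
    (∃ z : Fin s → ℕ, IsCBC β θ τ γ n z) ∧
    ∀ z : Fin s → ℕ, IsCBC β θ τ γ n z →
      ∀ F : (Fin s → ℝ) → ℝ, MemSobolev β θ τ F →
        IntegrableOn (fun Δ : Fin s → ℝ => |integralS β F - latticeRule β n z Δ F| ^ 2)
          (Set.Icc 0 1) ∧
        ∀ r : ℝ, 1 / 2 < r → (τ < β → r < 1) → (τ = β → r < 1 - θ * β / 2) →
          ∀ lam : ℝ, 1 / (2 * r) < lam → lam ≤ 1 →
            Real.sqrt (∫ Δ in Set.Icc (0 : Fin s → ℝ) 1,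
                |integralS β F - latticeRule β n z Δ F| ^ 2) ≤
              (1 / (n.totient : ℝ) *
                  ∑ u ∈ (Finset.univ : Finset (Finset (Fin s))).erase ∅,
                    γ u ^ lam * constK β θ τ r ^ (lam * u.card) *
                      (2 * (riemannZeta ((2 * r * lam : ℝ) : ℂ)).re) ^ u.card)
                ^ (1 / (2 * lam)) *
              sobolevNorm β θ τ γ F := by
  have : NeZero n := ⟨by omega⟩
  refine ⟨exists_isCBC hn γ, fun z hz F hF => ?_⟩
  obtain ⟨hint, hle⟩ := hF.integral_sq_error_le (n := n) hτ hτβ hθ hθβ hγ z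
  refine ⟨hint, fun r hr hr1 hr2 lam hlam hlam1 => ?_⟩
  obtain ⟨h0, hb⟩ := sum_latticeMean_rpow_le hn hτ hτβ hθ hθβ hγ hz hr hr1 hr2 hlam hlam1
  have hlam0 : 0 < lam := lt_trans (by positivity) hlam
  have hN : 0 ≤ sobolevNorm β θ τ γ F := Real.sqrt_nonneg _
  refine (Real.sqrt_le_sqrt hle).trans ?_
  rw [Real.sqrt_mul (sq_nonneg _), Real.sqrt_sq hN, mul_comm]
  refine mul_le_mul_of_nonneg_right ?_ hN
  -- The square root is the power 1/(2λ) of the λ-th power, for which the bound on the lattice means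
  -- is stated.
  refine le_trans (le_of_eq ?_)
    (Real.rpow_le_rpow (Real.rpow_nonneg h0 lam) hb (by positivity : 0 ≤ 1 / (2 * lam)))
  rw [← Real.rpow_mul h0, Real.sqrt_eq_rpow]
  congr 1
  field_simp
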